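/- **Setting.** Let $e_1,e_2,e_3$ be the (distinct) branch points of the Weierstrass curve $z^2=4(Z-e_1)(Z-e_2)(Z-e_3)$ of a period lattice, put $e=e_1$, $g=(e_1-e_2)(e_1-e_3)$, fix a square root $\sqrt g$, and parametrise the elliptic curve $k^2=K+3e+g/K$ by $K=\wp(\kappa)-e$, $k=\tfrac12\wp'(\kappa)/(\wp(\kappa)-e)$; write $k',K'$ for the values at $\kappa'$. For $n\in\mathbb Z$ let $$\rho_n(\kappa)=\exp\Big\{\sum_{j\ge0}k^{2j+1}x_{2j+1}+\sum_{j\ge1}\big[K^j-(g/K)^j\big]x_{2j}\Big\}\Big(\frac{K}{\sqrt g}\Big)^n,\qquad \Omega(\kappa,\kappa')=\frac{K-K'}{k+k'}=\frac{k-k'}{1-g/(KK')},$$ where $x_1,x_2,x_3$ are real variables and the other times are frozen, finitely many being nonzero. Let $d\zeta(\kappa,\kappa')=-d\zeta(\kappa',\kappa)$ be an antisymmetric complex measure of the form $a\,d\mu$ with $\mu$ a swap-invariant $\sigma$-finite measure and $a$ an antisymmetric measurable function, and let $S$ be a set of parameters $\kappa$ with $k,K,1/K$ finite such that $d\zeta$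 is concentrated on $S\times S$ and, for every $\kappa\in S$, the poles of $\Omega(\kappa,\cdot)$ are negligible. The vector $\boldsymbol c(\kappa)$ has the components $c^{[2i]}=K^i$, $c^{[2i+1]}=kK^i$ $(i\in\mathbb Z)$. On an open set $X$ of values of $(x_1,x_2,x_3)$ let $\boldsymbol u_n(\kappa)$, $n\in\mathbb Z$, $\kappa\in S$, be a solution of $$\boldsymbol u_n(\kappa)+\iint d\zeta(\lambda,\lambda')\,\rho_n(\kappa)\Omega(\kappa,\lambda')\rho_n(\lambda')\boldsymbol u_n(\lambda)=\rho_n(\kappa)\boldsymbol c(\kappa)$$ for which the homogeneous equation has only the zero solution (for each $n$ and each $x\in X$, in the class of measurable functions with absolutely convergent integrals). The components of $\boldsymbol u_n(\kappa)$ are assumed measurable in $\kappa$ and continuously differentiable in $(x_1,x_2,x_3)$, and the following integrals converge absolutely, locally uniformly dominated in $x$: for any finitely many labels there are, near each point of $X$, $x$-independent functions $b$ (bounding the components $u_n^{[i]}$ and their gradients) and $r$ (bounding the components $\rho_nc^{[i]}$) such that $|a(\lambda,\lambda')|\,b(\lambda)r(\lambda')$, $|a(\lambda,\lambda')|\,b(\lambda)|\Omega(\kappa,\lambda')|r(\lambda')$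 (each $\kappa\in S$) and $|a(\kappa,\kappa')a(\lambda,\lambda')|\,b(\kappa)r(\kappa')|\Omega(\kappa',\lambda')|r(\lambda')b(\lambda)$ are integrable. Put $$U_n^{[i,j]}=\iint d\zeta(\kappa,\kappa')\,u_n^{[i]}(\kappa)c^{[j]}(\kappa')\rho_n(\kappa'),\quad u_n=U_n^{[2,0]},\quad v_n=1+g^{-1}U_n^{[3,2]},\quad w_n=1-U_n^{[1,0]},\quad \phi_n=u_n^{[0]}(\kappa).$$ Below $\partial_i\ln f$ means $(\partial_if)/f$. **Theorem.** (1) For every $n\in\mathbb Z$ and $\kappa\in S$, the functions $u_n,v_n,w_n,\phi_n$ are smooth on $X$, $v_n$ and $w_n$ have no zeros there, and $$\partial_2\phi_n=-\left[\partial_1^2+2(\partial_1u_n)-3e\right]\phi_n+2\sqrt g\,v_nw_n\phi_{n+1},$$ $$\partial_3\phi_n=\left[\partial_1^3+3(\partial_1u_n)\partial_1+\tfrac32\left(\partial_1^2u_n-\partial_2u_n\right)\right]\phi_n-3\sqrt g\,v_n(\partial_1w_n)\phi_{n+1},$$ $$\sqrt g\,v_nw_n\phi_{n+1}+\sqrt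 g\,\phi_{n-1}=\left[\partial_1^2-(\partial_1\ln w_n)\partial_1+2(\partial_1u_n)-3e+\tfrac12\left(\partial_1^2\ln w_n+(\partial_1\ln w_n)^2+\partial_2\ln w_n\right)\right]\phi_n .$$ (2) Moreover $\Phi=(\phi_n,\phi_{n+1})^{T}$ satisfies $\partial_2\Phi=\boldsymbol P\Phi$ and $\partial_3\Phi=\boldsymbol Q\Phi$ with $u=u_n$, $v=v_n$, $w=w_n$, where, with $q=\partial_1^2\ln v+(\partial_1\ln v)^2-\partial_2\ln v$, $$\boldsymbol P=\begin{pmatrix}-\partial_1^2-2(\partial_1u)+3e&2\sqrt g\,vw\\-2\sqrt g&\partial_1^2+2(\partial_1\ln v)\partial_1+2(\partial_1u)-3e+q\end{pmatrix},$$ $$\boldsymbol Q=\begin{pmatrix}\partial_1^3+3(\partial_1u)\partial_1+\frac32(\partial_1^2u-\partial_2u)&-3\sqrt g\,v(\partial_1w)\\-3\sqrt g\,\partial_1\ln v&Q_{22}\end{pmatrix},$$ $$Q_{22}=\partial_1^3+3(\partial_1\ln v)\partial_1^2+3\left(\partial_1u+\partial_1^2\ln v+(\partial_1\ln v)^2\right)\partial_1+\tfrac32(\partial_1^2u-\partial_2u)+3(\partial_1\ln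 v)(2\partial_1u-3e)+\tfrac32\left((\partial_1q)+(\partial_1\ln v)\,q\right).$$ (3) Let $u,v,w$ be arbitrary smooth complex functions on an open set of $\mathbb R^3$, $v$ without zeros. The zero curvature equation $\partial_3\boldsymbol P-\partial_2\boldsymbol Q+[\boldsymbol P,\boldsymbol Q]=0$ (as an identity of operators on smooth two-component functions) holds if and only if there are smooth functions $s,a$ with $\partial_1s=\partial_2^2u$ (i.e. $s=\partial_1^{-1}\partial_2^2u$) and $\partial_1a=\partial_2a=0$ such that $$\partial_3u=\tfrac14\partial_1^3u+\tfrac32(\partial_1u)^2+\tfrac34s+3g(1-vw),$$ $$\partial_3v=-\tfrac12\partial_1^3v-3(\partial_1u-3e)\partial_1v+\tfrac32\partial_1\partial_2v+3(\partial_2u)v+a\,v,$$ $$\partial_3w=-\tfrac12\partial_1^3w-3(\partial_1u-3e)\partial_1w-\tfrac32\partial_1\partial_2w-3(\partial_2u)w-a\,w .$$ If $u,v,w$ are smooth on all of $\mathbb R^3$, $v$ has no zeros, and $u$, $v-1$, $w-1$ tend to $0$ together with their partial derivatives of order at most three as $x_1\to-\infty$ (or as $x_1\to+\infty$) for fixed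 $x_2,x_3$, then the zero curvature equation is equivalent to the elliptic coupled KP system, that is, to these three equations with $a=0$ and with $s=\partial_1^{-1}\partial_2^2u$ vanishing at that end. -/

import Mathlib

open MeasureTheory Filter Topology
open scoped ContDiff

noncomputable section

namespace EllipticKP

/-! ### The elliptic curve -/

/-- The Weierstrass curve `z² = 4 (Z - e₁) (Z - e₂) (Z - e₃)` of a period lattice, with its three
(distinct) branch points labelled, and a chosen square root of `g = (e₁ - e₂) (e₁ - e₃)`. -/
structure Curve where
  L : PeriodPair
  e₁ : ℂ
  e₂ : ℂ
  e₃ : ℂ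
  branch : ∀ z : ℂ, 4 * z ^ 3 - L.g₂ * z - L.g₃ = 4 * (z - e₁) * (z - e₂) * (z - e₃)
  ne₁₂ : e₁ ≠ e₂
  ne₁₃ : e₁ ≠ e₃
  ne₂₃ : e₂ ≠ e₃
  sqrtg : ℂ
  sqrtg_sq : sqrtg ^ 2 = (e₁ - e₂) * (e₁ - e₃)

namespace Curve

variable (C : Curve)

/-- The modulus `e = e₁`. -/
def e : ℂ := C.e₁

/-- The modulus `g = (e₁ - e₂) (e₁ - e₃)`. -/
def g : ℂ := (C.e₁ - C.e₂) * (C.e₁ - C.e₃)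

/-- The coordinate `K = ℘(κ) - e`. -/
def K (κ : ℂ) : ℂ := C.L.weierstrassP κ - C.e

/-- The coordinate `k = (1/2) ℘'(κ) / (℘(κ) - e)`. -/
def k (κ : ℂ) : ℂ := (1 / 2) * (C.L.derivWeierstrassP κ / (C.L.weierstrassP κ - C.e))

/-- The values of the uniformising parameter at which `k`, `K` and `1 / K` are finite. -/
def regular : Set ℂ := {κ | κ ∉ C.L.lattice ∧ C.L.weierstrassP κ ≠ C.e}

/-- The components of the vector `c(κ)` in the elliptic labelling. The vector is the joint
eigenvector of the index-raising operators of order one and two, with eigenvalues `k` and `K`, and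
has `0`-th entry `1`, so that `c^[2i] = K ^ i` and `c^[2i+1] = k K ^ i` (integer division rounds
down, also for negative labels). -/
def c (κ : ℂ) (i : ℤ) : ℂ :=
  if Even i then C.K κ ^ (i / 2) else C.k κ * C.K κ ^ (i / 2)

/-- The coefficient of the time `x_j` in the exponent of the plane wave factor: `k ^ j` for odd
`j`, and `K ^ (j/2) - (g / K) ^ (j/2)` for even `j`. -/
def dispersion (j : ℕ) (κ : ℂ) : ℂ :=
  if Even j then C.K κ ^ (j / 2) - (C.g / C.K κ) ^ (j / 2) else C.k κ ^ j

/-- The skew-symmetric Cauchy kernel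
`Ω(κ, κ') = (K - K') / (k + k') = (k - k') / (1 - g / (K K'))`; the second expression is used
where the first one is of the form `0 / 0`. -/
def Ω (κ κ' : ℂ) : ℂ :=
  if C.k κ + C.k κ' ≠ 0 then (C.K κ - C.K κ') / (C.k κ + C.k κ')
  else (C.k κ - C.k κ') / (1 - C.g / (C.K κ * C.K κ'))

/-- The poles of the kernel: both denominators vanish. -/
def IsPole (κ κ' : ℂ) : Prop := C.k κ + C.k κ' = 0 ∧ C.K κ * C.K κ' = C.g

end Curve

/-! ### Independent variables -/

/-- The space of the variables `(x₁, x₂, x₃)`; the entry with index `i : Fin 3` is `x_{i+1}`. -/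
abbrev Times : Type := Fin 3 → ℝ

/-- The partial derivative in the coordinate direction `i`. -/
def pd (i : Fin 3) (f : Times → ℂ) : Times → ℂ := fun x => fderiv ℝ f x (Pi.single i 1)

/-- `∂₁`. -/
abbrev D₁ : (Times → ℂ) → (Times → ℂ) := pd 0

/-- `∂₂`. -/
abbrev D₂ : (Times → ℂ) → (Times → ℂ) := pd 1

/-- `∂₃`. -/
abbrev D₃ : (Times → ℂ) → (Times → ℂ) := pd 2

/-- The logarithmic derivative `∂ ln f`. -/
def dlog (i : Fin 3) (f : Times → ℂ) : Times → ℂ := fun x => pd i f x / f x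

/-! ### The linear integral equation -/

/-- An antisymmetric complex measure `dζ(λ, λ') = density(λ, λ') dbase(λ, λ')` on pairs of spectral
parameters. An integration domain is encoded by the support of `base`. -/
structure SkewMeasure where
  base : Measure (ℂ × ℂ)
  sigmaFinite : SigmaFinite base
  density : ℂ × ℂ → ℂ
  measurable_density : Measurable density
  base_swap : base.map Prod.swap = base
  density_swap : ∀ p : ℂ × ℂ, density p.swap = -density p

namespace SkewMeasure

variable (ζ : SkewMeasure)

/-- Absolute convergence of `∬ F dζ`. -/
def Converges (F : ℂ × ℂ → ℂ) : Prop := Integrable (fun p => ζ.density p * F p) ζ.base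

/-- The double integral `∬ F dζ`. -/
def int (F : ℂ × ℂ → ℂ) : ℂ := ∫ p, ζ.density p * F p ∂ζ.base

end SkewMeasure

/-- The data of the linear integral equation: the curve, the antisymmetric measure, a set `S` of
spectral parameters that contains those over which one integrates, and the values `y` of the
remaining (frozen) times. Entries of `y` with index `1`, `2`, `3` only shift the origin of
`(x₁, x₂, x₃)`, possibly by complex amounts. -/
structure Setting where
  C : Curve
  ζ : SkewMeasure
  S : Set ℂ
  y : ℕ →₀ ℂ
  S_regular : S ⊆ C.regular
  concentrated : ∀ᵐ p ∂ζ.base, p.1 ∈ S ∧ p.2 ∈ S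
  no_pole : ∀ κ ∈ S, ∀ᵐ p ∂ζ.base, ¬ C.IsPole κ p.2

namespace Setting

variable (𝒮 : Setting)

/-- The plane wave factor `ρ_n(κ)`. -/
def ρ (n : ℤ) (x : Times) (κ : ℂ) : ℂ :=
  Complex.exp ((∑ j : Fin 3, (x j : ℂ) * 𝒮.C.dispersion ((j : ℕ) + 1) κ)
      + 𝒮.y.sum fun j t => t * 𝒮.C.dispersion j κ)
    * (𝒮.C.K κ / 𝒮.C.sqrtg) ^ n

/-- The integrand `ρ_n(κ) Ω(κ, λ') ρ_n(λ') f(λ)`, as a function of `(λ, λ')`. -/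
def integrand (n : ℤ) (x : Times) (κ : ℂ) (f : ℂ → ℂ) (p : ℂ × ℂ) : ℂ :=
  𝒮.ρ n x κ * 𝒮.C.Ω κ p.2 * 𝒮.ρ n x p.2 * f p.1

/-- `u n x κ i` stands for the component `u_n^[i](κ)` at the time `x`; `u` solves the linear
integral equation `u_n(κ) + ∬ dζ(λ,λ') ρ_n(κ) Ω(κ,λ') ρ_n(λ') u_n(λ) = ρ_n(κ) c(κ)`, for `x`
in the region `X`. -/
structure IsSolution (X : Set Times) (u : ℤ → Times → ℂ → ℤ → ℂ) : Prop where
  measurable : ∀ n, ∀ x ∈ X, ∀ i,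
    AEStronglyMeasurable (fun p : ℂ × ℂ => u n x p.1 i) 𝒮.ζ.base
  converges : ∀ n, ∀ x ∈ X, ∀ κ ∈ 𝒮.S, ∀ i,
    𝒮.ζ.Converges (𝒮.integrand n x κ fun l => u n x l i)
  eqn : ∀ n, ∀ x ∈ X, ∀ κ ∈ 𝒮.S, ∀ i,
    u n x κ i + 𝒮.ζ.int (𝒮.integrand n x κ fun l => u n x l i) = 𝒮.ρ n x κ * 𝒮.C.c κ i

/-- The homogeneous integral equation has only the zero solution. -/
def HomogeneousTrivial (n : ℤ) (x : Times) : Prop :=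
  ∀ f : ℂ → ℂ, AEStronglyMeasurable (fun p : ℂ × ℂ => f p.1) 𝒮.ζ.base →
    (∀ κ ∈ 𝒮.S, 𝒮.ζ.Converges (𝒮.integrand n x κ f)) →
    (∀ κ ∈ 𝒮.S, f κ + 𝒮.ζ.int (𝒮.integrand n x κ f) = 0) →
    ∀ κ ∈ 𝒮.S, f κ = 0

/-- Regularity in the times: the components are continuously differentiable, and locally in `x`
there are bounds `b` (for finitely many components and their gradients) and `r` (for finitely many
components of `ρ_n c`) with which the integrals that enter the theory converge absolutely. -/
structure IsRegular (X : Set Times) (u : ℤ → Times → ℂ → ℤ → ℂ) : Prop where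
  contDiffOn : ∀ n, ∀ κ ∈ 𝒮.S, ∀ i, ContDiffOn ℝ 1 (fun x => u n x κ i) X
  dominated : ∀ n, ∀ x₀ ∈ X, ∀ N : ℕ, ∃ b r : ℂ → ℝ,
    (∀ᶠ x in 𝓝 x₀, ∀ κ ∈ 𝒮.S, ∀ i : ℤ, |i| ≤ N →
      ‖u n x κ i‖ ≤ b κ ∧ ‖fderiv ℝ (fun x' => u n x' κ i) x‖ ≤ b κ ∧
      ‖𝒮.ρ n x κ * 𝒮.C.c κ i‖ ≤ r κ) ∧
    Integrable (fun p : ℂ × ℂ => ‖𝒮.ζ.density p‖ * b p.1 * r p.2) 𝒮.ζ.base ∧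
    (∀ κ ∈ 𝒮.S, Integrable
      (fun p : ℂ × ℂ => ‖𝒮.ζ.density p‖ * b p.1 * ‖𝒮.C.Ω κ p.2‖ * r p.2) 𝒮.ζ.base) ∧
    Integrable (fun z : (ℂ × ℂ) × (ℂ × ℂ) =>
      ‖𝒮.ζ.density z.1‖ * ‖𝒮.ζ.density z.2‖ * b z.1.1 * r z.1.2 *
        ‖𝒮.C.Ω z.1.2 z.2.2‖ * r z.2.2 * b z.2.1) (𝒮.ζ.base.prod 𝒮.ζ.base)

/-- The entry `U_n^[i,j]` of the potential matrix `U_n = ∬ dζ(κ,κ') u_n(κ) ᵗc(κ') ρ_n(κ')`. -/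
def U (u : ℤ → Times → ℂ → ℤ → ℂ) (n : ℤ) (i j : ℤ) (x : Times) : ℂ :=
  𝒮.ζ.int fun p => u n x p.1 i * 𝒮.C.c p.2 j * 𝒮.ρ n x p.2

/-- The potential `u_n = U_n^[2,0]`. -/
def potU (u : ℤ → Times → ℂ → ℤ → ℂ) (n : ℤ) (x : Times) : ℂ := 𝒮.U u n 2 0 x

/-- The potential `v_n = 1 + g⁻¹ U_n^[3,2]`. -/
def potV (u : ℤ → Times → ℂ → ℤ → ℂ) (n : ℤ) (x : Times) : ℂ := 1 + 𝒮.C.g⁻¹ * 𝒮.U u n 3 2 x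

/-- The potential `w_n = 1 - U_n^[1,0]`. -/
def potW (u : ℤ → Times → ℂ → ℤ → ℂ) (n : ℤ) (x : Times) : ℂ := 1 - 𝒮.U u n 1 0 x

end Setting

/-- The scalar wave function `φ_n = u_n^[0](κ)`. -/
def waveφ (u : ℤ → Times → ℂ → ℤ → ℂ) (κ : ℂ) (n : ℤ) (x : Times) : ℂ := u n x κ 0

/-! ### The linear system, the Lax pair and the nonlinear system -/

/-- The linear system for `φ = φ_n`, `φp = φ_{n+1}`, `φm = φ_{n-1}` with potentials `u`, `v`, `w`,
on the region `X`. -/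
structure LinearSystem (C : Curve) (X : Set Times) (u v w φm φ φp : Times → ℂ) : Prop where
  second : ∀ x ∈ X, D₂ φ x =
    -(D₁ (D₁ φ) x + 2 * D₁ u x * φ x - 3 * C.e * φ x) + 2 * C.sqrtg * v x * w x * φp x
  third : ∀ x ∈ X, D₃ φ x =
    (D₁ (D₁ (D₁ φ)) x + 3 * D₁ u x * D₁ φ x + 3 / 2 * (D₁ (D₁ u) x - D₂ u x) * φ x)
      - 3 * C.sqrtg * v x * D₁ w x * φp x
  spatial : ∀ x ∈ X, C.sqrtg * v x * w x * φp x + C.sqrtg * φm x =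
    D₁ (D₁ φ) x - dlog 0 w x * D₁ φ x + 2 * D₁ u x * φ x - 3 * C.e * φ x
      + 1 / 2 * (D₁ (dlog 0 w) x + dlog 0 w x ^ 2 + dlog 1 w x) * φ x

/-- Operators on functions of `(x₁, x₂, x₃)`. -/
abbrev Op : Type := (Times → ℂ) → (Times → ℂ)

/-- A `2 × 2` matrix of operators acting on a two-component function. -/
def act (M : Matrix (Fin 2) (Fin 2) Op) (Φ : Fin 2 → Times → ℂ) : Fin 2 → Times → ℂ :=
  fun i => ∑ j, M i j (Φ j)

/-- The function `∂₁² ln v + (∂₁ ln v)² - ∂₂ ln v`. -/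
def logTerm (v : Times → ℂ) : Times → ℂ :=
  fun x => D₁ (dlog 0 v) x + dlog 0 v x ^ 2 - dlog 1 v x

/-- The operator matrix `P`. -/
def laxP (C : Curve) (u v w : Times → ℂ) : Matrix (Fin 2) (Fin 2) Op :=
  !![fun f x => -D₁ (D₁ f) x - 2 * D₁ u x * f x + 3 * C.e * f x,
     fun f x => 2 * C.sqrtg * v x * w x * f x;
     fun f x => -2 * C.sqrtg * f x,
     fun f x => D₁ (D₁ f) x + 2 * dlog 0 v x * D₁ f x
      + (2 * D₁ u x - 3 * C.e + logTerm v x) * f x]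

/-- The operator matrix `Q`. -/
def laxQ (C : Curve) (u v w : Times → ℂ) : Matrix (Fin 2) (Fin 2) Op :=
  !![fun f x => D₁ (D₁ (D₁ f)) x + 3 * D₁ u x * D₁ f x
      + 3 / 2 * (D₁ (D₁ u) x - D₂ u x) * f x,
     fun f x => -3 * C.sqrtg * v x * D₁ w x * f x;
     fun f x => -3 * C.sqrtg * dlog 0 v x * f x,
     fun f x => D₁ (D₁ (D₁ f)) x + 3 * dlog 0 v x * D₁ (D₁ f) x
      + 3 * (D₁ u x + D₁ (dlog 0 v) x + dlog 0 v x ^ 2) * D₁ f x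
      + (3 / 2 * (D₁ (D₁ u) x - D₂ u x) + 3 * dlog 0 v x * (2 * D₁ u x - 3 * C.e)
        + 3 / 2 * (D₁ (logTerm v) x + dlog 0 v x * logTerm v x)) * f x]

/-- The two-component function `Φ` satisfies `∂₂ Φ = P Φ` and `∂₃ Φ = Q Φ` on `X`. -/
def LaxPair (C : Curve) (X : Set Times) (u v w : Times → ℂ) (Φ : Fin 2 → Times → ℂ) : Prop :=
  ∀ x ∈ X, ∀ i, D₂ (Φ i) x = act (laxP C u v w) Φ i x ∧ D₃ (Φ i) x = act (laxQ C u v w) Φ i x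

/-- The derivative `∂_j M` of an operator matrix (differentiation of its coefficients), that is,
the commutator of `∂_j` with `M`. -/
def opDeriv (j : Fin 3) (M : Matrix (Fin 2) (Fin 2) Op) (Φ : Fin 2 → Times → ℂ) :
    Fin 2 → Times → ℂ :=
  fun i x => pd j (act M Φ i) x - act M (fun l => pd j (Φ l)) i x

/-- The zero curvature equation `∂₃ P - ∂₂ Q + [P, Q] = 0`, as an identity between operators on
the smooth two-component functions on `X`. -/
def ZeroCurvature (C : Curve) (X : Set Times) (u v w : Times → ℂ) : Prop :=
  ∀ Φ : Fin 2 → Times → ℂ, (∀ i, ContDiffOn ℝ ∞ (Φ i) X) → ∀ x ∈ X, ∀ i,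
    opDeriv 2 (laxP C u v w) Φ i x - opDeriv 1 (laxQ C u v w) Φ i x
      + (act (laxP C u v w) (act (laxQ C u v w) Φ) i x
        - act (laxQ C u v w) (act (laxP C u v w) Φ) i x) = 0

/-- The elliptic coupled KP system on `X` with two auxiliary functions: `s` is the antiderivative
`∂₁⁻¹ ∂₂² u`, and `a` is an additional term `a v` in the second and `-a w` in the third equation.
The elliptic coupled KP system itself is the case `a = 0`. -/
structure EllipticCKPWith (C : Curve) (X : Set Times) (u v w s a : Times → ℂ) : Prop where
  smooth_s : ContDiffOn ℝ ∞ s X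
  antiderivative : ∀ x ∈ X, D₁ s x = D₂ (D₂ u) x
  eq_u : ∀ x ∈ X, D₃ u x = 1 / 4 * D₁ (D₁ (D₁ u)) x + 3 / 2 * D₁ u x ^ 2 + 3 / 4 * s x
    + 3 * C.g * (1 - v x * w x)
  eq_v : ∀ x ∈ X, D₃ v x = -(1 / 2) * D₁ (D₁ (D₁ v)) x - 3 * (D₁ u x - 3 * C.e) * D₁ v x
    + 3 / 2 * D₁ (D₂ v) x + 3 * D₂ u x * v x + a x * v x
  eq_w : ∀ x ∈ X, D₃ w x = -(1 / 2) * D₁ (D₁ (D₁ w)) x - 3 * (D₁ u x - 3 * C.e) * D₁ w x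
    - 3 / 2 * D₁ (D₂ w) x - 3 * D₂ u x * w x - a x * w x

/-- The elliptic coupled KP system on `X`, with `s = ∂₁⁻¹ ∂₂² u`. -/
def EllipticCKP (C : Curve) (X : Set Times) (u v w s : Times → ℂ) : Prop :=
  EllipticCKPWith C X u v w s 0

/-- `f` tends to `0` as `x₁` tends to its limit along `l`, with `x₂`, `x₃` fixed. -/
def VanishesAlong (l : Filter ℝ) (f : Times → ℂ) : Prop :=
  ∀ x : Times, Tendsto (fun t : ℝ => f (Function.update x 0 t)) l (𝓝 0)

/-- `f` and all its partial derivatives of order at most three vanish along `l`. -/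
def VanishesWithDerivatives (l : Filter ℝ) (f : Times → ℂ) : Prop :=
  ∀ js : List (Fin 3), js.length ≤ 3 → VanishesAlong l (js.foldr pd f)

end EllipticKP

end

/-! The first claim rests on uniqueness for the linear integral equation. Let the left-hand side of
that equation act on a candidate function. If the result is a combination of sources `ρ_n c^[i]`,
the candidate is the same combination of the solutions `u_n^[i]`. The candidates are the time
derivatives of `u_n`, and the solutions at a neighbouring `n`.

The result is such a combination because the Cauchy kernel becomes degenerate when multiplied by the
right factor. For the dispersion coefficient `ω` of each of the three times, `(ω(κ) + ω(κ')) Ω(κ,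
κ')` is a finite sum of products of a function of `κ` and a function of `κ'`; so is `(K K' - g) Ω`,
which governs the shift in `n`. These are `kernel_one`, `kernel_two`, `kernel_three` and
`kernel_shift`. The integrals that remain after factorisation are entries of `U_n`. The outcome is a
closed system of differential and difference relations, recorded as `Hierarchy`. It also gives
smoothness: first derivatives are polynomial in the unknowns, so differentiability bootstraps. The
skew-symmetry of `U_n` (`U_skew`) comes from inserting the integral equation into its definition.

From then on everything is algebra in the ring of smooth functions with its three commuting
derivations. The key facts are `w_{n+1} v_n = 1`, `φ_n^[2] = √g v_n φ_{n+1}` and `u_{n+1} = u_n + ∂₁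
ln v_n`. The first makes `v_n` and `w_n` zero-free. All three turn the linear system at level `n +
1` into the second row of the Lax pair at level `n`, once `φ_{n+2}` is eliminated.

The zero curvature claims do not use the integral equation. The curvature matrix is computed
outright with `∂₃ u`, `∂₃ v`, `∂₃ w` replaced by the right-hand sides of the system plus residuals
(`zeroCurvature_fst`, `zeroCurvature_snd`), and a few test functions separate the residuals. The
residual `a` cannot be forced to vanish locally: `P` and `Q` are unchanged under `v ↦ λ v`, `w ↦ λ⁻¹
w` when `λ` depends on `x₃` only. The boundary conditions at one end of the `x₁` axis remove this
freedom. -/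

noncomputable section

namespace EllipticKP

section

/-! ### Identities in a commutative algebra with three commuting derivations -/

section Algebraic

variable {R : Type*} [CommRing R] [Algebra ℂ R]

/-- The commutator of two derivations with logarithmic derivatives `p` and `r` of a unit. -/
theorem logDeriv_comm {d₁ d₂ : Derivation ℂ R R} (comm : ∀ f, d₂ (d₁ f) = d₁ (d₂ f))
    {v v' p r : R} (hv : v * v' = 1) (hp : d₁ v = v * p) (hr : d₂ v = v * r) :
    d₂ p = d₁ r := by
  have h := comm v
  rw [hp, hr] at h
  simp only [Derivation.leibniz, smul_eq_mul, hp, hr] at h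
  have h' : v * (d₂ p - d₁ r) = 0 := by linear_combination h
  linear_combination v' * h' + (d₁ r - d₂ p) * hv

/-- The first row of the zero curvature expression, in terms of the residuals of the equations
for `u` and `w`. -/
theorem zeroCurvature_fst {d₁ d₂ d₃ : Derivation ℂ R R}
    (c21 : ∀ f, d₂ (d₁ f) = d₁ (d₂ f)) (c31 : ∀ f, d₃ (d₁ f) = d₁ (d₃ f))
    (e σ : ℂ) {u v w p r t q s a b : R}
    (hv₁ : d₁ v = v * p) (hv₂ : d₂ v = v * r) (hv₃ : d₃ v = v * t)
    (hq : q = d₁ p + p * p - r)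
    (ht : t = a - (1 / 2 : ℂ) • (d₁ (d₁ p) + (3 : ℂ) • (p * d₁ p) + p * p * p)
      - (3 : ℂ) • (d₁ u * p - (3 * e) • p) + (3 / 2 : ℂ) • (d₁ r + p * r) + (3 : ℂ) • d₂ u)
    (hu₃ : d₃ u = (1 / 4 : ℂ) • d₁ (d₁ (d₁ u)) + (3 / 2 : ℂ) • (d₁ u * d₁ u)
      + (3 / 4 : ℂ) • s + (3 * σ ^ 2) • (1 - v * w))
    (hw₃ : d₃ w = b - (1 / 2 : ℂ) • d₁ (d₁ (d₁ w)) - (3 : ℂ) • (d₁ u * d₁ w - (3 * e) • d₁ w)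
      - (3 / 2 : ℂ) • d₁ (d₂ w) - (3 : ℂ) • (d₂ u * w) - a * w)
    {P₁ P₂ Q₁ Q₂ : R → R → R}
    (hP₁ : ∀ f₁ f₂, P₁ f₁ f₂ = -d₁ (d₁ f₁) - (2 : ℂ) • (d₁ u * f₁) + (3 * e) • f₁
      + (2 * σ) • (v * w * f₂))
    (hP₂ : ∀ f₁ f₂, P₂ f₁ f₂ = (-2 * σ) • f₁ + (d₁ (d₁ f₂) + (2 : ℂ) • (p * d₁ f₂)
      + ((2 : ℂ) • d₁ u * f₂ - (3 * e) • f₂ + q * f₂)))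
    (hQ₁ : ∀ f₁ f₂, Q₁ f₁ f₂ = d₁ (d₁ (d₁ f₁)) + (3 : ℂ) • (d₁ u * d₁ f₁)
      + (3 / 2 : ℂ) • ((d₁ (d₁ u) - d₂ u) * f₁) + (-3 * σ) • (v * d₁ w * f₂))
    (hQ₂ : ∀ f₁ f₂, Q₂ f₁ f₂ = (-3 * σ) • (p * f₁) + (d₁ (d₁ (d₁ f₂))
      + (3 : ℂ) • (p * d₁ (d₁ f₂)) + (3 : ℂ) • ((d₁ u + d₁ p + p * p) * d₁ f₂)
      + ((3 / 2 : ℂ) • (d₁ (d₁ u) - d₂ u) + (3 : ℂ) • (p * ((2 : ℂ) • d₁ u)) - (9 * e) • p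
        + (3 / 2 : ℂ) • (d₁ q + p * q)) * f₂))
    (f₁ f₂ : R) :
    (d₃ (P₁ f₁ f₂) - P₁ (d₃ f₁) (d₃ f₂)) - (d₂ (Q₁ f₁ f₂) - Q₁ (d₂ f₁) (d₂ f₂))
      + (P₁ (Q₁ f₁ f₂) (Q₂ f₁ f₂) - Q₁ (P₁ f₁ f₂) (P₂ f₁ f₂))
      = (2 * σ) • (v * b * f₂) - (3 / 2 : ℂ) • ((d₁ s - d₂ (d₂ u)) * f₁) := by
  subst hq
  simp only [hP₁, hP₂, hQ₁, hQ₂, map_add, map_sub, map_neg, Derivation.leibniz, smul_eq_mul,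
    Derivation.map_smul, hv₁, hv₂, hv₃, hu₃, hw₃, c21, c31]
  simp only [ht, Derivation.map_one_eq_zero]
  algebra

/-- The second row of the zero curvature expression. -/
theorem zeroCurvature_snd {d₁ d₂ d₃ : Derivation ℂ R R}
    (c21 : ∀ f, d₂ (d₁ f) = d₁ (d₂ f)) (c31 : ∀ f, d₃ (d₁ f) = d₁ (d₃ f))
    (e σ : ℂ) {u v w p r t q s a : R}
    (hv₁ : d₁ v = v * p) (hr : d₂ p = d₁ r) (hp₃ : d₃ p = d₁ t) (hr₃ : d₃ r = d₂ t)
    (hq : q = d₁ p + p * p - r)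
    (ht : t = a - (1 / 2 : ℂ) • (d₁ (d₁ p) + (3 : ℂ) • (p * d₁ p) + p * p * p)
      - (3 : ℂ) • (d₁ u * p - (3 * e) • p) + (3 / 2 : ℂ) • (d₁ r + p * r) + (3 : ℂ) • d₂ u)
    (hu₃ : d₃ u = (1 / 4 : ℂ) • d₁ (d₁ (d₁ u)) + (3 / 2 : ℂ) • (d₁ u * d₁ u)
      + (3 / 4 : ℂ) • s + (3 * σ ^ 2) • (1 - v * w))
    {P₁ P₂ Q₁ Q₂ : R → R → R}
    (hP₁ : ∀ f₁ f₂, P₁ f₁ f₂ = -d₁ (d₁ f₁) - (2 : ℂ) • (d₁ u * f₁) + (3 * e) • f₁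
      + (2 * σ) • (v * w * f₂))
    (hP₂ : ∀ f₁ f₂, P₂ f₁ f₂ = (-2 * σ) • f₁ + (d₁ (d₁ f₂) + (2 : ℂ) • (p * d₁ f₂)
      + ((2 : ℂ) • d₁ u * f₂ - (3 * e) • f₂ + q * f₂)))
    (hQ₁ : ∀ f₁ f₂, Q₁ f₁ f₂ = d₁ (d₁ (d₁ f₁)) + (3 : ℂ) • (d₁ u * d₁ f₁)
      + (3 / 2 : ℂ) • ((d₁ (d₁ u) - d₂ u) * f₁) + (-3 * σ) • (v * d₁ w * f₂))
    (hQ₂ : ∀ f₁ f₂, Q₂ f₁ f₂ = (-3 * σ) • (p * f₁) + (d₁ (d₁ (d₁ f₂))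
      + (3 : ℂ) • (p * d₁ (d₁ f₂)) + (3 : ℂ) • ((d₁ u + d₁ p + p * p) * d₁ f₂)
      + ((3 / 2 : ℂ) • (d₁ (d₁ u) - d₂ u) + (3 : ℂ) • (p * ((2 : ℂ) • d₁ u)) - (9 * e) • p
        + (3 / 2 : ℂ) • (d₁ q + p * q)) * f₂))
    (f₁ f₂ : R) :
    (d₃ (P₂ f₁ f₂) - P₂ (d₃ f₁) (d₃ f₂)) - (d₂ (Q₂ f₁ f₂) - Q₂ (d₂ f₁) (d₂ f₂))
      + (P₂ (Q₁ f₁ f₂) (Q₂ f₁ f₂) - Q₂ (P₁ f₁ f₂) (P₂ f₁ f₂))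
      = (2 : ℂ) • (d₁ a * d₁ f₂) + (d₁ (d₁ a) + (2 : ℂ) • (p * d₁ a) - d₂ a) * f₂
        + (3 / 2 : ℂ) • ((d₁ s - d₂ (d₂ u)) * f₂) := by
  subst hq
  simp only [hP₁, hP₂, hQ₁, hQ₂, map_add, map_sub, Derivation.leibniz, smul_eq_mul,
    Derivation.map_smul, hv₁, hr, hp₃, hr₃, hu₃, c21, c31]
  simp only [ht, map_add, map_sub, Derivation.leibniz, smul_eq_mul, Derivation.map_smul, hr, c21,
    Derivation.map_one_eq_zero]
  algebra

/-- The effect of multiplication by `k` on the labels of the entries of `c(κ)`. -/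
def raise {M : Type*} [AddCommGroup M] [Module ℂ M] (e g : ℂ) (f : ℤ → M) (i : ℤ) : M :=
  if Even i then f (i + 1) else f (i + 1) + (3 * e) • f (i - 1) + g • f (i - 3)

/-- The differential and difference relations between the entries `U n i j` of the potential
matrices and the components `φ n i` of the wave functions. -/
structure Hierarchy (d : Fin 3 → Derivation ℂ R R) (e σ : ℂ) (U : ℤ → ℤ → ℤ → R)
    (φ : ℤ → ℤ → R) : Prop where
  skew : ∀ n i j, U n i j = -U n j i
  d_one : ∀ n i, d 0 (φ n i) = raise e (σ ^ 2) (φ n) i - U n i 0 * φ n 2 + U n i 2 * φ n 0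
  d_two : ∀ n i, d 1 (φ n i) = φ n (i + 2) - σ ^ 2 • φ n (i - 2)
    - U n i 0 * φ n 3 - U n i 2 * φ n 1 + U n i 1 * φ n 2 + U n i 3 * φ n 0
  d_three : ∀ n i, d 2 (φ n i) = raise e (σ ^ 2) (raise e (σ ^ 2) (raise e (σ ^ 2) (φ n))) i
    - (U n i 0 * φ n 4 - U n i 4 * φ n 0 + (6 * e) • (U n i 0 * φ n 2 - U n i 2 * φ n 0)
      + σ ^ 2 • (U n i (-2) * φ n 2 - U n i 2 * φ n (-2)) - U n i 1 * φ n 3 + U n i 3 * φ n 1)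
  dU_one : ∀ n i j, d 0 (U n i j) = raise e (σ ^ 2) (fun l => U n l j) i
    + raise e (σ ^ 2) (U n i) j - U n i 0 * U n 2 j + U n i 2 * U n 0 j
  dU_two : ∀ n i j, d 1 (U n i j) = U n (i + 2) j - σ ^ 2 • U n (i - 2) j
    + U n i (j + 2) - σ ^ 2 • U n i (j - 2)
    - U n i 0 * U n 3 j - U n i 2 * U n 1 j + U n i 1 * U n 2 j + U n i 3 * U n 0 j
  up : ∀ n i, σ • φ (n + 1) i = φ n (i + 2) - U (n + 1) i 0 * φ n 3 + U (n + 1) i 1 * φ n 2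
  up_U : ∀ n i j, σ ^ 2 • U (n + 1) i j = U n (i + 2) (j + 2) - U (n + 1) i 0 * U n 3 (j + 2)
    + U (n + 1) i 1 * U n 2 (j + 2)
  down : ∀ n i, σ • φ n i = σ ^ 2 • φ (n + 1) (i - 2) + U n i 2 * φ (n + 1) 1
    - U n i 3 * φ (n + 1) 0

namespace Hierarchy

variable {d : Fin 3 → Derivation ℂ R R} {e σ : ℂ} {U : ℤ → ℤ → ℤ → R} {φ : ℤ → ℤ → R}

theorem diag (h : Hierarchy d e σ U φ) (n i : ℤ) : U n i i = 0 := by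
  have h2 : (2 : ℂ) • U n i i = 0 := by
    linear_combination (norm := algebra) h.skew n i i
  have := congrArg (fun z => (1 / 2 : ℂ) • z) h2
  simpa [smul_smul] using this

/-- In the shift relation for the label pair `(1, 0)` the last term contains diagonal entries, which
vanish by skewness; what is left factorises. -/
theorem w_mul_v (h : Hierarchy d e σ U φ) (hσ : σ ≠ 0) (n : ℤ) :
    (1 - U (n + 1) 1 0) * (1 + (σ ^ 2)⁻¹ • U n 3 2) = 1 := by
  have h1 := h.up_U n 1 0
  norm_num [h.diag] at h1
  have hs : (σ ^ 2)⁻¹ • σ ^ 2 • U (n + 1) 1 0 = U (n + 1) 1 0 := inv_smul_smul₀ (pow_ne_zero 2 hσ) _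
  rw [h1] at hs
  linear_combination (norm := algebra) hs

/-- At label `0` the upward shift collapses to `√g φ_{n+1}^[0] = w_{n+1} φ_n^[2]`, and `v_n` inverts
`w_{n+1}`. This is how `φ_{n+1}` enters the linear equations. -/
theorem phi_two (h : Hierarchy d e σ U φ) (hσ : σ ≠ 0) (n : ℤ) :
    φ n 2 = σ • ((1 + (σ ^ 2)⁻¹ • U n 3 2) * φ (n + 1) 0) := by
  have h1 := h.up n 0
  norm_num [h.diag, h.skew (n + 1) 0 1] at h1
  linear_combination (norm := algebra) -(1 + (σ ^ 2)⁻¹ • U n 3 2) * h1 - φ n 2 * h.w_mul_v hσ n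

theorem d_phi_zero (h : Hierarchy d e σ U φ) (n : ℤ) :
    d 0 (φ n 0) = φ n 1 - U n 2 0 * φ n 0 := by
  have h1 := h.d_one n 0
  norm_num [raise, h.diag, h.skew n 0 2] at h1
  linear_combination (norm := algebra) h1

theorem d_phi_one (h : Hierarchy d e σ U φ) (n : ℤ) :
    d 0 (φ n 1) = (1 - U n 1 0) * φ n 2 + (3 * e) • φ n 0 + σ ^ 2 • φ n (-2)
      - U n 2 1 * φ n 0 := by
  have h1 := h.d_one n 1
  norm_num [raise, h.skew n 1 2] at h1
  linear_combination (norm := algebra) h1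

theorem d_u (h : Hierarchy d e σ U φ) (n : ℤ) :
    d 0 (U n 2 0) = U n 3 0 + U n 2 1 - U n 2 0 * U n 2 0 := by
  have h1 := h.dU_one n 2 0
  norm_num [raise, h.diag] at h1
  linear_combination (norm := algebra) h1

theorem d_w (h : Hierarchy d e σ U φ) (n : ℤ) :
    d 0 (1 - U n 1 0) = -(1 - U n 1 0) * U n 2 0 - σ ^ 2 • U n (-2) 0 := by
  have h1 := h.dU_one n 1 0
  norm_num [raise, h.diag] at h1
  rw [map_sub, h1, Derivation.map_one_eq_zero]
  algebra

theorem d_d_phi_zero (h : Hierarchy d e σ U φ) (n : ℤ) :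
    d 0 (d 0 (φ n 0)) = (1 - U n 1 0) * φ n 2 + (3 * e) • φ n 0 + σ ^ 2 • φ n (-2)
      - (2 : ℂ) • (U n 2 1 * φ n 0) - U n 3 0 * φ n 0 - U n 2 0 * φ n 1
      + (2 : ℂ) • (U n 2 0 * U n 2 0 * φ n 0) := by
  rw [h.d_phi_zero, map_sub, Derivation.leibniz, h.d_phi_one, h.d_phi_zero, h.d_u]
  simp only [smul_eq_mul]
  algebra

/-- The component `φ_n^[-2]` occurs in `∂₂ φ` and in `∂₁² φ` with opposite signs. In the sum it
cancels, while the two terms `w φ_n^[2]` add up. -/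
theorem second (h : Hierarchy d e σ U φ) (hσ : σ ≠ 0) (n : ℤ) :
    d 1 (φ n 0) = -(d 0 (d 0 (φ n 0)) + (2 : ℂ) • (d 0 (U n 2 0) * φ n 0) - (3 * e) • φ n 0)
      + (2 * σ) • ((1 + (σ ^ 2)⁻¹ • U n 3 2) * (1 - U n 1 0) * φ (n + 1) 0) := by
  have h1 := h.d_two n 0
  norm_num [h.diag, h.skew n 0 1, h.skew n 0 2, h.skew n 0 3] at h1
  rw [h.d_d_phi_zero, h1, h.d_u]
  linear_combination (norm := algebra) 2 * (1 - U n 1 0) * h.phi_two hσ n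

/-- After expansion into entries and use of skewness everything cancels except `-3 (∂₁ w) φ_n^[2]`,
to which `phi_two` applies. -/
theorem third (h : Hierarchy d e σ U φ) (hσ : σ ≠ 0) (n : ℤ) :
    d 2 (φ n 0) = d 0 (d 0 (d 0 (φ n 0))) + (3 : ℂ) • (d 0 (U n 2 0) * d 0 (φ n 0))
      + (3 / 2 : ℂ) • ((d 0 (d 0 (U n 2 0)) - d 1 (U n 2 0)) * φ n 0)
      - (3 * σ) • ((1 + (σ ^ 2)⁻¹ • U n 3 2) * d 0 (1 - U n 1 0) * φ (n + 1) 0) := by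
  have h1 := h.d_three n 0
  have h2 := h.d_one n 2
  have h3 := h.d_one n (-2)
  have h4 := h.dU_one n 2 1
  have h5 := h.dU_one n 3 0
  have h6 := h.dU_two n 2 0
  have even : Even (-2 : ℤ) := by decide
  norm_num [raise, h.diag, show ¬ Even (3 : ℤ) by decide, even] at h1 h2 h3 h4 h5 h6
  have h7 := h.dU_one n 1 0
  norm_num [raise, h.diag] at h7
  rw [h.d_d_phi_zero, h.d_u, h.d_w, h1]
  simp only [map_add, map_sub, Derivation.leibniz, Derivation.map_smul, smul_eq_mul, h2, h3, h4,
    h5, h6, h.d_phi_zero, h.d_phi_one, h.d_u, h7, Derivation.map_one_eq_zero]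
  have hφ := h.phi_two hσ n
  simp only [h.skew n 0 1, h.skew n 0 2, h.skew n 0 3, h.skew n 0 4, h.skew n 0 (-2),
    h.skew n 2 (-2)]
  linear_combination (norm := algebra)
    -3 * (-(1 - U n 1 0) * U n 2 0 - σ ^ 2 • U n (-2) 0) * hφ

/-- The shift relation for the labels `(0, -2)` expresses the entry `U_{n+1}^[-2,0]` in `∂₁ w_{n+1}`
through `w_{n+1} u_n`. Hence `∂₁ ln w_{n+1} = u_n - u_{n+1}`, the factor `v_n` playing the part of
`1 / w_{n+1}`. -/
theorem dlog_w (h : Hierarchy d e σ U φ) (hσ : σ ≠ 0) (n : ℤ) :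
    d 0 (1 - U (n + 1) 1 0) * (1 + (σ ^ 2)⁻¹ • U n 3 2) = U n 2 0 - U (n + 1) 2 0 := by
  have h1 := h.up_U n 0 (-2)
  norm_num [h.diag] at h1
  rw [h.skew (n + 1) 0 1, h.skew (n + 1) 0 (-2)] at h1
  linear_combination (norm := algebra) (1 + (σ ^ 2)⁻¹ • U n 3 2) * (h.d_w (n + 1) + h1)
    + (U n 2 0 - U (n + 1) 2 0) * h.w_mul_v hσ n

theorem dlog_w_two (h : Hierarchy d e σ U φ) (hσ : σ ≠ 0) (n : ℤ) :
    d 1 (1 - U (n + 1) 1 0) * (1 + (σ ^ 2)⁻¹ • U n 3 2)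
      = U (n + 1) 2 1 - U (n + 1) 3 0 + U n 3 0 - U n 2 1 := by
  have h1 := h.up_U n 1 (-2)
  have h2 := h.up_U n 0 (-1)
  have h3 := h.dU_two (n + 1) 1 0
  norm_num [h.diag] at h1 h2 h3
  rw [map_sub, h3, Derivation.map_one_eq_zero]
  rw [h.skew (n + 1) 0 1, h.skew (n + 1) 0 (-1)] at h2
  rw [h.skew (n + 1) 1 2]
  linear_combination (norm := algebra) (1 + (σ ^ 2)⁻¹ • U n 3 2) * (h1 - h2)
    + (U (n + 1) 2 1 - U (n + 1) 3 0 + U n 3 0 - U n 2 1) * h.w_mul_v hσ n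

/-- Here `w φ^[2] + g φ^[-2]` is eliminated instead of `φ^[-2]` alone: the downward shift at label
`0` relates `g φ_{n+1}^[-2]` to `φ_n`, and `phi_two` relates `φ_{n+1}^[2]` to `φ_{n+2}`. The element
`P` stands for `∂₁ ln w_{n+1}`; its simpler form `u_n - u_{n+1}` is what makes `∂₁ P` computable. -/
theorem spatial (h : Hierarchy d e σ U φ) (hσ : σ ≠ 0) (n : ℤ) {P : R}
    (hP : d 0 (1 - U (n + 1) 1 0) * (1 + (σ ^ 2)⁻¹ • U n 3 2) = P) :
    σ • ((1 + (σ ^ 2)⁻¹ • U (n + 1) 3 2) * (1 - U (n + 1) 1 0) * φ (n + 2) 0) + σ • φ n 0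
      = d 0 (d 0 (φ (n + 1) 0)) - P * d 0 (φ (n + 1) 0)
        + (2 : ℂ) • (d 0 (U (n + 1) 2 0) * φ (n + 1) 0) - (3 * e) • φ (n + 1) 0
        + (1 / 2 : ℂ) • ((d 0 P + P * P
          + d 1 (1 - U (n + 1) 1 0) * (1 + (σ ^ 2)⁻¹ • U n 3 2)) * φ (n + 1) 0) := by
  rw [h.dlog_w hσ] at hP
  subst hP
  have h1 := h.down n 0
  norm_num [h.skew n 0 2, h.skew n 0 3] at h1
  have h2 := h.phi_two hσ (n + 1)
  rw [add_assoc, one_add_one_eq_two] at h2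
  rw [h1, h.dlog_w_two hσ, map_sub, h.d_d_phi_zero, h.d_u, h.d_u, h.d_phi_zero]
  linear_combination (norm := algebra) -(1 - U (n + 1) 1 0) * h2

theorem u_succ (h : Hierarchy d e σ U φ) (hσ : σ ≠ 0) (n : ℤ) :
    U (n + 1) 2 0 = U n 2 0 + d 0 (1 + (σ ^ 2)⁻¹ • U n 3 2) * (1 - U (n + 1) 1 0) := by
  have h1 := congrArg (d 0) (h.w_mul_v hσ n)
  rw [Derivation.leibniz, Derivation.map_one_eq_zero, smul_eq_mul, smul_eq_mul] at h1
  linear_combination h.dlog_w hσ n - h1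

end Hierarchy

/-- The linear system for the wave function with potentials `u + p` and `v⁻¹`, where
`p = ∂₁ ln v`, gives the second row of the Lax pair. -/
theorem lax_snd_of_linear {d : Fin 3 → Derivation ℂ R R}
    (comm : ∀ f, d 1 (d 0 f) = d 0 (d 1 f)) (e σ : ℂ) {v w v' p r u u' q φ φ' φ'' : R}
    (hvw : w * v = 1) (hp : d 0 v = v * p) (hr : d 1 v = v * r)
    (hq : q = d 0 p + p * p - r) (hu : u' = u + p)
    (second : d 1 φ' = -(d 0 (d 0 φ') + (2 : ℂ) • (d 0 u' * φ') - (3 * e) • φ')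
      + (2 * σ) • (v' * w * φ''))
    (third : d 2 φ' = d 0 (d 0 (d 0 φ')) + (3 : ℂ) • (d 0 u' * d 0 φ')
      + (3 / 2 : ℂ) • ((d 0 (d 0 u') - d 1 u') * φ') - (3 * σ) • (v' * d 0 w * φ''))
    (spatial : σ • (v' * w * φ'') + σ • φ = d 0 (d 0 φ') - (d 0 w * v) * d 0 φ'
      + (2 : ℂ) • (d 0 u' * φ') - (3 * e) • φ'
      + (1 / 2 : ℂ) • ((d 0 (d 0 w * v) + (d 0 w * v) * (d 0 w * v) + d 1 w * v) * φ')) :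
    d 1 φ' = (-2 * σ) • φ + (d 0 (d 0 φ') + (2 : ℂ) • (p * d 0 φ')
      + ((2 : ℂ) • d 0 u * φ' - (3 * e) • φ' + q * φ')) ∧
    d 2 φ' = (-3 * σ) • (p * φ) + (d 0 (d 0 (d 0 φ'))
      + (3 : ℂ) • (p * d 0 (d 0 φ')) + (3 : ℂ) • ((d 0 u + d 0 p + p * p) * d 0 φ')
      + ((3 / 2 : ℂ) • (d 0 (d 0 u) - d 1 u) + (3 : ℂ) • (p * ((2 : ℂ) • d 0 u)) - (9 * e) • p
        + (3 / 2 : ℂ) • (d 0 q + p * q)) * φ') := by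
  have hw : ∀ i, ∀ z, d i v = v * z → d i w * v = -z := fun i z hz => by
    have h1 := congrArg (d i) hvw
    rw [Derivation.leibniz, Derivation.map_one_eq_zero, smul_eq_mul, smul_eq_mul, hz] at h1
    linear_combination h1 - z * hvw
  have hw0 := hw 0 p hp
  have hpr := logDeriv_comm comm (by rw [mul_comm]; exact hvw) hp hr
  have hw0' : d 0 w = -p * w := by linear_combination w * hw0 - d 0 w * hvw
  rw [hw0, hw 1 r hr] at spatial
  rw [hw0'] at third
  subst hq hu
  simp only [map_add, map_neg, map_sub, Derivation.leibniz, smul_eq_mul, hpr] at *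
  constructor
  -- The multiples `2` and `3 p` cancel `φ''`: since `w = v⁻¹`, one has `∂₁ w = -p w`, so the
  -- coefficients of `v' w φ''` in the two evolutions are `2 σ` and `3 σ p`.
  · linear_combination (norm := algebra) second + 2 * spatial
  · linear_combination (norm := algebra) third + 3 * p * spatial

end Algebraic

end

section

/-! ### Smooth functions on an open set -/

theorem _root_.ContDiffOn.pd {X : Set Times} (hX : IsOpen X) {f : Times → ℂ}
    (hf : ContDiffOn ℝ ∞ f X) (j : Fin 3) : ContDiffOn ℝ ∞ (pd j f) X :=
  (hf.fderiv_of_isOpen hX (m := ∞) (by simp)).clm_apply contDiffOn_const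

theorem _root_.Filter.EventuallyEq.pd_eq {x : Times} {f g : Times → ℂ} (h : f =ᶠ[𝓝 x] g)
    (j : Fin 3) : pd j f x = pd j g x := by
  simp only [pd, h.fderiv_eq]

theorem pd_comm {X : Set Times} (hX : IsOpen X) {f : Times → ℂ} (hf : ContDiffOn ℝ ∞ f X)
    (i j : Fin 3) {x : Times} (hx : x ∈ X) : pd i (pd j f) x = pd j (pd i f) x := by
  have hat : ContDiffAt ℝ ∞ f x := hf.contDiffAt (hX.mem_nhds hx)
  have hsymm : IsSymmSndFDerivAt ℝ f x := hat.isSymmSndFDerivAt (by simpa using ENat.LEInfty.out)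
  have hd : DifferentiableAt ℝ (fderiv ℝ f) x :=
    (hat.fderiv_right (m := ∞) (by simp)).differentiableAt (by simp)
  have key : ∀ k l : Fin 3, pd k (pd l f) x
      = fderiv ℝ (fderiv ℝ f) x (Pi.single k 1) (Pi.single l 1) := by
    intro k l
    change fderiv ℝ (fun y => fderiv ℝ f y (Pi.single l 1)) x (Pi.single k 1) = _
    rw [fderiv_clm_apply hd (differentiableAt_const _)]
    simp
  rw [key, key, hsymm]

/-- The extension by zero of a function on `X`. -/
def zeroExt {X : Set Times} (f : X → ℂ) : Times → ℂ := Function.extend Subtype.val f 0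

theorem zeroExt_apply {X : Set Times} (f : X → ℂ) (x : X) : zeroExt f x = f x :=
  Subtype.val_injective.extend_apply f 0 x

/-- The algebra of smooth functions on `X`. -/
def smoothRing (X : Set Times) : Subalgebra ℂ (X → ℂ) where
  carrier := {f | ContDiffOn ℝ ∞ (zeroExt f) X}
  mul_mem' {f g} hf hg := (hf.mul hg).congr fun x hx => by
    simp [zeroExt_apply _ (⟨x, hx⟩ : X)]
  add_mem' {f g} hf hg := (hf.add hg).congr fun x hx => by
    simp [zeroExt_apply _ (⟨x, hx⟩ : X)]
  algebraMap_mem' c := (contDiffOn_const (c := c)).congr fun x hx => by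
    simp [zeroExt_apply _ (⟨x, hx⟩ : X)]

variable {X : Set Times}

/-- Evaluation at a point of `X`. -/
def ev (x : X) : smoothRing X →ₐ[ℂ] ℂ :=
  (Pi.evalAlgHom ℂ (fun _ : X => ℂ) x).comp (smoothRing X).val

theorem smoothRing_ext {F G : smoothRing X} (h : ∀ x : X, ev x F = ev x G) : F = G :=
  Subtype.ext (funext h)

/-- A function on the whole space agrees on `X` with an element of the ring. -/
def Represents (f : Times → ℂ) (F : smoothRing X) : Prop := ∀ x : X, f x = ev x F

/-- The class of a function that is smooth on `X`. -/
def toSmooth (f : Times → ℂ) (hf : ContDiffOn ℝ ∞ f X) : smoothRing X :=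
  ⟨fun x => f x, hf.congr fun x hx => zeroExt_apply _ (⟨x, hx⟩ : X)⟩

theorem represents_toSmooth {f : Times → ℂ} (hf : ContDiffOn ℝ ∞ f X) :
    Represents f (toSmooth f hf) := fun _ => rfl

theorem represents_zeroExt (F : smoothRing X) : Represents (zeroExt F.1) F :=
  fun x => zeroExt_apply F.1 x

/-- The partial derivatives, as derivations of the ring of smooth functions. -/
def deriv' (hX : IsOpen X) (j : Fin 3) : Derivation ℂ (smoothRing X) (smoothRing X) :=
  have hd : ∀ F : smoothRing X, ∀ x : X, DifferentiableAt ℝ (zeroExt F.1) x := fun F x =>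
    (F.2.contDiffAt (hX.mem_nhds x.2)).differentiableAt (by simp)
  have ae : ∀ {f g : Times → ℂ}, (∀ x : X, f x = g x) → ∀ x : X, f =ᶠ[𝓝 (x : Times)] g :=
    fun h x => Filter.eventuallyEq_of_mem (hX.mem_nhds x.2) fun y hy => h ⟨y, hy⟩
  Derivation.mk'
    { toFun := fun F => toSmooth (pd j (zeroExt F.1)) (ContDiffOn.pd hX F.2 j)
      map_add' := fun F G => smoothRing_ext fun x => by
        rw [map_add]
        change pd j _ _ = pd j _ _ + pd j _ _
        rw [(ae (g := zeroExt F.1 + zeroExt G.1) (fun x => by simp [zeroExt_apply]) x).pd_eq]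
        simp only [pd]
        rw [fderiv_add (hd F x) (hd G x)]
        rfl
      map_smul' := fun c F => smoothRing_ext fun x => by
        rw [map_smul]
        change pd j _ _ = c • pd j _ _
        rw [(ae (g := c • zeroExt F.1) (fun x => by simp [zeroExt_apply]) x).pd_eq]
        simp only [pd]
        rw [fderiv_const_smul (hd F x)]
        rfl }
    fun F G => smoothRing_ext fun x => by
      change pd j _ _ = F.1 x * pd j _ _ + G.1 x * pd j _ _
      rw [(ae (g := zeroExt F.1 * zeroExt G.1) (fun x => by simp [zeroExt_apply]) x).pd_eq]
      simp only [pd]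
      rw [fderiv_mul (hd F x) (hd G x)]
      simp [zeroExt_apply]

theorem ev_deriv' (hX : IsOpen X) (j : Fin 3) (F : smoothRing X) (x : X) :
    ev x (deriv' hX j F) = pd j (zeroExt F.1) x := rfl

namespace Represents

variable {f g : Times → ℂ} {F G : smoothRing X}

theorem contDiffOn (h : Represents f F) : ContDiffOn ℝ ∞ f X :=
  F.2.congr fun x hx => (h ⟨x, hx⟩).trans (zeroExt_apply F.1 ⟨x, hx⟩).symm

/-- On an open set a derivative depends only on the germ, so values outside `X` play no role. -/
theorem pd (hX : IsOpen X) (h : Represents f F) (j : Fin 3) :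
    Represents (pd j f) (deriv' hX j F) := fun x => by
  rw [ev_deriv']
  refine (Filter.eventuallyEq_of_mem (hX.mem_nhds x.2) fun y hy => ?_).pd_eq j
  exact (h ⟨y, hy⟩).trans (represents_zeroExt F ⟨y, hy⟩).symm

/-- The inverse `G` replaces division, which the ring does not have, and at the same time guarantees
that `f` has no zero on `X`. -/
theorem dlog (hX : IsOpen X) (h : Represents f F) (hFG : F * G = 1) (j : Fin 3) :
    Represents (dlog j f) (deriv' hX j F * G) := fun x => by
  have hev : ev x F * ev x G = 1 := by rw [← map_mul, hFG, map_one]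
  have hne : ev x F ≠ 0 := left_ne_zero_of_mul_eq_one hev
  rw [map_mul, EllipticKP.dlog, h.pd hX j x, h x, div_eq_iff hne]
  linear_combination (-ev x (deriv' hX j F)) * hev

end Represents

theorem deriv'_comm (hX : IsOpen X) (i j : Fin 3) (F : smoothRing X) :
    deriv' hX i (deriv' hX j F) = deriv' hX j (deriv' hX i F) := smoothRing_ext fun x => by
  rw [← ((represents_zeroExt F).pd hX j).pd hX i x, ← ((represents_zeroExt F).pd hX i).pd hX j x]
  exact pd_comm hX F.2 i j x.2

end

section

/-! ### The zero curvature equation -/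

variable {X : Set Times}

section LaxRing

variable {R : Type*} [CommRing R] [Algebra ℂ R] (d : Fin 3 → Derivation ℂ R R) (e σ : ℂ)
  (u v w p q : R)

/-- The first row of `P` in an abstract differential algebra. -/
def ringP₁ (f₁ f₂ : R) : R := -d 0 (d 0 f₁) - (2 : ℂ) • (d 0 u * f₁) + (3 * e) • f₁
  + (2 * σ) • (v * w * f₂)

/-- The second row of `P`. -/
def ringP₂ (f₁ f₂ : R) : R := (-2 * σ) • f₁ + (d 0 (d 0 f₂) + (2 : ℂ) • (p * d 0 f₂)
  + ((2 : ℂ) • d 0 u * f₂ - (3 * e) • f₂ + q * f₂))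

/-- The first row of `Q`. -/
def ringQ₁ (f₁ f₂ : R) : R := d 0 (d 0 (d 0 f₁)) + (3 : ℂ) • (d 0 u * d 0 f₁)
  + (3 / 2 : ℂ) • ((d 0 (d 0 u) - d 1 u) * f₁) + (-3 * σ) • (v * d 0 w * f₂)

/-- The second row of `Q`. -/
def ringQ₂ (f₁ f₂ : R) : R := (-3 * σ) • (p * f₁) + (d 0 (d 0 (d 0 f₂))
  + (3 : ℂ) • (p * d 0 (d 0 f₂)) + (3 : ℂ) • ((d 0 u + d 0 p + p * p) * d 0 f₂)
  + ((3 / 2 : ℂ) • (d 0 (d 0 u) - d 1 u) + (3 : ℂ) • (p * ((2 : ℂ) • d 0 u)) - (9 * e) • p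
    + (3 / 2 : ℂ) • (d 0 q + p * q)) * f₂)

end LaxRing

section Represent

variable (hX : IsOpen X) {C : Curve} {u v w : Times → ℂ} {U V W V' : smoothRing X}

theorem represents_logTerm (hv : Represents v V) (hV : V * V' = 1) : Represents (logTerm v)
    (deriv' hX 0 (deriv' hX 0 V * V') + (deriv' hX 0 V * V') * (deriv' hX 0 V * V')
      - deriv' hX 1 V * V') := fun x => by
  simp only [logTerm, (hv.dlog hX hV 0).pd hX 0 x, hv.dlog hX hV 0 x, hv.dlog hX hV 1 x,
    map_add, map_sub, map_mul]
  ring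

theorem represents_laxP_fst (hu : Represents u U) (hv : Represents v V) (hw : Represents w W)
    {Φ : Fin 2 → Times → ℂ} {F₁ F₂ : smoothRing X}
    (h₁ : Represents (Φ 0) F₁) (h₂ : Represents (Φ 1) F₂) :
    Represents (act (laxP C u v w) Φ 0)
      (ringP₁ (deriv' hX) C.e C.sqrtg U V W F₁ F₂) := fun x => by
  simp [act, laxP, ringP₁, Fin.sum_univ_two, h₁ x, h₂ x, (h₁.pd hX 0).pd hX 0 x,
    hu.pd hX 0 x, hv x, hw x]
  ring

theorem represents_laxP_snd (hu : Represents u U) (hv : Represents v V) (hV : V * V' = 1)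
    {Φ : Fin 2 → Times → ℂ} {F₁ F₂ : smoothRing X}
    (h₁ : Represents (Φ 0) F₁) (h₂ : Represents (Φ 1) F₂) {p q : smoothRing X}
    (hp : deriv' hX 0 V * V' = p) (hq : deriv' hX 0 p + p * p - deriv' hX 1 V * V' = q) :
    Represents (act (laxP C u v w) Φ 1)
      (ringP₂ (deriv' hX) C.e C.sqrtg U p q F₁ F₂) := fun x => by
  subst hp hq
  simp [act, laxP, ringP₂, Fin.sum_univ_two, h₁ x, h₂ x, (h₂.pd hX 0).pd hX 0 x, h₂.pd hX 0 x,
    hu.pd hX 0 x, hv.dlog hX hV 0 x, represents_logTerm hX hv hV x]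
  ring

theorem represents_laxQ_fst (hu : Represents u U) (hv : Represents v V) (hw : Represents w W)
    {Φ : Fin 2 → Times → ℂ} {F₁ F₂ : smoothRing X}
    (h₁ : Represents (Φ 0) F₁) (h₂ : Represents (Φ 1) F₂) :
    Represents (act (laxQ C u v w) Φ 0)
      (ringQ₁ (deriv' hX) C.sqrtg U V W F₁ F₂) := fun x => by
  simp [act, laxQ, ringQ₁, Fin.sum_univ_two, h₁ x, h₂ x, h₁.pd hX 0 x,
    ((h₁.pd hX 0).pd hX 0).pd hX 0 x, hu.pd hX 0 x, hu.pd hX 1 x, (hu.pd hX 0).pd hX 0 x, hv x,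
    hw.pd hX 0 x]
  ring

theorem represents_laxQ_snd (hu : Represents u U) (hv : Represents v V) (hV : V * V' = 1)
    {Φ : Fin 2 → Times → ℂ} {F₁ F₂ : smoothRing X}
    (h₁ : Represents (Φ 0) F₁) (h₂ : Represents (Φ 1) F₂) {p q : smoothRing X}
    (hp : deriv' hX 0 V * V' = p) (hq : deriv' hX 0 p + p * p - deriv' hX 1 V * V' = q) :
    Represents (act (laxQ C u v w) Φ 1)
      (ringQ₂ (deriv' hX) C.e C.sqrtg U p q F₁ F₂) := fun x => by
  have hq' := represents_logTerm hX hv hV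
  subst hp
  rw [hq] at hq'
  simp [act, laxQ, ringQ₂, Fin.sum_univ_two, h₁ x, h₂ x, (h₂.pd hX 0).pd hX 0 x, h₂.pd hX 0 x,
    ((h₂.pd hX 0).pd hX 0).pd hX 0 x, hu.pd hX 0 x, hu.pd hX 1 x, (hu.pd hX 0).pd hX 0 x,
    hv.dlog hX hV 0 x, (hv.dlog hX hV 0).pd hX 0 x, hq' x, hq'.pd hX 0 x]
  ring

/-- The zero curvature equation in terms of the residuals of the nonlinear system. -/
theorem zeroCurvature_iff_residuals (hu : Represents u U) (hv : Represents v V)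
    (hw : Represents w W) (hV : V * V' = 1) {s a b : smoothRing X} {p r : smoothRing X}
    (hp : deriv' hX 0 V * V' = p) (hr : deriv' hX 1 V * V' = r)
    (ha : deriv' hX 2 V * V' = a - (1 / 2 : ℂ) • (deriv' hX 0 (deriv' hX 0 p)
        + (3 : ℂ) • (p * deriv' hX 0 p) + p * p * p)
      - (3 : ℂ) • (deriv' hX 0 U * p - (3 * C.e) • p) + (3 / 2 : ℂ) • (deriv' hX 0 r + p * r)
      + (3 : ℂ) • deriv' hX 1 U)
    (hs : deriv' hX 2 U = (1 / 4 : ℂ) • deriv' hX 0 (deriv' hX 0 (deriv' hX 0 U))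
      + (3 / 2 : ℂ) • (deriv' hX 0 U * deriv' hX 0 U) + (3 / 4 : ℂ) • s
      + (3 * C.sqrtg ^ 2) • (1 - V * W))
    (hb : deriv' hX 2 W = b - (1 / 2 : ℂ) • deriv' hX 0 (deriv' hX 0 (deriv' hX 0 W))
      - (3 : ℂ) • (deriv' hX 0 U * deriv' hX 0 W - (3 * C.e) • deriv' hX 0 W)
      - (3 / 2 : ℂ) • deriv' hX 0 (deriv' hX 1 W) - (3 : ℂ) • (deriv' hX 1 U * W) - a * W) :
    ZeroCurvature C X u v w ↔ ∀ f₁ f₂ : smoothRing X,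
      (2 * C.sqrtg) • (V * b * f₂)
        - (3 / 2 : ℂ) • ((deriv' hX 0 s - deriv' hX 1 (deriv' hX 1 U)) * f₁) = 0 ∧
      (2 : ℂ) • (deriv' hX 0 a * deriv' hX 0 f₂)
        + (deriv' hX 0 (deriv' hX 0 a) + (2 : ℂ) • (p * deriv' hX 0 a) - deriv' hX 1 a) * f₂
        + (3 / 2 : ℂ) • ((deriv' hX 0 s - deriv' hX 1 (deriv' hX 1 U)) * f₂) = 0 := by
  obtain ⟨t, ht⟩ : ∃ t, deriv' hX 2 V * V' = t := ⟨_, rfl⟩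
  have hmul : ∀ {i z}, deriv' hX i V * V' = z → deriv' hX i V = V * z := fun {i z} h => by
    rw [← h]; linear_combination (-deriv' hX i V) * hV
  have hv₁ := hmul hp
  have hv₂ := hmul hr
  have hv₃ := hmul ht
  rw [ht] at ha
  obtain ⟨q, hq⟩ : ∃ q, deriv' hX 0 p + p * p - r = q := ⟨_, rfl⟩
  have hq' : deriv' hX 0 p + p * p - deriv' hX 1 V * V' = q := by rw [hr, hq]
  have hpr := logDeriv_comm (deriv'_comm hX 1 0) hV hv₁ hv₂
  have hpt := logDeriv_comm (deriv'_comm hX 2 0) hV hv₁ hv₃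
  have hrt := logDeriv_comm (deriv'_comm hX 2 1) hV hv₂ hv₃
  have e₁ := zeroCurvature_fst (deriv'_comm hX 1 0) (deriv'_comm hX 2 0) C.e C.sqrtg hv₁ hv₂ hv₃
    hq.symm ha hs hb (P₁ := ringP₁ (deriv' hX) C.e C.sqrtg U V W)
    (P₂ := ringP₂ (deriv' hX) C.e C.sqrtg U p q) (Q₁ := ringQ₁ (deriv' hX) C.sqrtg U V W)
    (Q₂ := ringQ₂ (deriv' hX) C.e C.sqrtg U p q) (fun _ _ => rfl) (fun _ _ => rfl)
    (fun _ _ => rfl) (fun _ _ => rfl)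
  have e₂ := zeroCurvature_snd (deriv'_comm hX 1 0) (deriv'_comm hX 2 0) C.e C.sqrtg hv₁ hpr hpt
    hrt hq.symm ha hs (P₁ := ringP₁ (deriv' hX) C.e C.sqrtg U V W)
    (P₂ := ringP₂ (deriv' hX) C.e C.sqrtg U p q) (Q₁ := ringQ₁ (deriv' hX) C.sqrtg U V W)
    (Q₂ := ringQ₂ (deriv' hX) C.e C.sqrtg U p q) (fun _ _ => rfl) (fun _ _ => rfl)
    (fun _ _ => rfl) (fun _ _ => rfl)
  -- For a fixed test function, the analytic curvature at a point is the evaluation of the ring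
  -- expressions in `e₁` and `e₂`. The two rows can then be compared in the ring.
  have main : ∀ (Φ : Fin 2 → Times → ℂ) (f₁ f₂ : smoothRing X), Represents (Φ 0) f₁ →
      Represents (Φ 1) f₂ → ((∀ x ∈ X, ∀ i,
        opDeriv 2 (laxP C u v w) Φ i x - opDeriv 1 (laxQ C u v w) Φ i x
          + (act (laxP C u v w) (act (laxQ C u v w) Φ) i x
            - act (laxQ C u v w) (act (laxP C u v w) Φ) i x) = 0) ↔
        (2 * C.sqrtg) • (V * b * f₂)
          - (3 / 2 : ℂ) • ((deriv' hX 0 s - deriv' hX 1 (deriv' hX 1 U)) * f₁) = 0 ∧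
        (2 : ℂ) • (deriv' hX 0 a * deriv' hX 0 f₂)
          + (deriv' hX 0 (deriv' hX 0 a) + (2 : ℂ) • (p * deriv' hX 0 a) - deriv' hX 1 a) * f₂
          + (3 / 2 : ℂ) • ((deriv' hX 0 s - deriv' hX 1 (deriv' hX 1 U)) * f₂) = 0) := by
    intro Φ f₁ f₂ h₁ h₂
    have P₁ {Ψ : Fin 2 → Times → ℂ} {g₁ g₂ : smoothRing X} (k₁ : Represents (Ψ 0) g₁)
      (k₂ : Represents (Ψ 1) g₂) := represents_laxP_fst (C := C) hX hu hv hw k₁ k₂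
    have P₂ {Ψ : Fin 2 → Times → ℂ} {g₁ g₂ : smoothRing X} (k₁ : Represents (Ψ 0) g₁)
      (k₂ : Represents (Ψ 1) g₂) :=
      represents_laxP_snd (C := C) (w := w) hX hu hv hV k₁ k₂ hp hq'
    have Q₁ {Ψ : Fin 2 → Times → ℂ} {g₁ g₂ : smoothRing X} (k₁ : Represents (Ψ 0) g₁)
      (k₂ : Represents (Ψ 1) g₂) := represents_laxQ_fst (C := C) hX hu hv hw k₁ k₂
    have Q₂ {Ψ : Fin 2 → Times → ℂ} {g₁ g₂ : smoothRing X} (k₁ : Represents (Ψ 0) g₁)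
      (k₂ : Represents (Ψ 1) g₂) :=
      represents_laxQ_snd (C := C) (w := w) hX hu hv hV k₁ k₂ hp hq'
    have dΦ₁ j := h₁.pd hX j
    have dΦ₂ j := h₂.pd hX j
    rw [← e₁, ← e₂]
    constructor
    · intro h
      constructor <;> refine smoothRing_ext fun x => ?_
      · have := h x x.2 0
        simp only [opDeriv] at this
        rw [(P₁ h₁ h₂).pd hX 2 x, (Q₁ h₁ h₂).pd hX 1 x, P₁ (dΦ₁ 2) (dΦ₂ 2) x,
          Q₁ (dΦ₁ 1) (dΦ₂ 1) x, P₁ (Q₁ h₁ h₂) (Q₂ h₁ h₂) x, Q₁ (P₁ h₁ h₂) (P₂ h₁ h₂) x] at this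
        simpa only [map_add, map_sub, map_zero] using this
      · have := h x x.2 1
        simp only [opDeriv] at this
        rw [(P₂ h₁ h₂).pd hX 2 x, (Q₂ h₁ h₂).pd hX 1 x, P₂ (dΦ₁ 2) (dΦ₂ 2) x,
          Q₂ (dΦ₁ 1) (dΦ₂ 1) x, P₂ (Q₁ h₁ h₂) (Q₂ h₁ h₂) x, Q₂ (P₁ h₁ h₂) (P₂ h₁ h₂) x] at this
        simpa only [map_add, map_sub, map_zero] using this
    · rintro ⟨k₁, k₂⟩ x hx i
      lift x to X using hx
      simp only [opDeriv]
      fin_cases i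
      · have := congrArg (ev x) k₁
        simp only [Fin.zero_eta]
        rw [(P₁ h₁ h₂).pd hX 2 x, (Q₁ h₁ h₂).pd hX 1 x, P₁ (dΦ₁ 2) (dΦ₂ 2) x,
          Q₁ (dΦ₁ 1) (dΦ₂ 1) x, P₁ (Q₁ h₁ h₂) (Q₂ h₁ h₂) x, Q₁ (P₁ h₁ h₂) (P₂ h₁ h₂) x]
        simpa only [map_add, map_sub, map_zero] using this
      · have := congrArg (ev x) k₂
        simp only [Fin.mk_one]
        rw [(P₂ h₁ h₂).pd hX 2 x, (Q₂ h₁ h₂).pd hX 1 x, P₂ (dΦ₁ 2) (dΦ₂ 2) x,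
          Q₂ (dΦ₁ 1) (dΦ₂ 1) x, P₂ (Q₁ h₁ h₂) (Q₂ h₁ h₂) x, Q₂ (P₁ h₁ h₂) (P₂ h₁ h₂) x]
        simpa only [map_add, map_sub, map_zero] using this
  constructor
  · intro h f₁ f₂
    -- Zero extensions are legitimate test functions, since smoothness is demanded on `X` only.
    refine (main ![zeroExt f₁.1, zeroExt f₂.1] f₁ f₂ (represents_zeroExt f₁)
      (represents_zeroExt f₂)).1 (h _ fun i => ?_)
    fin_cases i
    · exact f₁.2
    · exact f₂.2
  · intro h Φ hΦ
    exact (main Φ _ _ (represents_toSmooth (hΦ 0)) (represents_toSmooth (hΦ 1))).2 (h _ _)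

end Represent

end

/-! ### From vanishing residuals to the elliptic coupled KP system -/

section

variable {X : Set Times}

theorem Curve.sqrtg_sq_eq (C : Curve) : C.sqrtg ^ 2 = C.g := C.sqrtg_sq

theorem Curve.g_ne_zero (C : Curve) : C.g ≠ 0 :=
  mul_ne_zero (sub_ne_zero.2 C.ne₁₂) (sub_ne_zero.2 C.ne₁₃)

theorem Curve.sqrtg_ne_zero (C : Curve) : C.sqrtg ≠ 0 := fun h =>
  C.g_ne_zero (by rw [← C.sqrtg_sq_eq, h]; norm_num)

/-- The equation for `v` in logarithmic form. -/
theorem logDeriv_eq_iff {R : Type*} [CommRing R] [Algebra ℂ R] {d : Fin 3 → Derivation ℂ R R}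
    {V V' u p r a : R} (e : ℂ) (hV : V * V' = 1) (hp : d 0 V * V' = p) (hr : d 1 V * V' = r) :
    d 2 V * V' = a - (1 / 2 : ℂ) • (d 0 (d 0 p) + (3 : ℂ) • (p * d 0 p) + p * p * p)
      - (3 : ℂ) • (d 0 u * p - (3 * e) • p) + (3 / 2 : ℂ) • (d 0 r + p * r) + (3 : ℂ) • d 1 u ↔
    d 2 V = -((1 / 2 : ℂ) • d 0 (d 0 (d 0 V))) - (3 : ℂ) • (d 0 u * d 0 V - (3 * e) • d 0 V)
      + (3 / 2 : ℂ) • d 0 (d 1 V) + (3 : ℂ) • (d 1 u * V) + a * V := by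
  have hv₁ : d 0 V = V * p := by rw [← hp]; linear_combination (-d 0 V) * hV
  have hv₂ : d 1 V = V * r := by rw [← hr]; linear_combination (-d 1 V) * hV
  simp only [hv₁, hv₂, Derivation.leibniz, map_add, smul_eq_mul]
  constructor <;> intro h
  · linear_combination (norm := algebra) V * h - d 2 V * hV
  · linear_combination (norm := algebra) V' * h +
      (a - (1 / 2 : ℂ) • (d 0 (d 0 p) + (3 : ℂ) • (p * d 0 p) + p * p * p)
      - (3 : ℂ) • (d 0 u * p - (3 * e) • p) + (3 / 2 : ℂ) • (d 0 r + p * r) + (3 : ℂ) • d 1 u) * hV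

theorem exists_inverse {v : Times → ℂ} (hv : ContDiffOn ℝ ∞ v X) (h0 : ∀ x ∈ X, v x ≠ 0) :
    ∃ V V' : smoothRing X, Represents v V ∧ V * V' = 1 :=
  ⟨toSmooth v hv, toSmooth (fun x => (v x)⁻¹) (hv.inv h0), represents_toSmooth hv,
    smoothRing_ext fun x => by
      rw [map_mul, map_one]
      exact mul_inv_cancel₀ (h0 x x.2)⟩

/-- The coordinate function `x₁`. -/
theorem exists_coordinate (hX : IsOpen X) : ∃ ξ : smoothRing X, deriv' hX 0 ξ = 1 := by
  let f : Times → ℂ := fun x => (x 0 : ℂ)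
  have hf : ContDiff ℝ ∞ f := Complex.ofRealCLM.contDiff.comp (contDiff_apply ℝ ℝ (0 : Fin 3))
  refine ⟨toSmooth f hf.contDiffOn, smoothRing_ext fun x => ?_⟩
  rw [← (represents_toSmooth hf.contDiffOn).pd hX 0 x, map_one]
  have : HasFDerivAt f (Complex.ofRealCLM.comp (ContinuousLinearMap.proj (R := ℝ) (0 : Fin 3))) x :=
    ContinuousLinearMap.hasFDerivAt
      (Complex.ofRealCLM.comp (ContinuousLinearMap.proj (R := ℝ) (φ := fun _ => ℝ) (0 : Fin 3)))
  simp [pd, this.fderiv]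

/-- A dictionary between the pointwise system and ring identities. The leading `0` in the equation
for `W` is the residual `b` of `zeroCurvature_iff_residuals`. -/
theorem represents_ckp (hX : IsOpen X) {C : Curve} {u v w s a : Times → ℂ}
    {U V W S A : smoothRing X}
    (hu : Represents u U) (hv : Represents v V) (hw : Represents w W) (hs : Represents s S)
    (ha : Represents a A) :
    EllipticCKPWith C X u v w s a ↔
      deriv' hX 0 S = deriv' hX 1 (deriv' hX 1 U) ∧
      deriv' hX 2 U = (1 / 4 : ℂ) • deriv' hX 0 (deriv' hX 0 (deriv' hX 0 U))
        + (3 / 2 : ℂ) • (deriv' hX 0 U * deriv' hX 0 U) + (3 / 4 : ℂ) • S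
        + (3 * C.sqrtg ^ 2) • (1 - V * W) ∧
      deriv' hX 2 V = -((1 / 2 : ℂ) • deriv' hX 0 (deriv' hX 0 (deriv' hX 0 V)))
        - (3 : ℂ) • (deriv' hX 0 U * deriv' hX 0 V - (3 * C.e) • deriv' hX 0 V)
        + (3 / 2 : ℂ) • deriv' hX 0 (deriv' hX 1 V) + (3 : ℂ) • (deriv' hX 1 U * V) + A * V ∧
      deriv' hX 2 W = 0 - (1 / 2 : ℂ) • deriv' hX 0 (deriv' hX 0 (deriv' hX 0 W))
        - (3 : ℂ) • (deriv' hX 0 U * deriv' hX 0 W - (3 * C.e) • deriv' hX 0 W)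
        - (3 / 2 : ℂ) • deriv' hX 0 (deriv' hX 1 W) - (3 : ℂ) • (deriv' hX 1 U * W) - A * W := by
  have d₁ {f : Times → ℂ} {F : smoothRing X} (h : Represents f F) (j : Fin 3) := h.pd hX j
  have e₁ (x : X) : (D₁ s x = D₂ (D₂ u) x ↔
      ev x (deriv' hX 0 S) = ev x (deriv' hX 1 (deriv' hX 1 U))) := by
    simp only [d₁ hs 0 x, d₁ (d₁ hu 1) 1 x]
  constructor
  · rintro ⟨-, h₁, h₂, h₃, h₄⟩
    refine ⟨smoothRing_ext fun x => ?_, smoothRing_ext fun x => ?_, smoothRing_ext fun x => ?_,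
      smoothRing_ext fun x => ?_⟩
    · exact (e₁ x).1 (h₁ x x.2)
    · have := h₂ x x.2
      simp only [d₁ hu 2 x, d₁ (d₁ (d₁ hu 0) 0) 0 x, d₁ hu 0 x, hs x, hv x, hw x, ← C.sqrtg_sq_eq] at this
      simp only [map_add, map_sub, map_mul, map_smul, smul_eq_mul, map_one]
      linear_combination this
    · have := h₃ x x.2
      simp only [d₁ hv 2 x, d₁ (d₁ (d₁ hv 0) 0) 0 x, d₁ hu 0 x, d₁ hv 0 x, hv x, d₁ hu 1 x,
        d₁ (d₁ hv 1) 0 x, ha x] at this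
      simp only [map_add, map_sub, map_neg, map_mul, map_smul, smul_eq_mul]
      linear_combination this
    · have := h₄ x x.2
      simp only [d₁ hw 2 x, d₁ (d₁ (d₁ hw 0) 0) 0 x, d₁ hu 0 x, d₁ hw 0 x, hw x, d₁ hu 1 x,
        d₁ (d₁ hw 1) 0 x, ha x] at this
      simp only [map_zero, map_sub, map_mul, map_smul, smul_eq_mul]
      linear_combination this
  · rintro ⟨h₁, h₂, h₃, h₄⟩
    refine ⟨hs.contDiffOn, fun x hx => ?_, fun x hx => ?_, fun x hx => ?_, fun x hx => ?_⟩ <;>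
      lift x to X using hx
    · exact (e₁ x).2 (by rw [h₁])
    · have := congrArg (ev x) h₂
      simp only [d₁ hu 2 x, d₁ (d₁ (d₁ hu 0) 0) 0 x, d₁ hu 0 x, hs x, hv x, hw x, ← C.sqrtg_sq_eq]
      simp only [map_add, map_sub, map_mul, map_smul, smul_eq_mul, map_one] at this
      linear_combination this
    · have := congrArg (ev x) h₃
      simp only [d₁ hv 2 x, d₁ (d₁ (d₁ hv 0) 0) 0 x, d₁ hu 0 x, d₁ hv 0 x, hv x, d₁ hu 1 x,
        d₁ (d₁ hv 1) 0 x, ha x]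
      simp only [map_add, map_sub, map_neg, map_mul, map_smul, smul_eq_mul] at this
      linear_combination this
    · have := congrArg (ev x) h₄
      simp only [d₁ hw 2 x, d₁ (d₁ (d₁ hw 0) 0) 0 x, d₁ hu 0 x, d₁ hw 0 x, hw x, d₁ hu 1 x,
        d₁ (d₁ hw 1) 0 x, ha x]
      simp only [map_zero, map_sub, map_mul, map_smul, smul_eq_mul] at this
      linear_combination this

theorem zeroCurvature_iff (C : Curve) {u v w : Times → ℂ} (hX : IsOpen X)
    (hu : ContDiffOn ℝ ∞ u X) (hv : ContDiffOn ℝ ∞ v X) (hw : ContDiffOn ℝ ∞ w X)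
    (hv0 : ∀ x ∈ X, v x ≠ 0) :
    ZeroCurvature C X u v w ↔
      ∃ s a : Times → ℂ, ContDiffOn ℝ ∞ a X ∧ (∀ x ∈ X, D₁ a x = 0 ∧ D₂ a x = 0) ∧
        EllipticCKPWith C X u v w s a := by
  obtain ⟨V, V', rv, hV⟩ := exists_inverse hv hv0
  have ru := represents_toSmooth hu
  have rw' := represents_toSmooth hw
  set U := toSmooth u hu
  set W := toSmooth w hw
  obtain ⟨p, hp⟩ : ∃ p, deriv' hX 0 V * V' = p := ⟨_, rfl⟩
  obtain ⟨r, hr⟩ : ∃ r, deriv' hX 1 V * V' = r := ⟨_, rfl⟩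
  constructor
  · intro h
    -- `S`, `A` and `B` are defined as what is missing in the equations for `u`, `ln v` and `w`, so
    -- the residual form of the curvature holds without any assumption on them.
    obtain ⟨S, hS⟩ : ∃ S, S = (4 / 3 : ℂ) • (deriv' hX 2 U
        - ((1 / 4 : ℂ) • deriv' hX 0 (deriv' hX 0 (deriv' hX 0 U))
        + (3 / 2 : ℂ) • (deriv' hX 0 U * deriv' hX 0 U) + (3 * C.sqrtg ^ 2) • (1 - V * W))) :=
      ⟨_, rfl⟩
    obtain ⟨A, hA⟩ : ∃ A, A = deriv' hX 2 V * V'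
        - (-((1 / 2 : ℂ) • (deriv' hX 0 (deriv' hX 0 p) + (3 : ℂ) • (p * deriv' hX 0 p)
        + p * p * p)) - (3 : ℂ) • (deriv' hX 0 U * p - (3 * C.e) • p)
        + (3 / 2 : ℂ) • (deriv' hX 0 r + p * r) + (3 : ℂ) • deriv' hX 1 U) := ⟨_, rfl⟩
    obtain ⟨B, hB⟩ : ∃ B, B = deriv' hX 2 W
        - (-((1 / 2 : ℂ) • deriv' hX 0 (deriv' hX 0 (deriv' hX 0 W)))
        - (3 : ℂ) • (deriv' hX 0 U * deriv' hX 0 W - (3 * C.e) • deriv' hX 0 W)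
        - (3 / 2 : ℂ) • deriv' hX 0 (deriv' hX 1 W) - (3 : ℂ) • (deriv' hX 1 U * W) - A * W) :=
      ⟨_, rfl⟩
    have hS' : deriv' hX 2 U = (1 / 4 : ℂ) • deriv' hX 0 (deriv' hX 0 (deriv' hX 0 U))
        + (3 / 2 : ℂ) • (deriv' hX 0 U * deriv' hX 0 U) + (3 / 4 : ℂ) • S
        + (3 * C.sqrtg ^ 2) • (1 - V * W) := by
      linear_combination (norm := algebra) (-3 / 4 : ℂ) • hS
    have hA' : deriv' hX 2 V * V' = A - (1 / 2 : ℂ) • (deriv' hX 0 (deriv' hX 0 p)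
        + (3 : ℂ) • (p * deriv' hX 0 p) + p * p * p)
        - (3 : ℂ) • (deriv' hX 0 U * p - (3 * C.e) • p) + (3 / 2 : ℂ) • (deriv' hX 0 r + p * r)
        + (3 : ℂ) • deriv' hX 1 U := by
      linear_combination (norm := algebra) -hA
    have key := (zeroCurvature_iff_residuals hX ru rv rw' hV hp hr hA' hS'
      (b := B) (by linear_combination (norm := algebra) -hB)).1 h
    -- The test functions `(1, 0)`, `(0, 1)` and `(0, x₁)` suffice. The coordinate `x₁` separates
    -- the coefficient of `∂₁ f₂` from that of `f₂`.
    have k₁ := (key 1 0).1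
    have k₂ := (key 0 1).1
    have k₃ := (key 0 1).2
    obtain ⟨ξ, hξ⟩ := exists_coordinate hX
    have k₄ := (key 0 ξ).2
    rw [Derivation.map_one_eq_zero] at k₃
    rw [hξ] at k₄
    have hs : deriv' hX 0 S = deriv' hX 1 (deriv' hX 1 U) := by
      linear_combination (norm := algebra) (-2 / 3 : ℂ) • k₁
    -- The product `2 √g v B` vanishes, and both `2 √g` and `v` are invertible.
    have hb : B = 0 := by
      have h2 : (2 * C.sqrtg)⁻¹ • (2 * C.sqrtg) • (V * B) = V * B :=
        inv_smul_smul₀ (mul_ne_zero two_ne_zero C.sqrtg_ne_zero) _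
      rw [mul_one, mul_zero, smul_zero, sub_zero] at k₂
      rw [k₂, smul_zero] at h2
      linear_combination (-V') * h2 - B * hV
    have ha₁ : deriv' hX 0 A = 0 := by
      linear_combination (norm := algebra) (1 / 2 : ℂ) • (k₄ - ξ * k₃)
    have ha₂ : deriv' hX 1 A = 0 := by
      rw [ha₁, hs, map_zero] at k₃
      linear_combination (norm := algebra) -k₃
    refine ⟨zeroExt S.1, zeroExt A.1, A.2, fun x hx => ?_, ?_⟩
    · lift x to X using hx
      simp only [(represents_zeroExt A).pd hX 0 x, (represents_zeroExt A).pd hX 1 x, ha₁, ha₂,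
        map_zero, and_self]
    · refine (represents_ckp hX ru rv rw' (represents_zeroExt S) (represents_zeroExt A)).2
        ⟨hs, hS', ?_, ?_⟩
      · exact (logDeriv_eq_iff _ hV hp hr).1 hA'
      · linear_combination (norm := algebra) hb - hB
  · rintro ⟨s, a, ha, ha', hc⟩
    have rs := represents_toSmooth hc.smooth_s
    have ra := represents_toSmooth ha
    obtain ⟨h₁, h₂, h₃, h₄⟩ := (represents_ckp hX ru rv rw' rs ra).1 hc
    have ha₁ : deriv' hX 0 (toSmooth a ha) = 0 := smoothRing_ext fun x => by
      rw [← ra.pd hX 0 x, map_zero]; exact (ha' x x.2).1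
    have ha₂ : deriv' hX 1 (toSmooth a ha) = 0 := smoothRing_ext fun x => by
      rw [← ra.pd hX 1 x, map_zero]; exact (ha' x x.2).2
    refine (zeroCurvature_iff_residuals hX ru rv rw' hV hp hr
      ((logDeriv_eq_iff _ hV hp hr).2 h₃) h₂ (b := 0) h₄).2 fun f₁ f₂ => ?_
    rw [ha₁, ha₂, h₁]
    simp

/-- A function that does not depend on `x₁` and vanishes at one end is zero. -/
theorem eq_zero_of_vanishesAlong {l : Filter ℝ} [l.NeBot] {f : Times → ℂ} (hf : ContDiff ℝ ∞ f)
    (h : ∀ x, D₁ f x = 0) (hl : VanishesAlong l f) : f = 0 := by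
  funext x
  have hd : ∀ t : ℝ, HasDerivAt (fun t : ℝ => f (Function.update x 0 t)) 0 t := fun t => by
    have h1 := (hf.differentiable (by simp) (Function.update x 0 t)).hasFDerivAt.comp_hasDerivAt t
      (hasDerivAt_update x 0 t)
    rwa [show fderiv ℝ f (Function.update x 0 t) (Pi.single 0 1) = 0 from h _] at h1
  have hc : ∀ t, f (Function.update x 0 t) = f x := fun t => by
    have := is_const_of_deriv_eq_zero (fun t => (hd t).differentiableAt) (fun t => (hd t).deriv) t
      (x 0)
    simpa using this
  have := hl x
  simp only [hc] at this
  exact tendsto_const_nhds_iff.1 this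

/-- The local statement leaves an unknown `a` that is independent of `x₁`. Such a function is
determined by its limit at one end, and the equation for `v` shows that this limit is zero. The
equation for `u` gives the normalisation of `s` in the same way. -/
theorem zeroCurvature_univ_iff (C : Curve) {u v w : Times → ℂ} {l : Filter ℝ}
    (hl : l = Filter.atBot ∨ l = Filter.atTop) (hu : ContDiff ℝ ∞ u) (hv : ContDiff ℝ ∞ v)
    (hw : ContDiff ℝ ∞ w) (hv0 : ∀ x, v x ≠ 0) (lu : VanishesWithDerivatives l u)
    (lv : VanishesWithDerivatives l (fun x => v x - 1))
    (lw : VanishesWithDerivatives l (fun x => w x - 1)) :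
    ZeroCurvature C Set.univ u v w ↔
      ∃ s : Times → ℂ, VanishesAlong l s ∧ EllipticCKP C Set.univ u v w s := by
  have hne : l.NeBot := by rcases hl with rfl | rfl <;> infer_instance
  rw [zeroCurvature_iff C isOpen_univ hu.contDiffOn hv.contDiffOn hw.contDiffOn fun x _ => hv0 x]
  constructor
  · rintro ⟨s, a, ha, ha', hc⟩
    have pv : ∀ j, pd j (fun x => v x - 1) = pd j v := fun j => by
      funext x; simp [pd, fderiv_sub_const]
    have v1 : VanishesAlong l (D₁ v) := by simpa [pv] using lv [0] (by simp)
    have v3 : VanishesAlong l (D₃ v) := by simpa [pv] using lv [2] (by simp)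
    have v12 : VanishesAlong l (D₁ (D₂ v)) := by simpa [pv] using lv [0, 1] (by simp)
    have v111 : VanishesAlong l (D₁ (D₁ (D₁ v))) := by simpa [pv] using lv [0, 0, 0] (by simp)
    have u1 : VanishesAlong l (D₁ u) := lu [0] (by simp)
    have u2 : VanishesAlong l (D₂ u) := lu [1] (by simp)
    have u3 : VanishesAlong l (D₃ u) := lu [2] (by simp)
    have u111 : VanishesAlong l (D₁ (D₁ (D₁ u))) := lu [0, 0, 0] (by simp)
    have v0 : ∀ x : Times, Tendsto (fun t : ℝ => v (Function.update x 0 t)) l (𝓝 1) := fun x => by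
      simpa using (lv [] (by simp) x).add_const 1
    have w0 : ∀ x : Times, Tendsto (fun t : ℝ => w (Function.update x 0 t)) l (𝓝 1) := fun x => by
      simpa using (lw [] (by simp) x).add_const 1
    have ha0 : VanishesAlong l a := fun x => by
      -- The equation for `v` solved for `a`: each term of the numerator contains a vanishing
      -- derivative, and the denominator tends to `1`.
      have h : a = fun x => (D₃ v x - (-(1 / 2) * D₁ (D₁ (D₁ v)) x
          - 3 * (D₁ u x - 3 * C.e) * D₁ v x + 3 / 2 * D₁ (D₂ v) x + 3 * D₂ u x * v x)) / v x := by
        funext y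
        rw [eq_div_iff (hv0 y), hc.eq_v y trivial]
        ring
      rw [h]
      have := ((v3 x).sub (((((v111 x).const_mul (-(1 / 2) : ℂ)).sub
        ((((u1 x).sub_const (3 * C.e)).const_mul 3).mul (v1 x))).add
        ((v12 x).const_mul (3 / 2 : ℂ))).add (((u2 x).const_mul 3).mul (v0 x)))).div (v0 x)
        one_ne_zero
      convert this using 1
      · norm_num
        rfl
      · norm_num
    have a0 := eq_zero_of_vanishesAlong (contDiffOn_univ.1 ha) (fun x => (ha' x trivial).1) ha0
    subst a0
    refine ⟨s, fun x => ?_, hc⟩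
    -- Solved for `s`; here the term `1 - v w` tends to zero because `v` and `w` both tend to `1`.
    have h : s = fun x => 4 / 3 * (D₃ u x - (1 / 4 * D₁ (D₁ (D₁ u)) x + 3 / 2 * D₁ u x ^ 2
        + 3 * C.g * (1 - v x * w x))) := by
      funext y
      rw [hc.eq_u y trivial]
      ring
    rw [h]
    have := ((u3 x).sub ((((u111 x).const_mul (1 / 4 : ℂ)).add
      (((u1 x).pow 2).const_mul (3 / 2 : ℂ))).add
      ((((v0 x).mul (w0 x)).const_sub 1).const_mul (3 * C.g)))).const_mul (4 / 3 : ℂ)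
    simpa using this
  · rintro ⟨s, -, hc⟩
    refine ⟨s, 0, contDiffOn_const, fun x _ => ?_, hc⟩
    constructor <;> simp [pd]

end

section

/-! ### The elliptic curve and the kernel -/

/-- Meant for `℘` and `℘'`, whose continuity is available off the countable period lattice; on a
countable set every function is measurable. -/
theorem measurable_of_continuousOn_compl_countable {f : ℂ → ℂ} {s : Set ℂ} (hs : s.Countable)
    (hf : ContinuousOn f sᶜ) : Measurable f := by
  refine measurable_of_restrict_of_restrict_compl hs.measurableSet ?_ ?_
  · have := hs.to_subtype
    exact measurable_of_countable _
  · exact (continuousOn_iff_continuous_domRestrict.1 hf).measurable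

namespace Curve

variable (C : Curve)

theorem measurable_weierstrassP : Measurable C.L.weierstrassP :=
  measurable_of_continuousOn_compl_countable (s := C.L.lattice)
    (Set.countable_coe_iff.1 C.L.latticeEquivProd.toEquiv.injective.countable)
    C.L.differentiableOn_weierstrassP.continuousOn

theorem measurable_derivWeierstrassP : Measurable C.L.derivWeierstrassP :=
  measurable_of_continuousOn_compl_countable (s := C.L.lattice)
    (Set.countable_coe_iff.1 C.L.latticeEquivProd.toEquiv.injective.countable)
    C.L.differentiableOn_derivWeierstrassP.continuousOn

theorem measurable_K : Measurable C.K := C.measurable_weierstrassP.sub_const _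

theorem measurable_k : Measurable C.k :=
  (C.measurable_derivWeierstrassP.div (C.measurable_weierstrassP.sub_const _)).const_mul _

theorem measurable_c (i : ℤ) : Measurable fun κ => C.c κ i := by
  unfold c
  split_ifs
  · exact C.measurable_K.pow_const _
  · exact C.measurable_k.mul (C.measurable_K.pow_const _)

theorem measurable_dispersion (j : ℕ) : Measurable (C.dispersion j) := by
  unfold dispersion
  split_ifs
  · exact (C.measurable_K.pow_const _).sub ((C.measurable_K.const_div _).pow_const _)
  · exact C.measurable_k.pow_const _

theorem measurable_Ω : Measurable fun p : ℂ × ℂ => C.Ω p.1 p.2 := by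
  have k₁ : Measurable fun p : ℂ × ℂ => C.k p.1 :=
    C.measurable_k.comp measurable_fst
  have k₂ : Measurable fun p : ℂ × ℂ => C.k p.2 :=
    C.measurable_k.comp measurable_snd
  have K₁ : Measurable fun p : ℂ × ℂ => C.K p.1 :=
    C.measurable_K.comp measurable_fst
  have K₂ : Measurable fun p : ℂ × ℂ => C.K p.2 :=
    C.measurable_K.comp measurable_snd
  refine Measurable.ite ?_ ((K₁.sub K₂).div (k₁.add k₂))
    ((k₁.sub k₂).div (((K₁.mul K₂).const_div _).const_sub _))
  exact (k₁.add k₂) (measurableSet_singleton (0 : ℂ)).compl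

theorem Ω_swap (κ κ' : ℂ) : C.Ω κ' κ = -C.Ω κ κ' := by
  unfold Ω
  rw [add_comm (C.k κ'), mul_comm (C.K κ')]
  split_ifs <;> ring

variable {C}

theorem K_ne_zero {κ : ℂ} (h : κ ∈ C.regular) : C.K κ ≠ 0 := sub_ne_zero.2 h.2

/-- The Weierstrass cubic has no quadratic term. The values at `1`, `-1` and `0` isolate that
coefficient. -/
theorem sum_branch (C : Curve) : C.e₁ + C.e₂ + C.e₃ = 0 := by
  linear_combination (1 / 8 : ℂ) * (C.branch 1 + C.branch (-1)) - (1 / 4 : ℂ) * C.branch 0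

/-- In the coordinate `K` the cubic is `4 K (K + e₁ - e₂) (K + e₁ - e₃)`, with middle coefficient `2
e₁ - e₂ - e₃ = 3 e₁` because the branch points add up to zero. -/
theorem k_sq {κ : ℂ} (h : κ ∈ C.regular) :
    C.k κ ^ 2 = C.K κ + 3 * C.e + C.g / C.K κ := by
  have hK := K_ne_zero h
  have h1 := C.L.derivWeierstrassP_sq κ h.1
  rw [C.branch] at h1
  have h2 := C.sum_branch
  have hk : C.k κ = 1 / 2 * (C.L.derivWeierstrassP κ / C.K κ) := rfl
  have hP : C.L.weierstrassP κ = C.K κ + C.e₁ := by simp [K, e]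
  rw [hk]
  rw [hP] at h1
  field_simp
  rw [h1]
  simp only [g, e]
  linear_combination (-4 * C.K κ ^ 2) * h2

theorem c_add_two {κ : ℂ} (h : κ ∈ C.regular) (i : ℤ) : C.c κ (i + 2) = C.K κ * C.c κ i := by
  have hi : (i + 2) / 2 = i / 2 + 1 := by omega
  have hp : Even (i + 2) ↔ Even i := by simp
  unfold c
  rw [hi, zpow_add_one₀ (K_ne_zero h)]
  simp only [hp]
  split_ifs <;> ring

theorem c_sub_two {κ : ℂ} (h : κ ∈ C.regular) (i : ℤ) : C.K κ * C.c κ (i - 2) = C.c κ i := by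
  rw [← c_add_two h, sub_add_cancel]

/-- For an odd label the product contains `k²`, which the curve equation turns into three even
labels. -/
theorem k_mul_c {κ : ℂ} (h : κ ∈ C.regular) (i : ℤ) :
    C.k κ * C.c κ i = raise C.e C.g (C.c κ) i := by
  unfold raise
  split_ifs with hi
  · have hi' : ¬ Even (i + 1) := by simpa [Int.even_add_one] using hi
    have : (i + 1) / 2 = i / 2 := by obtain ⟨m, rfl⟩ := hi; omega
    simp only [c, hi, hi', this, if_true, if_false]
  · obtain ⟨m, rfl⟩ := Int.not_even_iff_odd.1 hi
    have e1 : (2 * m + 1) / 2 = m := by omega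
    have e2 : (2 * m + 1 + 1) / 2 = m + 1 := by omega
    have e3 : (2 * m + 1 - 1) / 2 = m := by omega
    have e4 : (2 * m + 1 - 3) / 2 = m - 1 := by omega
    have p2 : Even (2 * m + 1 + 1) := ⟨m + 1, by ring⟩
    have p3 : Even (2 * m + 1 - 1) := ⟨m, by ring⟩
    have p4 : Even (2 * m + 1 - 3) := ⟨m - 1, by ring⟩
    have hK := K_ne_zero h
    simp only [c, hi, p2, p3, p4, e1, e2, e3, e4, if_true, if_false, smul_eq_mul,
      zpow_add_one₀ hK, zpow_sub_one₀ hK]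
    linear_combination C.K κ ^ m * k_sq h

theorem c_zero (κ : ℂ) : C.c κ 0 = 1 := by simp [c]

theorem c_one (κ : ℂ) : C.c κ 1 = C.k κ := by simp [c]

theorem c_two (κ : ℂ) : C.c κ 2 = C.K κ := by simp [c]

theorem c_three (κ : ℂ) : C.c κ 3 = C.k κ * C.K κ := by
  simp [c, show ¬ Even (3 : ℤ) by decide]

theorem c_four (κ : ℂ) : C.c κ 4 = C.K κ ^ 2 := by
  simp [c, show Even (4 : ℤ) by decide]

theorem c_neg_two (κ : ℂ) : C.c κ (-2) = (C.K κ)⁻¹ := by simp [c]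

/-- The kernel solves both linear equations, away from the poles. -/
theorem kernel_eq {κ κ' : ℂ} (h : κ ∈ C.regular) (h' : κ' ∈ C.regular) (hp : ¬ C.IsPole κ κ') :
    (C.k κ + C.k κ') * C.Ω κ κ' = C.K κ - C.K κ' ∧
    (1 - C.g / (C.K κ * C.K κ')) * C.Ω κ κ' = C.k κ - C.k κ' := by
  have hK := K_ne_zero h
  have hK' := K_ne_zero h'
  -- The difference of the curve equations at the two parameters, factorised; it is the reason why
  -- the two expressions for the kernel agree.
  have hr : (C.k κ + C.k κ') * (C.k κ - C.k κ')
      = (1 - C.g / (C.K κ * C.K κ')) * (C.K κ - C.K κ') := by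
    have e1 := k_sq h
    have e2 := k_sq h'
    have e3 : C.g / C.K κ - C.g / C.K κ' = -C.g / (C.K κ * C.K κ') * (C.K κ - C.K κ') := by
      field_simp; ring
    linear_combination e1 - e2 + e3
  unfold Ω
  split_ifs with h0
  · refine ⟨mul_div_cancel₀ _ h0, ?_⟩
    rw [← mul_div_assoc, ← hr, mul_div_cancel_left₀ _ h0]
  · rw [not_not] at h0
    have h1 : 1 - C.g / (C.K κ * C.K κ') ≠ 0 := by
      intro h1
      refine hp ⟨h0, ?_⟩
      rw [sub_eq_zero, eq_comm, div_eq_one_iff_eq (mul_ne_zero hK hK')] at h1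
      exact h1.symm
    refine ⟨?_, mul_div_cancel₀ _ h1⟩
    -- Away from the poles, `k + k' = 0` forces `K = K'`, so the first linear equation reads `0 =
    -- 0`.
    rw [h0, zero_mul] at hr ⊢
    rcases mul_eq_zero.1 hr.symm with h2 | h2
    · exact absurd h2 h1
    · exact h2.symm

end Curve

end

section

/-! ### Integrals against the antisymmetric measure -/

namespace SkewMeasure

variable {ζ : SkewMeasure} {F G : ℂ × ℂ → ℂ} {z w : ℂ}

/-- The integral of `F` converges absolutely and has the value `z`. -/
def HasInt (ζ : SkewMeasure) (F : ℂ × ℂ → ℂ) (z : ℂ) : Prop := ζ.Converges F ∧ ζ.int F = z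

theorem Converges.hasInt (h : ζ.Converges F) : ζ.HasInt F (ζ.int F) := ⟨h, rfl⟩

theorem HasInt.congr (hF : ζ.HasInt F z) (h : ∀ᵐ p ∂ζ.base, F p = G p) : ζ.HasInt G z := by
  have h' : (fun p => ζ.density p * F p) =ᵐ[ζ.base] fun p => ζ.density p * G p := by
    filter_upwards [h] with p hp
    rw [hp]
  exact ⟨(integrable_congr h').1 hF.1, (integral_congr_ae h').symm.trans hF.2⟩

theorem HasInt.add (hF : ζ.HasInt F z) (hG : ζ.HasInt G w) :
    ζ.HasInt (fun p => F p + G p) (z + w) := by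
  have e : (fun p => ζ.density p * (F p + G p)) =
      fun p => ζ.density p * F p + ζ.density p * G p := by funext p; ring
  refine ⟨?_, ?_⟩
  · rw [Converges, e]; exact Integrable.add hF.1 hG.1
  · rw [int, e, integral_add hF.1 hG.1, ← hF.2, ← hG.2]; rfl

theorem HasInt.const_mul (hF : ζ.HasInt F z) (c : ℂ) :
    ζ.HasInt (fun p => c * F p) (c * z) := by
  have e : (fun p => ζ.density p * (c * F p)) = fun p => c * (ζ.density p * F p) := by
    funext p; ring
  refine ⟨?_, ?_⟩
  · rw [Converges, e]; exact Integrable.const_mul hF.1 c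
  · rw [int, e, integral_const_mul, ← hF.2]; rfl

theorem HasInt.sub (hF : ζ.HasInt F z) (hG : ζ.HasInt G w) :
    ζ.HasInt (fun p => F p - G p) (z - w) := by
  have := hF.add (hG.const_mul (-1))
  simpa [sub_eq_add_neg] using this

/-- Turns a pointwise identity of the kernel into an identity of integrals, with convergence carried
along by the arithmetic of `HasInt`. -/
theorem HasInt.unique (hF : ζ.HasInt F z) (hG : ζ.HasInt G w)
    (h : ∀ᵐ p ∂ζ.base, F p = G p) : z = w :=
  (hF.congr h).2.symm.trans hG.2

end SkewMeasure

namespace Setting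

open SkewMeasure

variable (𝒮 : Setting)

theorem ρ_succ (n : ℤ) (x : Times) {κ : ℂ} (h : κ ∈ 𝒮.S) :
    𝒮.C.sqrtg * 𝒮.ρ (n + 1) x κ = 𝒮.C.K κ * 𝒮.ρ n x κ := by
  have hK := Curve.K_ne_zero (𝒮.S_regular h)
  have hg := 𝒮.C.sqrtg_ne_zero
  simp only [ρ]
  rw [zpow_add_one₀ (div_ne_zero hK hg)]
  field_simp

theorem measurable_ρ (n : ℤ) (x : Times) : Measurable (𝒮.ρ n x) := by
  unfold ρ
  refine Measurable.mul (Complex.measurable_exp.comp (Measurable.add ?_ ?_)) ?_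
  · exact Finset.measurable_sum _ fun j _ => (𝒮.C.measurable_dispersion _).const_mul _
  · exact Finset.measurable_sum _ fun j _ => (𝒮.C.measurable_dispersion _).const_mul _
  · exact (𝒮.C.measurable_K.div_const _).pow_const _

/-- The integrand of the pairing of a function with the plane wave `ρ_n c^[i]`. -/
def pairing (n : ℤ) (x : Times) (f : ℂ → ℂ) (i : ℤ) (p : ℂ × ℂ) : ℂ :=
  f p.1 * 𝒮.C.c p.2 i * 𝒮.ρ n x p.2

/-- The functions whose pairings with all plane waves converge, also with the kernel inserted. -/
def admissible (n : ℤ) (x : Times) : Submodule ℂ (ℂ → ℂ) where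
  carrier := {f | AEStronglyMeasurable (fun p : ℂ × ℂ => f p.1) 𝒮.ζ.base ∧
    (∀ i, 𝒮.ζ.Converges (𝒮.pairing n x f i)) ∧
    ∀ κ ∈ 𝒮.S, ∀ i, 𝒮.ζ.Converges fun p => 𝒮.C.Ω κ p.2 * 𝒮.pairing n x f i p}
  zero_mem' := by
    refine ⟨aestronglyMeasurable_const, fun i => ?_, fun κ _ i => ?_⟩ <;>
    simp [Converges, pairing]
  add_mem' {f g} hf hg := by
    refine ⟨hf.1.add hg.1, fun i => ?_, fun κ hκ i => ?_⟩
    · refine (((hf.2.1 i).hasInt.add (hg.2.1 i).hasInt).congr (ae_of_all _ fun p => ?_)).1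
      simp [pairing]; ring
    · refine (((hf.2.2 κ hκ i).hasInt.add (hg.2.2 κ hκ i).hasInt).congr
        (ae_of_all _ fun p => ?_)).1
      simp [pairing]; ring
  smul_mem' a f hf := by
    refine ⟨hf.1.const_smul a, fun i => ?_, fun κ hκ i => ?_⟩
    · refine (((hf.2.1 i).hasInt.const_mul a).congr (ae_of_all _ fun p => ?_)).1
      simp [pairing]; ring
    · refine (((hf.2.2 κ hκ i).hasInt.const_mul a).congr (ae_of_all _ fun p => ?_)).1
      simp [pairing]; ring

variable {𝒮} {n : ℤ} {x : Times}

/-- The pairing with the plane wave `ρ_n c^[i]`. -/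
def pairW (i : ℤ) : 𝒮.admissible n x →ₗ[ℂ] ℂ where
  toFun f := 𝒮.ζ.int (𝒮.pairing n x f i)
  map_add' f g := (((f.2.2.1 i).hasInt.add (g.2.2.1 i).hasInt).congr (ae_of_all _ fun p => by
    simp [pairing]; ring)).2
  map_smul' a f := (((f.2.2.1 i).hasInt.const_mul a).congr (ae_of_all _ fun p => by
    simp [pairing]; ring)).2

/-- The pairing with the plane wave `ρ_n c^[i]` and the kernel. -/
def pairT (κ : 𝒮.S) (i : ℤ) : 𝒮.admissible n x →ₗ[ℂ] ℂ where
  toFun f := 𝒮.ζ.int fun p => 𝒮.C.Ω κ p.2 * 𝒮.pairing n x f i p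
  map_add' f g := (((f.2.2.2 κ κ.2 i).hasInt.add (g.2.2.2 κ κ.2 i).hasInt).congr
    (ae_of_all _ fun p => by simp [pairing]; ring)).2
  map_smul' a f := (((f.2.2.2 κ κ.2 i).hasInt.const_mul a).congr
    (ae_of_all _ fun p => by simp [pairing]; ring)).2

theorem hasInt_pairW (f : 𝒮.admissible n x) (i : ℤ) :
    𝒮.ζ.HasInt (𝒮.pairing n x f i) (pairW i f) := (f.2.2.1 i).hasInt

theorem hasInt_pairT (f : 𝒮.admissible n x) (κ : 𝒮.S) (i : ℤ) :
    𝒮.ζ.HasInt (fun p => 𝒮.C.Ω κ p.2 * 𝒮.pairing n x f i p) (pairT κ i f) :=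
  (f.2.2.2 κ κ.2 i).hasInt

/-- The operator on the left-hand side of the linear integral equation. -/
def integralOp (κ : 𝒮.S) : 𝒮.admissible n x →ₗ[ℂ] ℂ :=
  (LinearMap.proj (R := ℂ) (φ := fun _ : ℂ => ℂ) (κ : ℂ)).comp (𝒮.admissible n x).subtype
    + 𝒮.ρ n x κ • pairT κ 0

theorem integralOp_apply (κ : 𝒮.S) (f : 𝒮.admissible n x) :
    integralOp κ f = (f : ℂ → ℂ) κ + 𝒮.ρ n x κ * pairT κ 0 f := rfl

theorem hasInt_integrand (f : 𝒮.admissible n x) (κ : 𝒮.S) :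
    𝒮.ζ.HasInt (𝒮.integrand n x κ f) (𝒮.ρ n x κ * pairT κ 0 f) :=
  ((hasInt_pairT f κ 0).const_mul _).congr (ae_of_all _ fun p => by
    simp only [integrand, pairing, Curve.c_zero]; ring)

/-- The difference of the two functions solves the homogeneous equation. All evolution and shift
relations are obtained from this uniqueness. -/
theorem eqOn_of_integralOp_eq (h : 𝒮.HomogeneousTrivial n x) {f g : 𝒮.admissible n x}
    (hfg : ∀ κ : 𝒮.S, integralOp κ f = integralOp κ g) (κ : 𝒮.S) :
    (f : ℂ → ℂ) κ = (g : ℂ → ℂ) κ := by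
  have := h _ (f - g).2.1 (fun κ hκ => (hasInt_integrand (f - g) ⟨κ, hκ⟩).1)
    (fun κ hκ => by
      rw [(hasInt_integrand (f - g) ⟨κ, hκ⟩).2]
      have := sub_eq_zero.2 (hfg ⟨κ, hκ⟩)
      rwa [← map_sub] at this) κ κ.2
  exact sub_eq_zero.1 this

theorem pairW_congr {f g : 𝒮.admissible n x}
    (h : ∀ κ : 𝒮.S, (f : ℂ → ℂ) κ = (g : ℂ → ℂ) κ) (i : ℤ) : pairW i f = pairW i g := by
  refine (hasInt_pairW f i).unique (hasInt_pairW g i) ?_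
  filter_upwards [𝒮.concentrated] with p hp
  simp only [pairing, h ⟨p.1, hp.1⟩]

theorem ae_kernel (κ : 𝒮.S) : ∀ᵐ p ∂𝒮.ζ.base, p.2 ∈ 𝒮.S ∧
    (𝒮.C.k κ + 𝒮.C.k p.2) * 𝒮.C.Ω κ p.2 = 𝒮.C.K κ - 𝒮.C.K p.2 ∧
    (1 - 𝒮.C.g / (𝒮.C.K κ * 𝒮.C.K p.2)) * 𝒮.C.Ω κ p.2 = 𝒮.C.k κ - 𝒮.C.k p.2 := by
  filter_upwards [𝒮.concentrated, 𝒮.no_pole κ κ.2] with p hp hnp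
  exact ⟨hp.2, Curve.kernel_eq (𝒮.S_regular κ.2) (𝒮.S_regular hp.2) hnp⟩

/-- The integrated form of `(k + k') Ω = K - K'`: a factor depending on `κ'` is absorbed into the
label of the plane wave, and the right-hand side no longer contains the kernel. -/
theorem kernel_one (f : 𝒮.admissible n x) (κ : 𝒮.S) :
    𝒮.C.k κ * pairT κ 0 f + pairT κ 1 f = 𝒮.C.K κ * pairW 0 f - pairW 2 f := by
  refine HasInt.unique (((hasInt_pairT f κ 0).const_mul _).add (hasInt_pairT f κ 1))
    (((hasInt_pairW f 0).const_mul _).sub (hasInt_pairW f 2)) ?_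
  filter_upwards [ae_kernel κ] with p ⟨_, h, _⟩
  simp only [pairing, Curve.c_zero, Curve.c_one, Curve.c_two]
  linear_combination ((f : ℂ → ℂ) p.1 * 𝒮.ρ n x p.2) * h

/-- The sum of the two dispersion coefficients is `(K + K') (1 - g / (K K'))`, whose product with
`Ω` is `(K + K') (k - k')`. -/
theorem kernel_two (f : 𝒮.admissible n x) (κ : 𝒮.S) :
    (𝒮.C.K κ - 𝒮.C.g / 𝒮.C.K κ) * pairT κ 0 f + (pairT κ 2 f - 𝒮.C.g * pairT κ (-2) f)
      = 𝒮.C.k κ * 𝒮.C.K κ * pairW 0 f + 𝒮.C.k κ * pairW 2 f - 𝒮.C.K κ * pairW 1 f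
        - pairW 3 f := by
  refine HasInt.unique (((hasInt_pairT f κ 0).const_mul _).add ((hasInt_pairT f κ 2).sub
    ((hasInt_pairT f κ (-2)).const_mul _)))
    (((((hasInt_pairW f 0).const_mul _).add ((hasInt_pairW f 2).const_mul _)).sub
      ((hasInt_pairW f 1).const_mul _)).sub (hasInt_pairW f 3)) ?_
  filter_upwards [ae_kernel κ] with p ⟨hp, _, h⟩
  have hK := Curve.K_ne_zero (𝒮.S_regular κ.2)
  have hK' := Curve.K_ne_zero (𝒮.S_regular hp)
  have e : (𝒮.C.K κ + 𝒮.C.K p.2) * (1 - 𝒮.C.g / (𝒮.C.K κ * 𝒮.C.K p.2))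
      = 𝒮.C.K κ - 𝒮.C.g / 𝒮.C.K κ + 𝒮.C.K p.2 - 𝒮.C.g * (𝒮.C.K p.2)⁻¹ := by
    field_simp; ring
  simp only [pairing, Curve.c_zero, Curve.c_one, Curve.c_two, Curve.c_three, Curve.c_neg_two]
  linear_combination ((f : ℂ → ℂ) p.1 * 𝒮.ρ n x p.2) * ((𝒮.C.K κ + 𝒮.C.K p.2) * h
    - 𝒮.C.Ω κ p.2 * e)

theorem hasInt_raise {F : ℤ → ℂ × ℂ → ℂ} {z : ℤ → ℂ} (h : ∀ i, 𝒮.ζ.HasInt (F i) (z i))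
    (e g : ℂ) (i : ℤ) :
    𝒮.ζ.HasInt (fun p => raise e g (fun l => F l p) i) (raise e g z i) := by
  unfold raise
  split_ifs
  · exact h _
  · exact ((h _).add ((h _).const_mul _)).add ((h _).const_mul _)

theorem raise_mul (e g a b : ℂ) (f : ℤ → ℂ) (i : ℤ) :
    raise e g (fun l => a * f l * b) i = a * raise e g f i * b := by
  unfold raise
  split_ifs
  · rfl
  · simp only [smul_eq_mul]; ring

/-- Since `k³ + k'³ = (k + k') (k² - k k' + k'²)`, the kernel disappears, and the curve equation
then eliminates both squares from `(K - K') (k² - k k' + k'²)`. -/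
theorem kernel_three (f : 𝒮.admissible n x) (κ : 𝒮.S) :
    𝒮.C.k κ ^ 3 * pairT κ 0 f + raise 𝒮.C.e 𝒮.C.g (raise 𝒮.C.e 𝒮.C.g (raise 𝒮.C.e 𝒮.C.g
        fun i => pairT κ i f)) 0
      = 𝒮.C.K κ ^ 2 * pairW 0 f - pairW 4 f
        + 6 * 𝒮.C.e * (𝒮.C.K κ * pairW 0 f - pairW 2 f)
        + 𝒮.C.g * (𝒮.C.K κ * pairW (-2) f - (𝒮.C.K κ)⁻¹ * pairW 2 f)
        - 𝒮.C.k κ * 𝒮.C.K κ * pairW 1 f + 𝒮.C.k κ * pairW 3 f := by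
  refine HasInt.unique (((hasInt_pairT f κ 0).const_mul _).add (hasInt_raise (hasInt_raise
      (hasInt_raise (fun i => hasInt_pairT f κ i) _ _) _ _) _ _ _))
    ((((((((hasInt_pairW f 0).const_mul _).sub (hasInt_pairW f 4)).add
      ((((hasInt_pairW f 0).const_mul _).sub (hasInt_pairW f 2)).const_mul _)).add
      ((((hasInt_pairW f (-2)).const_mul _).sub ((hasInt_pairW f 2).const_mul _)).const_mul _))).sub
      ((hasInt_pairW f 1).const_mul _)).add ((hasInt_pairW f 3).const_mul _)) ?_
  filter_upwards [ae_kernel κ] with p ⟨hp, h, _⟩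
  have hK := Curve.K_ne_zero (𝒮.S_regular κ.2)
  have hK' := Curve.K_ne_zero (𝒮.S_regular hp)
  have key : ∀ i, 𝒮.C.k p.2 * 𝒮.C.c p.2 i = raise 𝒮.C.e 𝒮.C.g (𝒮.C.c p.2) i :=
    Curve.k_mul_c (𝒮.S_regular hp)
  have e1 : (fun i => 𝒮.C.Ω κ p.2 * 𝒮.pairing n x f i p)
      = fun i => (𝒮.C.Ω κ p.2 * (f : ℂ → ℂ) p.1) * 𝒮.C.c p.2 i * 𝒮.ρ n x p.2 := by
    funext i; simp only [pairing]; ring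
  have e2 : ∀ (a b : ℂ), raise 𝒮.C.e 𝒮.C.g (fun i => a * 𝒮.C.c p.2 i * b)
      = fun i => (a * 𝒮.C.k p.2) * 𝒮.C.c p.2 i * b := by
    intro a b
    funext i
    rw [raise_mul, ← key]
    ring
  have s1 := Curve.k_sq (𝒮.S_regular κ.2)
  have s2 := Curve.k_sq (𝒮.S_regular hp)
  have e3 : (𝒮.C.K κ - 𝒮.C.K p.2) * (𝒮.C.g / 𝒮.C.K κ + 𝒮.C.g / 𝒮.C.K p.2)
      = 𝒮.C.g * (𝒮.C.K κ * (𝒮.C.K p.2)⁻¹ - (𝒮.C.K κ)⁻¹ * 𝒮.C.K p.2) := by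
    field_simp; ring
  rw [e1, e2, e2, e2]
  simp only [pairing, Curve.c_zero, Curve.c_one, Curve.c_two, Curve.c_three, Curve.c_four,
    Curve.c_neg_two]
  linear_combination ((f : ℂ → ℂ) p.1 * 𝒮.ρ n x p.2) *
    ((𝒮.C.k κ ^ 2 - 𝒮.C.k κ * 𝒮.C.k p.2 + 𝒮.C.k p.2 ^ 2) * h
      + (𝒮.C.K κ - 𝒮.C.K p.2) * (s1 + s2) + e3)

/-- Comes from `(K K' - g) Ω = K K' (k - k')`. It measures how far multiplication of the plane waves
by `K` fails to commute with the integral operator. -/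
theorem kernel_shift (f : 𝒮.admissible n x) (κ : 𝒮.S) :
    𝒮.C.K κ * pairT κ 2 f - 𝒮.C.g * pairT κ 0 f
      = 𝒮.C.k κ * 𝒮.C.K κ * pairW 2 f - 𝒮.C.K κ * pairW 3 f := by
  refine HasInt.unique (((hasInt_pairT f κ 2).const_mul _).sub ((hasInt_pairT f κ 0).const_mul _))
    (((hasInt_pairW f 2).const_mul _).sub ((hasInt_pairW f 3).const_mul _)) ?_
  filter_upwards [ae_kernel κ] with p ⟨hp, _, h⟩
  have hK := Curve.K_ne_zero (𝒮.S_regular κ.2)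
  have hK' := Curve.K_ne_zero (𝒮.S_regular hp)
  have e : 𝒮.C.K κ * 𝒮.C.K p.2 * (1 - 𝒮.C.g / (𝒮.C.K κ * 𝒮.C.K p.2))
      = 𝒮.C.K κ * 𝒮.C.K p.2 - 𝒮.C.g := by
    field_simp
  simp only [pairing, Curve.c_zero, Curve.c_two, Curve.c_three]
  linear_combination ((f : ℂ → ℂ) p.1 * 𝒮.ρ n x p.2) * (𝒮.C.K κ * 𝒮.C.K p.2 * h
    - 𝒮.C.Ω κ p.2 * e)

theorem pairing_succ (f : ℂ → ℂ) (i : ℤ) {p : ℂ × ℂ} (hp : p.2 ∈ 𝒮.S) :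
    𝒮.C.sqrtg * 𝒮.pairing (n + 1) x f i p = 𝒮.pairing n x f (i + 2) p := by
  simp only [pairing, Curve.c_add_two (𝒮.S_regular hp)]
  linear_combination (f p.1 * 𝒮.C.c p.2 i) * 𝒮.ρ_succ n x hp

theorem hasInt_pairing_succ {f : ℂ → ℂ} {z : ℂ} {i : ℤ} {θ : ℂ × ℂ → ℂ} :
    𝒮.ζ.HasInt (fun p => θ p * 𝒮.pairing (n + 1) x f i p) z ↔
      𝒮.ζ.HasInt (fun p => θ p * 𝒮.pairing n x f (i + 2) p) (𝒮.C.sqrtg * z) := by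
  have hg := 𝒮.C.sqrtg_ne_zero
  constructor
  · intro h
    refine (h.const_mul 𝒮.C.sqrtg).congr ?_
    filter_upwards [𝒮.concentrated] with p hp
    linear_combination θ p * pairing_succ f i hp.2
  · intro h
    have := h.const_mul 𝒮.C.sqrtg⁻¹
    rw [inv_mul_cancel_left₀ hg] at this
    refine this.congr ?_
    filter_upwards [𝒮.concentrated] with p hp
    rw [← pairing_succ f i hp.2]
    field_simp

/-- Raising `n` multiplies `ρ_n` by `K / √g`, that is, moves labels by two. Admissibility refers to
all labels, hence does not depend on `n`. -/
theorem admissible_succ : 𝒮.admissible (n + 1) x = 𝒮.admissible n x := by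
  have hg := 𝒮.C.sqrtg_ne_zero
  have key : ∀ (f : ℂ → ℂ) (i : ℤ) (θ : ℂ × ℂ → ℂ),
      𝒮.ζ.Converges (fun p => θ p * 𝒮.pairing (n + 1) x f i p) ↔
      𝒮.ζ.Converges (fun p => θ p * 𝒮.pairing n x f (i + 2) p) := fun f i θ =>
    ⟨fun h => (hasInt_pairing_succ.1 h.hasInt).1, fun h => by
      have := h.hasInt
      rw [← mul_inv_cancel_left₀ hg (𝒮.ζ.int _)] at this
      exact (hasInt_pairing_succ.2 this).1⟩
  ext f
  refine and_congr Iff.rfl (and_congr ?_ (forall₂_congr fun κ _ => ?_))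
  · have key1 := fun i => key f i (fun _ => 1)
    simp only [one_mul] at key1
    exact ⟨fun h i => by simpa using (key1 (i - 2)).1 (h _), fun h i => (key1 i).2 (h _)⟩
  · have key1 := fun i => key f i (fun p => 𝒮.C.Ω κ p.2)
    exact ⟨fun h i => by simpa using (key1 (i - 2)).1 (h _), fun h i => (key1 i).2 (h _)⟩

theorem pairW_succ {f : 𝒮.admissible (n + 1) x} {f₀ : 𝒮.admissible n x}
    (h : (f : ℂ → ℂ) = f₀) (i : ℤ) : 𝒮.C.sqrtg * pairW i f = pairW (i + 2) f₀ := by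
  have h1 := hasInt_pairW f₀ (i + 2)
  have h2 := hasInt_pairW f i
  rw [h] at h2
  refine HasInt.unique (h2.const_mul _) h1 ?_
  filter_upwards [𝒮.concentrated] with p hp
  exact pairing_succ _ i hp.2

theorem pairT_succ {f : 𝒮.admissible (n + 1) x} {f₀ : 𝒮.admissible n x}
    (h : (f : ℂ → ℂ) = f₀) (κ : 𝒮.S) (i : ℤ) :
    𝒮.C.sqrtg * pairT κ i f = pairT κ (i + 2) f₀ := by
  have h1 := hasInt_pairT f₀ κ (i + 2)
  have h2 := hasInt_pairT f κ i
  rw [h] at h2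
  exact (hasInt_pairing_succ (θ := fun p => 𝒮.C.Ω κ p.2)).1 h2 |>.2.symm.trans h1.2

end Setting

end

section

namespace Setting

open SkewMeasure

/-! ### Solutions of the linear integral equation -/

variable {𝒮 : Setting} {X : Set Times} {u : ℤ → Times → ℂ → ℤ → ℂ} {n : ℤ} {x : Times}

theorem aestronglyMeasurable_pairing {f : ℂ → ℂ}
    (hf : AEStronglyMeasurable (fun p : ℂ × ℂ => f p.1) 𝒮.ζ.base) (i : ℤ) :
    AEStronglyMeasurable (𝒮.pairing n x f i) 𝒮.ζ.base :=
  (hf.mul ((𝒮.C.measurable_c i).comp measurable_snd).aestronglyMeasurable).mul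
    ((𝒮.measurable_ρ n x).comp measurable_snd).aestronglyMeasurable

theorem measurable_Ω_right (κ : ℂ) : Measurable fun p : ℂ × ℂ => 𝒮.C.Ω κ p.2 := by
  have h : Measurable fun p : ℂ × ℂ => (κ, p.2) := measurable_const.prodMk measurable_snd
  have := 𝒮.C.measurable_Ω.comp h
  simpa only [Function.comp_def] using this

theorem norm_pairing_le {f : ℂ → ℂ} {b r : ℂ → ℝ} {i : ℤ}
    (hb : ∀ κ ∈ 𝒮.S, ‖f κ‖ ≤ b κ)
    (hr : ∀ κ ∈ 𝒮.S, ‖𝒮.ρ n x κ * 𝒮.C.c κ i‖ ≤ r κ) {p : ℂ × ℂ} (h₁ : p.1 ∈ 𝒮.S)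
    (h₂ : p.2 ∈ 𝒮.S) : ‖𝒮.pairing n x f i p‖ ≤ b p.1 * r p.2 := by
  have : 𝒮.pairing n x f i p = f p.1 * (𝒮.ρ n x p.2 * 𝒮.C.c p.2 i) := by
    simp only [pairing]; ring
  rw [this, norm_mul]
  exact mul_le_mul (hb _ h₁) (hr _ h₂) (norm_nonneg _) ((norm_nonneg _).trans (hb _ h₁))

theorem mem_admissible_of_bound {f : ℂ → ℂ}
    (hf : AEStronglyMeasurable (fun p : ℂ × ℂ => f p.1) 𝒮.ζ.base)
    (h : ∀ N : ℕ, ∃ b r : ℂ → ℝ, (∀ κ ∈ 𝒮.S, ‖f κ‖ ≤ b κ) ∧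
      (∀ κ ∈ 𝒮.S, ∀ i : ℤ, |i| ≤ N → ‖𝒮.ρ n x κ * 𝒮.C.c κ i‖ ≤ r κ) ∧
      Integrable (fun p : ℂ × ℂ => ‖𝒮.ζ.density p‖ * b p.1 * r p.2) 𝒮.ζ.base ∧
      ∀ κ ∈ 𝒮.S, Integrable
        (fun p : ℂ × ℂ => ‖𝒮.ζ.density p‖ * b p.1 * ‖𝒮.C.Ω κ p.2‖ * r p.2) 𝒮.ζ.base) :
    f ∈ 𝒮.admissible n x := by
  have hd := 𝒮.ζ.measurable_density.aestronglyMeasurable (μ := 𝒮.ζ.base)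
  refine ⟨hf, fun i => ?_, fun κ hκ i => ?_⟩ <;>
    obtain ⟨b, r, hb, hr, h₁, h₂⟩ := h i.natAbs
  · refine h₁.mono' (hd.mul (aestronglyMeasurable_pairing hf i)) ?_
    filter_upwards [𝒮.concentrated] with p hp
    rw [norm_mul, mul_assoc]
    gcongr
    exact norm_pairing_le hb (fun κ hκ => hr κ hκ i (by simp)) hp.1 hp.2
  · refine (h₂ κ hκ).mono' (hd.mul ((measurable_Ω_right κ).aestronglyMeasurable.mul
      (aestronglyMeasurable_pairing hf i))) ?_
    filter_upwards [𝒮.concentrated] with p hp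
    have := norm_pairing_le hb (fun κ hκ => hr κ hκ i (by simp)) hp.1 hp.2
    rw [norm_mul, norm_mul]
    calc _ ≤ ‖𝒮.ζ.density p‖ * (‖𝒮.C.Ω κ p.2‖ * (b p.1 * r p.2)) := by gcongr
      _ = _ := by ring

theorem solution_mem (hs : 𝒮.IsSolution X u) (hr : 𝒮.IsRegular X u) (hx : x ∈ X) (n i : ℤ) :
    (fun κ => u n x κ i) ∈ 𝒮.admissible n x := by
  refine mem_admissible_of_bound (hs.measurable n x hx i) fun N => ?_
  obtain ⟨b, r, hb, h₁, h₂, -⟩ := hr.dominated n x hx (max N i.natAbs)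
  have hb' := hb.self_of_nhds
  refine ⟨b, r, fun κ hκ => (hb' κ hκ i ?_).1, fun κ hκ l hl => (hb' κ hκ l ?_).2.2, h₁, h₂⟩
  · push_cast; exact le_max_of_le_right (by simp)
  · push_cast; exact le_max_of_le_left hl

/-- A component of the solution, as an admissible function. -/
def sol (hs : 𝒮.IsSolution X u) (hr : 𝒮.IsRegular X u) (hx : x ∈ X) (n i : ℤ) :
    𝒮.admissible n x := ⟨fun κ => u n x κ i, solution_mem hs hr hx n i⟩

theorem pairW_sol (hs : 𝒮.IsSolution X u) (hr : 𝒮.IsRegular X u) (hx : x ∈ X) (n i j : ℤ) :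
    pairW j (sol hs hr hx n i) = 𝒮.U u n i j x := rfl

theorem integralOp_sol (hs : 𝒮.IsSolution X u) (hr : 𝒮.IsRegular X u) (hx : x ∈ X) (n i : ℤ)
    (κ : 𝒮.S) : integralOp κ (sol hs hr hx n i) = 𝒮.ρ n x κ * 𝒮.C.c κ i := by
  rw [integralOp_apply, ← hs.eqn n x hx κ κ.2 i]
  exact congrArg _ (hasInt_integrand (sol hs hr hx n i) κ).2.symm

/-- Replacing `ρ_n c^[j]` by the left-hand side of the integral equation splits `U_n^[i,j]` into a
double integral of `u^[i](κ) u^[j](κ')` and a fourfold integral with the kernel. The first is skew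
because `dζ` is, the second because `Ω` is, after exchange of the two pairs of variables. The last
domination hypothesis justifies Fubini. -/
theorem U_skew (hs : 𝒮.IsSolution X u) (hr : 𝒮.IsRegular X u) (hx : x ∈ X) (n i j : ℤ) :
    𝒮.U u n i j x = -𝒮.U u n j i x := by
  have := 𝒮.ζ.sigmaFinite
  let d := 𝒮.ζ.density
  let G : ℤ → ℤ → (ℂ × ℂ) × (ℂ × ℂ) → ℂ := fun i j z =>
    d z.1 * u n x z.1.1 i * 𝒮.ρ n x z.1.2 *
      (d z.2 * (𝒮.C.Ω z.1.2 z.2.2 * 𝒮.pairing n x (fun l => u n x l j) 0 z.2))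
  have hG : ∀ i j, Integrable (G i j) (𝒮.ζ.base.prod 𝒮.ζ.base) := by
    intro i j
    obtain ⟨b, r, hb, -, -, h₃⟩ := hr.dominated n x hx (max i.natAbs j.natAbs)
    have hb' := hb.self_of_nhds
    have m₁ : Measurable d := 𝒮.ζ.measurable_density
    have m₂ : Measurable fun z : (ℂ × ℂ) × (ℂ × ℂ) => z.1 := measurable_fst
    have m₃ : Measurable fun z : (ℂ × ℂ) × (ℂ × ℂ) => z.2 := measurable_snd
    have m₄ : Measurable fun z : (ℂ × ℂ) × (ℂ × ℂ) => (z.1.2, z.2.2) :=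
      (measurable_snd.comp m₂).prodMk (measurable_snd.comp m₃)
    refine h₃.mono' ?_ ?_
    · refine AEStronglyMeasurable.mul (AEStronglyMeasurable.mul (AEStronglyMeasurable.mul ?_ ?_) ?_)
        (AEStronglyMeasurable.mul ?_ (AEStronglyMeasurable.mul ?_ ?_))
      · exact (m₁.comp m₂).aestronglyMeasurable
      · exact (hs.measurable n x hx i).comp_quasiMeasurePreserving
          Measure.quasiMeasurePreserving_fst
      · exact ((𝒮.measurable_ρ n x).comp (measurable_snd.comp m₂)).aestronglyMeasurable
      · exact (m₁.comp m₃).aestronglyMeasurable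
      · exact (𝒮.C.measurable_Ω.comp m₄).aestronglyMeasurable
      · exact (aestronglyMeasurable_pairing (hs.measurable n x hx j) 0).comp_quasiMeasurePreserving
          Measure.quasiMeasurePreserving_snd
    · filter_upwards [Measure.quasiMeasurePreserving_fst.ae 𝒮.concentrated,
        Measure.quasiMeasurePreserving_snd.ae 𝒮.concentrated] with z h1 h2
      have c1 := (hb' _ h1.1 i (by push_cast; exact le_max_of_le_left (by simp))).1
      have c2 := (hb' _ h2.1 j (by push_cast; exact le_max_of_le_right (by simp))).1
      have c3 := (hb' _ h1.2 0 (by simp)).2.2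
      have c4 := (hb' _ h2.2 0 (by simp)).2.2
      simp only [Curve.c_zero, mul_one] at c3 c4
      have b1 := (norm_nonneg _).trans c1
      have r1 := (norm_nonneg _).trans c3
      have b2 := (norm_nonneg _).trans c2
      simp only [G, pairing, norm_mul, Curve.c_zero, mul_one]
      calc _ ≤ ‖d z.1‖ * b z.1.1 * r z.1.2 *
            (‖d z.2‖ * (‖𝒮.C.Ω z.1.2 z.2.2‖ * (b z.2.1 * r z.2.2))) := by gcongr
        _ = _ := by ring
  have inner : ∀ i j, ∀ p : ℂ × ℂ, ∀ hp : p.2 ∈ 𝒮.S,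
      ∫ q, G i j (p, q) ∂𝒮.ζ.base = d p * u n x p.1 i * 𝒮.ρ n x p.2 *
        pairT ⟨p.2, hp⟩ 0 (sol hs hr hx n j) := fun i j p hp =>
    integral_const_mul (d p * u n x p.1 i * 𝒮.ρ n x p.2)
      fun q => d q * (𝒮.C.Ω p.2 q.2 * 𝒮.pairing n x (fun l => u n x l j) 0 q)
  have point : ∀ i j, ∀ᵐ p ∂𝒮.ζ.base, d p * 𝒮.pairing n x (fun l => u n x l i) j p
      = d p * (u n x p.1 i * u n x p.2 j) + ∫ q, G i j (p, q) ∂𝒮.ζ.base := by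
    intro i j
    filter_upwards [𝒮.concentrated] with p hp
    rw [inner i j p hp.2]
    have := integralOp_sol hs hr hx n j ⟨p.2, hp.2⟩
    rw [integralOp_apply] at this
    simp only [sol] at this ⊢
    simp only [pairing]
    linear_combination (-(d p * u n x p.1 i)) * this
  have split : ∀ i j, 𝒮.U u n i j x = (∫ p, d p * (u n x p.1 i * u n x p.2 j) ∂𝒮.ζ.base)
      + ∫ z, G i j z ∂(𝒮.ζ.base.prod 𝒮.ζ.base) := by
    intro i j
    have h1 : Integrable (fun p => d p * 𝒮.pairing n x (fun l => u n x l i) j p) 𝒮.ζ.base :=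
      (hasInt_pairW (sol hs hr hx n i) j).1
    have h2 := (hG i j).integral_prod_left
    -- Convergence of the double integral is not assumed; it follows from that of the other two
    -- terms.
    have h3 : Integrable (fun p : ℂ × ℂ => d p * (u n x p.1 i * u n x p.2 j)) 𝒮.ζ.base := by
      refine (integrable_congr ?_).1 (h1.sub h2)
      filter_upwards [point i j] with p hp
      simp only [Pi.sub_apply, hp, add_sub_cancel_right]
    rw [integral_prod _ (hG i j), ← integral_add h3 h2]
    exact integral_congr_ae (point i j)
  have first : (∫ p, d p * (u n x p.1 i * u n x p.2 j) ∂𝒮.ζ.base)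
      = -∫ p, d p * (u n x p.1 j * u n x p.2 i) ∂𝒮.ζ.base := by
    rw [← integral_neg]
    have e : 𝒮.ζ.base.map (MeasurableEquiv.prodComm (α := ℂ) (β := ℂ)) = 𝒮.ζ.base :=
      𝒮.ζ.base_swap
    conv_lhs => rw [← e]
    rw [integral_map_equiv]
    refine integral_congr_ae (ae_of_all _ fun p => ?_)
    have hd : d p.swap = -d p := 𝒮.ζ.density_swap p
    change d p.swap * (u n x p.2 i * u n x p.1 j) = -(d p * (u n x p.1 j * u n x p.2 i))
    rw [hd]; ring
  have second : (∫ z, G i j z ∂(𝒮.ζ.base.prod 𝒮.ζ.base))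
      = -∫ z, G j i z ∂(𝒮.ζ.base.prod 𝒮.ζ.base) := by
    rw [← integral_neg, ← integral_prod_swap]
    refine integral_congr_ae (ae_of_all _ fun z => ?_)
    simp only [G, pairing, Prod.fst_swap, Prod.snd_swap, Curve.c_zero, 𝒮.C.Ω_swap z.1.2 z.2.2]
    ring
  rw [split i j, split j i, first, second]
  ring

/-- The solution at level `n + 1` is put into the operator at level `n`. By `kernel_shift` the
discrepancy is a combination of `ρ_n k K` and `ρ_n K`, the sources of the components `3` and `2`,
with entries of `U_{n+1}` as coefficients. -/
theorem sol_up (hs : 𝒮.IsSolution X u) (hr : 𝒮.IsRegular X u)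
    (hh : ∀ n, ∀ x ∈ X, 𝒮.HomogeneousTrivial n x) (hx : x ∈ X) (n i : ℤ)
    (f : 𝒮.admissible n x) (hf : (f : ℂ → ℂ) = fun κ => u (n + 1) x κ i) (κ : 𝒮.S) :
    ((𝒮.C.sqrtg • f : 𝒮.admissible n x) : ℂ → ℂ) κ
      = ((sol hs hr hx n (i + 2) - 𝒮.U u (n + 1) i 0 x • sol hs hr hx n 3
        + 𝒮.U u (n + 1) i 1 x • sol hs hr hx n 2 : 𝒮.admissible n x) : ℂ → ℂ) κ := by
  refine eqOn_of_integralOp_eq (hh n x hx) (fun κ => ?_) κ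
  have hg := 𝒮.C.sqrtg_ne_zero
  have hκ := 𝒮.S_regular κ.2
  have hK := Curve.K_ne_zero hκ
  simp only [map_add, map_sub, map_smul, smul_eq_mul, integralOp_sol, Curve.c_add_two hκ,
    Curve.c_two, Curve.c_three]
  have h1 := integralOp_sol hs hr hx (n + 1) i κ
  rw [integralOp_apply] at h1 ⊢
  have hf' : ((sol hs hr hx (n + 1) i : 𝒮.admissible (n + 1) x) : ℂ → ℂ) = f := hf.symm
  have h2 := pairT_succ hf' κ 0
  have h3 := pairW_succ hf' 0
  have h4 := pairW_succ hf' 1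
  have h5 := kernel_shift f κ
  have h6 := 𝒮.ρ_succ n x κ.2
  have h7 := 𝒮.C.sqrtg_sq_eq
  rw [hf'] at h1
  rw [pairW_sol] at h3 h4
  norm_num at h2 h3 h4
  have h8 : 𝒮.C.sqrtg * (𝒮.C.sqrtg * ((f : ℂ → ℂ) κ + 𝒮.ρ n x κ * pairT κ 0 f))
      = 𝒮.C.sqrtg * (𝒮.ρ n x κ * (𝒮.C.K κ * 𝒮.C.c κ i) - 𝒮.U u (n + 1) i 0 x *
        (𝒮.ρ n x κ * (𝒮.C.k κ * 𝒮.C.K κ)) + 𝒮.U u (n + 1) i 1 x * (𝒮.ρ n x κ * 𝒮.C.K κ)) := by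
    rw [← h7] at h5
    generalize pairT κ 0 (sol hs hr hx (n + 1) i) = T at *
    generalize pairT κ 0 f = T₀ at *
    generalize pairT κ 2 f = T₂ at *
    generalize pairW 2 f = W₂ at *
    generalize pairW 3 f = W₃ at *
    linear_combination 𝒮.C.sqrtg ^ 2 * h1 + (𝒮.C.c κ i * 𝒮.C.sqrtg - 𝒮.C.sqrtg * T) * h6
      - 𝒮.ρ n x κ * 𝒮.C.K κ * h2 - 𝒮.ρ n x κ * h5 + 𝒮.ρ n x κ * 𝒮.C.k κ * 𝒮.C.K κ * h3
      - 𝒮.ρ n x κ * 𝒮.C.K κ * h4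
  exact mul_left_cancel₀ hg h8

end Setting

end

/-! ### The downward shift, the shift of the potential matrix, and preparations for time derivatives
-/

section

namespace Setting

open SkewMeasure

variable {𝒮 : Setting} {X : Set Times} {u : ℤ → Times → ℂ → ℤ → ℂ} {n : ℤ} {x : Times}

/-- The mirror image of `sol_up`: a solution at level `n` in the operator at level `n + 1`. The
sources are now those of the components `1` and `0`. -/
theorem sol_down (hs : 𝒮.IsSolution X u) (hr : 𝒮.IsRegular X u)
    (hh : ∀ n, ∀ x ∈ X, 𝒮.HomogeneousTrivial n x) (hx : x ∈ X) (n i : ℤ) (κ : 𝒮.S) :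
    𝒮.C.sqrtg * u n x κ i = 𝒮.C.sqrtg ^ 2 * u (n + 1) x κ (i - 2)
      + 𝒮.U u n i 2 x * u (n + 1) x κ 1 - 𝒮.U u n i 3 x * u (n + 1) x κ 0 := by
  let f : 𝒮.admissible (n + 1) x :=
    ⟨fun κ => u n x κ i, by rw [admissible_succ]; exact solution_mem hs hr hx n i⟩
  refine eqOn_of_integralOp_eq (hh (n + 1) x hx) (f := 𝒮.C.sqrtg • f)
    (g := 𝒮.C.sqrtg ^ 2 • sol hs hr hx (n + 1) (i - 2)
      + 𝒮.U u n i 2 x • sol hs hr hx (n + 1) 1 - 𝒮.U u n i 3 x • sol hs hr hx (n + 1) 0)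
    (fun κ => ?_) κ
  have hg := 𝒮.C.sqrtg_ne_zero
  simp only [map_add, map_sub, map_smul, smul_eq_mul, integralOp_sol, Curve.c_zero, Curve.c_one]
  have h1 := integralOp_sol hs hr hx n i κ
  rw [integralOp_apply] at h1 ⊢
  have h2 := pairT_succ (f := f) (f₀ := sol hs hr hx n i) rfl κ 0
  have h5 := kernel_shift (sol hs hr hx n i) κ
  rw [pairW_sol, pairW_sol, ← 𝒮.C.sqrtg_sq_eq] at h5
  have h6 := 𝒮.ρ_succ n x κ.2
  have h7 := Curve.c_sub_two (𝒮.S_regular κ.2) i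
  rw [zero_add] at h2
  have hf : (f : ℂ → ℂ) κ = (sol hs hr hx n i : ℂ → ℂ) κ := rfl
  rw [← hf] at h1
  refine mul_left_cancel₀ hg ?_
  generalize pairT κ 0 (sol hs hr hx n i) = T at *
  generalize pairT κ 2 (sol hs hr hx n i) = T₂ at *
  generalize pairT κ 0 f = T₀ at *
  linear_combination 𝒮.C.sqrtg ^ 2 * h1 + 𝒮.ρ n x κ * h5 - 𝒮.C.sqrtg ^ 2 * 𝒮.ρ n x κ * h7
    + 𝒮.C.sqrtg * 𝒮.ρ (n + 1) x κ * h2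
    - (𝒮.C.sqrtg ^ 2 * 𝒮.C.c κ (i - 2) + 𝒮.U u n i 2 x * 𝒮.C.k κ - 𝒮.U u n i 3 x - T₂) * h6

/-- A solution at level `n + 1` as an admissible function at level `n`. -/
theorem exists_sol_succ (hs : 𝒮.IsSolution X u) (hr : 𝒮.IsRegular X u) (hx : x ∈ X) (n i : ℤ) :
    ∃ f : 𝒮.admissible n x, (f : ℂ → ℂ) = fun κ => u (n + 1) x κ i :=
  ⟨⟨_, by rw [← admissible_succ]; exact solution_mem hs hr hx (n + 1) i⟩, rfl⟩

/-- `sol_up` paired with the plane wave of label `j + 2`, which at level `n + 1` has label `j`. -/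
theorem U_up (hs : 𝒮.IsSolution X u) (hr : 𝒮.IsRegular X u)
    (hh : ∀ n, ∀ x ∈ X, 𝒮.HomogeneousTrivial n x) (hx : x ∈ X) (n i j : ℤ) :
    𝒮.C.sqrtg ^ 2 * 𝒮.U u (n + 1) i j x = 𝒮.U u n (i + 2) (j + 2) x
      - 𝒮.U u (n + 1) i 0 x * 𝒮.U u n 3 (j + 2) x
      + 𝒮.U u (n + 1) i 1 x * 𝒮.U u n 2 (j + 2) x := by
  obtain ⟨f, hf⟩ := exists_sol_succ hs hr hx n i
  have h1 := pairW_congr (sol_up hs hr hh hx n i f hf) (j + 2)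
  have hf' : ((sol hs hr hx (n + 1) i : 𝒮.admissible (n + 1) x) : ℂ → ℂ) = f := hf.symm
  have h2 := pairW_succ hf' j
  simp only [map_add, map_sub, map_smul, smul_eq_mul, pairW_sol] at h1 h2
  linear_combination h1 + 𝒮.C.sqrtg * h2

/-! ### Dependence on the times -/

/-- The coordinates, as complex-valued linear functionals. -/
def coord (l : Fin 3) : Times →L[ℝ] ℂ :=
  Complex.ofRealCLM.comp (ContinuousLinearMap.proj (R := ℝ) (φ := fun _ : Fin 3 => ℝ) l)

theorem coord_single (l m : Fin 3) :
    coord l (Pi.single m 1) = if l = m then 1 else 0 := by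
  simp only [coord, ContinuousLinearMap.comp_apply, ContinuousLinearMap.proj_apply,
    Pi.single_apply, Complex.ofRealCLM_apply]
  split_ifs <;> simp

theorem clm_eq_sum (L : Times →L[ℝ] ℂ) : L = ∑ l, L (Pi.single l 1) • coord l := by
  refine ContinuousLinearMap.coe_injective (LinearMap.pi_ext' fun m => LinearMap.ext_ring ?_)
  simp [coord_single]

theorem sum_coord_single (a : Fin 3 → ℂ) (m : Fin 3) :
    (∑ l, a l • coord l) (Pi.single m 1) = a m := by
  simp [coord_single]

theorem hasFDerivAt_ρ (n : ℤ) (x : Times) (κ : ℂ) :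
    HasFDerivAt (fun x => 𝒮.ρ n x κ)
      (∑ l : Fin 3, (𝒮.C.dispersion ((l : ℕ) + 1) κ * 𝒮.ρ n x κ) • coord l) x := by
  have h1 : HasFDerivAt (fun x : Times => (∑ j : Fin 3, (x j : ℂ) * 𝒮.C.dispersion ((j : ℕ) + 1) κ)
      + 𝒮.y.sum fun j t => t * 𝒮.C.dispersion j κ)
      (∑ l : Fin 3, 𝒮.C.dispersion ((l : ℕ) + 1) κ • coord l) x := by
    refine HasFDerivAt.add_const _ ?_
    refine HasFDerivAt.fun_sum fun l _ => ?_
    exact (coord l).hasFDerivAt.mul_const _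
  have h2 := h1.cexp.mul_const ((𝒮.C.K κ / 𝒮.C.sqrtg) ^ n)
  refine h2.congr_fderiv ?_
  rw [Finset.smul_sum, Finset.smul_sum]
  refine Finset.sum_congr rfl fun l _ => ?_
  rw [smul_smul, smul_smul]
  congr 1
  simp only [ρ]
  ring

/-- The effect of multiplication by the coefficient of the time `x_{l+1}` on the labels. -/
def dispRaise {M : Type*} [AddCommGroup M] [Module ℂ M] (e g : ℂ) (l : Fin 3) (f : ℤ → M) :
    ℤ → M :=
  ![raise e g f, fun i => f (i + 2) - g • f (i - 2), raise e g (raise e g (raise e g f))] l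

theorem dispersion_mul_c {C : Curve} {κ : ℂ} (h : κ ∈ C.regular) (l : Fin 3) (i : ℤ) :
    C.dispersion ((l : ℕ) + 1) κ * C.c κ i = dispRaise C.e C.g l (C.c κ) i := by
  have key := Curve.k_mul_c h
  have hf : raise C.e C.g (C.c κ) = fun i => C.k κ * C.c κ i * 1 := by
    funext i; rw [mul_one, key]
  fin_cases l
  · simp [dispRaise, Curve.dispersion, key]
  · have h1 := Curve.c_add_two h i
    have h2 := Curve.c_sub_two h i
    have hK := Curve.K_ne_zero h
    simp [dispRaise, Curve.dispersion]
    rw [h1, ← h2]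
    field_simp
  · have h3 : ¬ Even 3 := by decide
    have e : ∀ a : ℂ, raise C.e C.g (fun i => a * C.c κ i * 1)
        = fun i => a * C.k κ * C.c κ i * 1 := by
      intro a
      funext i
      rw [raise_mul, ← key]; ring
    change C.dispersion 3 κ * _ = raise _ _ (raise _ _ (raise _ _ (C.c κ))) i
    rw [hf, e, e]
    simp only [Curve.dispersion, h3, if_false]
    ring

theorem norm_raise_le {e g : ℂ} {f : ℤ → ℂ} {R : ℝ} {N : ℕ}
    (h : ∀ i : ℤ, |i| ≤ (N + 3 : ℕ) → ‖f i‖ ≤ R) {i : ℤ} (hi : |i| ≤ N) :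
    ‖raise e g f i‖ ≤ (1 + ‖3 * e‖ + ‖g‖) * R := by
  have hR : 0 ≤ R := (norm_nonneg _).trans (h 0 (by simp; omega))
  push_cast at h
  rw [abs_le] at hi
  have b1 := h (i + 1) (by rw [abs_le]; omega)
  have b2 := h (i - 1) (by rw [abs_le]; omega)
  have b3 := h (i - 3) (by rw [abs_le]; omega)
  unfold raise
  split_ifs
  · nlinarith [mul_nonneg (norm_nonneg (3 * e)) hR, mul_nonneg (norm_nonneg g) hR]
  · refine (norm_add₃_le).trans ?_
    rw [norm_smul, norm_smul, add_mul, add_mul, one_mul]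
    gcongr

/-- Each multiplication by `k` moves labels by at most three, and the third time uses three of them;
hence the margin `9` and the cube of the constant for a single step. -/
theorem exists_dispRaise_bound (e g : ℂ) : ∃ M : ℝ, ∀ (f : ℤ → ℂ) (R : ℝ) (N : ℕ),
    (∀ i : ℤ, |i| ≤ (N + 9 : ℕ) → ‖f i‖ ≤ R) → ∀ (l : Fin 3) (i : ℤ), |i| ≤ N →
      ‖dispRaise e g l f i‖ ≤ M * R := by
  set A := 1 + ‖3 * e‖ + ‖g‖
  have hA : 1 ≤ A := by
    have := norm_nonneg (3 * e)
    have := norm_nonneg g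
    simp only [A]; linarith
  refine ⟨A ^ 3, fun f R N h l i hi => ?_⟩
  have hR : 0 ≤ R := (norm_nonneg _).trans (h 0 (by simp; omega))
  have hA3 : A ≤ A ^ 3 := le_self_pow₀ hA (by norm_num)
  have h9 : ∀ i : ℤ, |i| ≤ (N + 6 : ℕ) → ‖raise e g f i‖ ≤ A * R := fun i hi => norm_raise_le h hi
  have h6 : ∀ i : ℤ, |i| ≤ (N + 3 : ℕ) → ‖raise e g (raise e g f) i‖ ≤ A * (A * R) :=
    fun i hi => norm_raise_le h9 hi
  fin_cases l
  · refine (norm_raise_le (N := N) (fun i hi => h i (hi.trans (by push_cast; omega))) hi).trans ?_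
    exact mul_le_mul_of_nonneg_right hA3 hR
  · rw [abs_le] at hi
    have b1 := h (i + 2) (by rw [abs_le]; push_cast; omega)
    have b2 := h (i - 2) (by rw [abs_le]; push_cast; omega)
    refine (norm_sub_le _ _).trans ?_
    rw [norm_smul]
    calc ‖f (i + 2)‖ + ‖g‖ * ‖f (i - 2)‖ ≤ R + ‖g‖ * R := by gcongr
      _ ≤ A * R := by
        have := mul_nonneg (norm_nonneg (3 * e)) hR
        simp only [A]; linarith
      _ ≤ _ := mul_le_mul_of_nonneg_right hA3 hR
  · refine (norm_raise_le h6 hi).trans (le_of_eq ?_)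
    ring

theorem differentiableAt_sol (hr : 𝒮.IsRegular X u) (hX : IsOpen X) (hx : x ∈ X) (n i : ℤ) {κ : ℂ}
    (hκ : κ ∈ 𝒮.S) : DifferentiableAt ℝ (fun x => u n x κ i) x :=
  ((hr.contDiffOn n κ hκ i).contDiffAt (hX.mem_nhds hx)).differentiableAt (by simp)

theorem norm_pd_le (f : Times → ℂ) (l : Fin 3) (x : Times) : ‖pd l f x‖ ≤ ‖fderiv ℝ f x‖ := by
  refine ((fderiv ℝ f x).le_opNorm _).trans (le_of_eq ?_)
  rw [Pi.norm_single, norm_one, mul_one]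

/-- A derivative is a limit of difference quotients, each measurable because the solution is. The
sequence starts at `m₀` so that the displaced points stay in `X`. -/
theorem aestronglyMeasurable_pd (hs : 𝒮.IsSolution X u) (hr : 𝒮.IsRegular X u) (hX : IsOpen X)
    (hx : x ∈ X) (n i : ℤ) (l : Fin 3) :
    AEStronglyMeasurable (fun p : ℂ × ℂ => pd l (fun x => u n x p.1 i) x) 𝒮.ζ.base := by
  let t : ℕ → ℝ := fun m => 1 / ((m : ℝ) + 1)
  have ht : Tendsto t atTop (𝓝 0) := tendsto_one_div_add_atTop_nhds_zero_nat
  have ht0 : ∀ m, t m ≠ 0 := fun m => by positivity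
  have hlim : Tendsto (fun m => x + t m • (Pi.single l 1 : Times)) atTop (𝓝 x) := by
    simpa using tendsto_const_nhds.add (ht.smul_const (Pi.single l 1 : Times))
  obtain ⟨m₀, hm₀⟩ := eventually_atTop.1 (hlim.eventually (hX.mem_nhds hx))
  refine aestronglyMeasurable_of_tendsto_ae atTop
    (f := fun m (p : ℂ × ℂ) => (t (m + m₀))⁻¹ •
      (u n (x + t (m + m₀) • (Pi.single l 1 : Times)) p.1 i - u n x p.1 i)) (fun m => ?_) ?_
  · exact ((hs.measurable n _ (hm₀ _ (Nat.le_add_left _ _)) i).sub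
      (hs.measurable n x hx i)).const_smul (t (m + m₀))⁻¹
  · filter_upwards [𝒮.concentrated] with p hp
    have h1 := (differentiableAt_sol hr hX hx n i hp.1).hasFDerivAt.hasLineDerivAt (Pi.single l 1)
    have h2 := h1.tendsto_slope_zero
    refine h2.comp ?_
    refine tendsto_nhdsWithin_iff.2 ⟨ht.comp (tendsto_add_atTop_nat m₀), ?_⟩
    exact Eventually.of_forall fun m => ht0 _

end Setting

end

/-! ### Differentiation under the integral sign -/

section

namespace Setting

open SkewMeasure

variable {𝒮 : Setting} {X : Set Times} {u : ℤ → Times → ℂ → ℤ → ℂ} {n : ℤ} {x : Times}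

/-- The derivative of the integrand of a pairing with respect to `x_{l+1}`. -/
def pairingDeriv (𝒮 : Setting) (u : ℤ → Times → ℂ → ℤ → ℂ) (n : ℤ) (i j : ℤ) (l : Fin 3)
    (x : Times) (p : ℂ × ℂ) : ℂ :=
  𝒮.pairing n x (fun κ => pd l (fun x => u n x κ i) x) j p
    + 𝒮.C.dispersion ((l : ℕ) + 1) p.2 * 𝒮.pairing n x (fun κ => u n x κ i) j p

theorem hasFDerivAt_pairing (hr : 𝒮.IsRegular X u) (hX : IsOpen X) (hx : x ∈ X) (n i j : ℤ)
    {p : ℂ × ℂ} (hp : p.1 ∈ 𝒮.S) :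
    HasFDerivAt (fun x => 𝒮.pairing n x (fun κ => u n x κ i) j p)
      (∑ l, pairingDeriv 𝒮 u n i j l x p • coord l) x := by
  have h1 := (differentiableAt_sol hr hX hx n i hp).hasFDerivAt
  rw [clm_eq_sum (fderiv ℝ _ x)] at h1
  refine ((h1.mul_const (𝒮.C.c p.2 j)).mul (hasFDerivAt_ρ n x p.2)).congr_fderiv ?_
  rw [Finset.smul_sum, Finset.smul_sum, Finset.smul_sum, ← Finset.sum_add_distrib]
  refine Finset.sum_congr rfl fun l _ => ?_
  rw [smul_smul, smul_smul, smul_smul]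
  refine (add_smul _ _ (coord l)).symm.trans (congrArg (· • coord l) ?_)
  simp only [pairingDeriv, pairing, pd]
  ring

theorem norm_pairingDeriv_le {b r : ℂ → ℝ} {M : ℝ} {N : ℕ} {i j : ℤ} (hi : |i| ≤ N)
    (hj : |j| ≤ N) (hM : ∀ (f : ℤ → ℂ) (R : ℝ) (N : ℕ),
      (∀ i : ℤ, |i| ≤ (N + 9 : ℕ) → ‖f i‖ ≤ R) → ∀ (l : Fin 3) (i : ℤ), |i| ≤ N →
      ‖dispRaise 𝒮.C.e 𝒮.C.g l f i‖ ≤ M * R)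
    (hb : ∀ κ ∈ 𝒮.S, ∀ i : ℤ, |i| ≤ (N + 9 : ℕ) →
      ‖u n x κ i‖ ≤ b κ ∧ ‖fderiv ℝ (fun x' => u n x' κ i) x‖ ≤ b κ ∧
      ‖𝒮.ρ n x κ * 𝒮.C.c κ i‖ ≤ r κ) (l : Fin 3) {p : ℂ × ℂ} (h₁ : p.1 ∈ 𝒮.S)
    (h₂ : p.2 ∈ 𝒮.S) :
    ‖pairingDeriv 𝒮 u n i j l x p‖ ≤ (1 + M) * (b p.1 * r p.2) := by
  have up : ∀ {m : ℤ}, |m| ≤ N → |m| ≤ (N + 9 : ℕ) := fun h => h.trans (by push_cast; omega)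
  have hbi := hb p.1 h₁ i (up hi)
  have b0 : 0 ≤ b p.1 := (norm_nonneg _).trans hbi.1
  have hdisp : ‖𝒮.C.dispersion ((l : ℕ) + 1) p.2 * (𝒮.ρ n x p.2 * 𝒮.C.c p.2 j)‖ ≤ M * r p.2 := by
    have := hM (fun m => 𝒮.ρ n x p.2 • 𝒮.C.c p.2 m) (r p.2) N
      (fun m hm => (hb p.2 h₂ m hm).2.2) l j hj
    have e : dispRaise 𝒮.C.e 𝒮.C.g l (fun m => 𝒮.ρ n x p.2 • 𝒮.C.c p.2 m) j
        = 𝒮.C.dispersion ((l : ℕ) + 1) p.2 * (𝒮.ρ n x p.2 * 𝒮.C.c p.2 j) := by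
      rw [mul_left_comm, dispersion_mul_c (𝒮.S_regular h₂)]
      unfold dispRaise
      have hraise : ∀ f : ℤ → ℂ, raise 𝒮.C.e 𝒮.C.g (fun m => 𝒮.ρ n x p.2 • f m)
          = fun m => 𝒮.ρ n x p.2 • raise 𝒮.C.e 𝒮.C.g f m := fun f => by
        funext m
        simpa using raise_mul 𝒮.C.e 𝒮.C.g (𝒮.ρ n x p.2) 1 f m
      fin_cases l
      · exact congrFun (hraise _) j
      · simp; ring
      · change raise _ _ (raise _ _ (raise _ _ _)) j = _
        rw [hraise, hraise, hraise]
        rfl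
    rwa [e] at this
  have e : pairingDeriv 𝒮 u n i j l x p
      = pd l (fun x => u n x p.1 i) x * (𝒮.ρ n x p.2 * 𝒮.C.c p.2 j)
        + u n x p.1 i * (𝒮.C.dispersion ((l : ℕ) + 1) p.2 * (𝒮.ρ n x p.2 * 𝒮.C.c p.2 j)) := by
    simp only [pairingDeriv, pairing]; ring
  rw [e]
  refine (norm_add_le _ _).trans ?_
  have hd := (norm_pd_le (fun x => u n x p.1 i) l x).trans hbi.2.1
  rw [show (1 + M) * (b p.1 * r p.2) = b p.1 * r p.2 + b p.1 * (M * r p.2) by ring]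
  exact add_le_add
    ((norm_mul_le _ _).trans (mul_le_mul hd (hb p.2 h₂ j (up hj)).2.2 (norm_nonneg _) b0))
    ((norm_mul_le _ _).trans (mul_le_mul hbi.1 hdisp (norm_nonneg _) b0))

theorem aestronglyMeasurable_pairingDeriv (hs : 𝒮.IsSolution X u) (hr : 𝒮.IsRegular X u)
    (hX : IsOpen X) (hx : x ∈ X) (n i j : ℤ) (l : Fin 3) :
    AEStronglyMeasurable (pairingDeriv 𝒮 u n i j l x) 𝒮.ζ.base :=
  (aestronglyMeasurable_pairing (aestronglyMeasurable_pd hs hr hX hx n i l) j).add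
    (((𝒮.C.measurable_dispersion _).comp measurable_snd).aestronglyMeasurable.mul
      (aestronglyMeasurable_pairing (hs.measurable n x hx i) j))

/-- Differentiation of the weighted pairings under the integral sign. -/
theorem hasFDerivAt_weighted (hs : 𝒮.IsSolution X u) (hr : 𝒮.IsRegular X u) (hX : IsOpen X)
    (hx : x ∈ X) (n i j : ℤ) {θ : ℂ × ℂ → ℂ} (hθ : Measurable θ)
    (hint : ∀ b r : ℂ → ℝ,
      Integrable (fun p : ℂ × ℂ => ‖𝒮.ζ.density p‖ * b p.1 * r p.2) 𝒮.ζ.base →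
      (∀ κ ∈ 𝒮.S, Integrable
        (fun p : ℂ × ℂ => ‖𝒮.ζ.density p‖ * b p.1 * ‖𝒮.C.Ω κ p.2‖ * r p.2) 𝒮.ζ.base) →
      Integrable (fun p : ℂ × ℂ => ‖θ p‖ * (b p.1 * r p.2)) 𝒮.ζ.base) :
    (∀ l, Integrable (fun p => θ p * pairingDeriv 𝒮 u n i j l x p) 𝒮.ζ.base) ∧
    HasFDerivAt (fun x => ∫ p, θ p * 𝒮.pairing n x (fun κ => u n x κ i) j p ∂𝒮.ζ.base)
      (∑ l, (∫ p, θ p * pairingDeriv 𝒮 u n i j l x p ∂𝒮.ζ.base) • coord l) x := by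
  obtain ⟨M, hM⟩ := exists_dispRaise_bound 𝒮.C.e 𝒮.C.g
  obtain ⟨N, hi, hj⟩ : ∃ N : ℕ, |i| ≤ N ∧ |j| ≤ N :=
    ⟨max i.natAbs j.natAbs, by push_cast; exact le_max_of_le_left (by simp),
      by push_cast; exact le_max_of_le_right (by simp)⟩
  -- Differentiating the plane wave multiplies it by a dispersion coefficient, which shifts labels
  -- by up to nine; the bounds have to cover these labels too.
  obtain ⟨b, r, hb, h₁, h₂, -⟩ := hr.dominated n x hx (N + 9)
  have hbr := hint b r h₁ h₂
  have up : ∀ {m : ℤ}, |m| ≤ N → |m| ≤ (N + 9 : ℕ) := fun h => h.trans (by push_cast; omega)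
  have hl : ∀ l, Integrable (fun p => θ p * pairingDeriv 𝒮 u n i j l x p) 𝒮.ζ.base := fun l => by
    refine (hbr.const_mul (1 + M)).mono' (hθ.aestronglyMeasurable.mul
      (aestronglyMeasurable_pairingDeriv hs hr hX hx n i j l)) ?_
    filter_upwards [𝒮.concentrated] with p hp
    rw [norm_mul, mul_left_comm]
    gcongr
    exact norm_pairingDeriv_le hi hj hM hb.self_of_nhds l hp.1 hp.2
  refine ⟨hl, ?_⟩
  have key := hasFDerivAt_integral_of_dominated_of_fderiv_le (𝕜 := ℝ) (μ := 𝒮.ζ.base)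
    (F := fun x p => θ p * 𝒮.pairing n x (fun κ => u n x κ i) j p)
    (F' := fun x p => ∑ l, (θ p * pairingDeriv 𝒮 u n i j l x p) • coord l)
    (bound := fun p => ∑ l, (1 + M) * (‖θ p‖ * (b p.1 * r p.2)) * ‖coord l‖)
    (x₀ := x) (hb.and (hX.mem_nhds hx)) ?_ ?_ ?_ ?_ ?_ ?_
  · refine key.congr_fderiv ?_
    rw [integral_finsetSum _ fun l _ => (hl l).smul_const (coord l)]
    refine Finset.sum_congr rfl fun l _ => ?_
    exact integral_smul_const _ _
  · filter_upwards [hX.mem_nhds hx] with y hy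
    exact hθ.aestronglyMeasurable.mul (aestronglyMeasurable_pairing (hs.measurable n y hy i) j)
  · refine hbr.mono' (hθ.aestronglyMeasurable.mul
      (aestronglyMeasurable_pairing (hs.measurable n x hx i) j)) ?_
    filter_upwards [𝒮.concentrated] with p hp
    rw [norm_mul]
    gcongr
    exact norm_pairing_le (fun κ hκ => (hb.self_of_nhds κ hκ i (up hi)).1)
      (fun κ hκ => (hb.self_of_nhds κ hκ j (up hj)).2.2) hp.1 hp.2
  · exact (integrable_finsetSum _ fun l _ => (hl l).smul_const (coord l)).aestronglyMeasurable
  · filter_upwards [𝒮.concentrated] with p hp y hy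
    refine (norm_sum_le _ _).trans (Finset.sum_le_sum fun l _ => ?_)
    rw [norm_smul, norm_mul, mul_left_comm (1 + M)]
    gcongr
    exact norm_pairingDeriv_le hi hj hM hy.1 l hp.1 hp.2
  · exact integrable_finsetSum _ fun l _ => (hbr.const_mul _).mul_const _
  · filter_upwards [𝒮.concentrated] with p hp y hy
    refine ((hasFDerivAt_pairing hr hX hy.2 n i j hp.1).const_mul (θ p)).congr_fderiv ?_
    rw [Finset.smul_sum]
    exact Finset.sum_congr rfl fun l _ => smul_smul _ _ _

/-- The derivative of a component of the solution, as an admissible function. -/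
def dsol (hs : 𝒮.IsSolution X u) (hr : 𝒮.IsRegular X u) (hX : IsOpen X) (hx : x ∈ X) (n i : ℤ)
    (l : Fin 3) : 𝒮.admissible n x :=
  ⟨fun κ => pd l (fun x => u n x κ i) x, by
    refine mem_admissible_of_bound (aestronglyMeasurable_pd hs hr hX hx n i l) fun N => ?_
    obtain ⟨b, r, hb, h₁, h₂, -⟩ := hr.dominated n x hx (max N i.natAbs)
    have hb' := hb.self_of_nhds
    refine ⟨b, r, fun κ hκ => (norm_pd_le _ l x).trans (hb' κ hκ i ?_).2.1,
      fun κ hκ l hl => (hb' κ hκ l ?_).2.2, h₁, h₂⟩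
    · push_cast; exact le_max_of_le_right (by simp)
    · push_cast; exact le_max_of_le_left hl⟩

theorem hasInt_dispRaise {F : ℤ → ℂ × ℂ → ℂ} {z : ℤ → ℂ} (h : ∀ i, 𝒮.ζ.HasInt (F i) (z i))
    (e g : ℂ) (l : Fin 3) (i : ℤ) :
    𝒮.ζ.HasInt (fun p => dispRaise e g l (fun m => F m p) i) (dispRaise e g l z i) := by
  fin_cases l
  · exact hasInt_raise h e g i
  · exact (h _).sub ((h _).const_mul _)
  · exact hasInt_raise (hasInt_raise (hasInt_raise h e g) e g) e g i

theorem dispersion_mul_pairing {f : ℂ → ℂ} (a : ℂ) (l : Fin 3) (i : ℤ) {p : ℂ × ℂ}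
    (hp : p.2 ∈ 𝒮.S) :
    dispRaise 𝒮.C.e 𝒮.C.g l (fun m => a * 𝒮.pairing n x f m p) i
      = a * (𝒮.C.dispersion ((l : ℕ) + 1) p.2 * 𝒮.pairing n x f i p) := by
  have e1 : (fun m => a * 𝒮.pairing n x f m p)
      = fun m => (a * f p.1) * 𝒮.C.c p.2 m * 𝒮.ρ n x p.2 := by
    funext m; simp only [pairing]; ring
  have hraise : ∀ (a b : ℂ) (f : ℤ → ℂ), raise 𝒮.C.e 𝒮.C.g (fun m => a * f m * b)
      = fun m => a * raise 𝒮.C.e 𝒮.C.g f m * b := fun a b f => by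
    funext m; exact raise_mul _ _ _ _ _ _
  have h1 := dispersion_mul_c (𝒮.S_regular hp) l i
  have h2 : 𝒮.C.dispersion ((l : ℕ) + 1) p.2 * 𝒮.pairing n x f i p
      = f p.1 * dispRaise 𝒮.C.e 𝒮.C.g l (𝒮.C.c p.2) i * 𝒮.ρ n x p.2 := by
    rw [← h1]; simp only [pairing]; ring
  rw [h2, e1]
  fin_cases l
  · simp only [dispRaise, Matrix.cons_val_zero, Fin.zero_eta, hraise]; ring
  · simp [dispRaise]; ring
  · simp only [dispRaise, Fin.reduceFinMk, Matrix.cons_val, hraise]; ring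

theorem hasFDerivAt_U (hs : 𝒮.IsSolution X u) (hr : 𝒮.IsRegular X u) (hX : IsOpen X)
    (hx : x ∈ X) (n i j : ℤ) :
    HasFDerivAt (𝒮.U u n i j) (∑ l, (pairW j (dsol hs hr hX hx n i l)
      + dispRaise 𝒮.C.e 𝒮.C.g l (fun m => 𝒮.U u n i m x) j) • coord l) x := by
  refine (hasFDerivAt_weighted hs hr hX hx n i j 𝒮.ζ.measurable_density
    (fun b r h _ => by simpa only [mul_assoc] using h)).2.congr_fderiv ?_
  refine Finset.sum_congr rfl fun l _ => ?_
  congr 1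
  refine ((((hasInt_pairW (dsol hs hr hX hx n i l) j).add (hasInt_dispRaise
    (fun m => hasInt_pairW (sol hs hr hx n i) m) 𝒮.C.e 𝒮.C.g l j))).congr ?_).2
  filter_upwards [𝒮.concentrated] with p hp
  have := dispersion_mul_pairing (n := n) (x := x) (f := sol hs hr hx n i) 1 l j hp.2
  simp only [one_mul] at this
  rw [this]
  rfl

theorem hasFDerivAt_T (hs : 𝒮.IsSolution X u) (hr : 𝒮.IsRegular X u) (hX : IsOpen X)
    (hx : x ∈ X) (n i : ℤ) (κ : 𝒮.S) :
    HasFDerivAt (fun x => 𝒮.ζ.int fun p => 𝒮.C.Ω κ p.2 * 𝒮.pairing n x (fun κ => u n x κ i) 0 p)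
      (∑ l, (pairT κ 0 (dsol hs hr hX hx n i l)
      + dispRaise 𝒮.C.e 𝒮.C.g l (fun m => pairT κ m (sol hs hr hx n i)) 0) • coord l) x := by
  have h := (hasFDerivAt_weighted hs hr hX hx n i 0
    (θ := fun p => 𝒮.ζ.density p * 𝒮.C.Ω κ p.2)
    (𝒮.ζ.measurable_density.mul (measurable_Ω_right κ))
    (fun b r _ h => (h κ κ.2).congr (ae_of_all _ fun p => by
      simp only [norm_mul]; ring))).2
  simp only [mul_assoc] at h
  refine h.congr_fderiv ?_
  refine Finset.sum_congr rfl fun l _ => ?_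
  congr 1
  refine (((hasInt_pairT (dsol hs hr hX hx n i l) κ 0).add (hasInt_dispRaise
    (fun m => hasInt_pairT (sol hs hr hx n i) κ m) 𝒮.C.e 𝒮.C.g l 0)).congr ?_).2
  filter_upwards [𝒮.concentrated] with p hp
  rw [dispersion_mul_pairing (n := n) (x := x) (f := sol hs hr hx n i) _ l 0 hp.2]
  simp only [pairingDeriv]
  rw [mul_add]
  rfl

theorem pd_U (hs : 𝒮.IsSolution X u) (hr : 𝒮.IsRegular X u) (hX : IsOpen X)
    (hx : x ∈ X) (n i j : ℤ) (l : Fin 3) :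
    pd l (𝒮.U u n i j) x = pairW j (dsol hs hr hX hx n i l)
      + dispRaise 𝒮.C.e 𝒮.C.g l (fun m => 𝒮.U u n i m x) j := by
  rw [pd, (hasFDerivAt_U hs hr hX hx n i j).fderiv, sum_coord_single]

/-- The differentiated integral equation. The bracket collects the dispersion coefficients from both
plane wave factors next to the kernel, which is exactly the combination that the kernel identities
reduce. -/
theorem integralOp_dsol (hs : 𝒮.IsSolution X u) (hr : 𝒮.IsRegular X u) (hX : IsOpen X)
    (hx : x ∈ X) (n i : ℤ) (l : Fin 3) (κ : 𝒮.S) :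
    integralOp κ (dsol hs hr hX hx n i l) = 𝒮.ρ n x κ *
      (dispRaise 𝒮.C.e 𝒮.C.g l (𝒮.C.c κ) i
        - (𝒮.C.dispersion ((l : ℕ) + 1) κ * pairT κ 0 (sol hs hr hx n i)
        + dispRaise 𝒮.C.e 𝒮.C.g l (fun m => pairT κ m (sol hs hr hx n i)) 0)) := by
  have hT := hasFDerivAt_T hs hr hX hx n i κ
  have hρ := hasFDerivAt_ρ (𝒮 := 𝒮) n x κ
  have h1 := hρ.mul ((hasFDerivAt_const (𝒮.C.c κ i) x).sub hT)
  -- The equation is solved for `u`, so that the derivative of `u` is read off from those of `ρ_n`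
  -- and of the integral.
  have h2 : (fun x => u n x κ i) =ᶠ[𝓝 x] fun x => 𝒮.ρ n x κ * (𝒮.C.c κ i
      - 𝒮.ζ.int fun p => 𝒮.C.Ω κ p.2 * 𝒮.pairing n x (fun κ => u n x κ i) 0 p) := by
    filter_upwards [hX.mem_nhds hx] with y hy
    have := integralOp_sol hs hr hy n i κ
    rw [integralOp_apply] at this
    change u n y κ i + 𝒮.ρ n y κ * (𝒮.ζ.int fun p =>
      𝒮.C.Ω κ p.2 * 𝒮.pairing n y (fun κ => u n y κ i) 0 p) = _ at this
    linear_combination this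
  have h3 : pd l (fun x => u n x κ i) x = _ :=
    (h2.pd_eq l).trans (congrArg (fun L : Times →L[ℝ] ℂ => L (Pi.single l 1)) h1.fderiv)
  rw [integralOp_apply, ← dispersion_mul_c (𝒮.S_regular κ.2)]
  change pd l (fun x => u n x κ i) x + _ = _
  rw [h3, zero_sub]
  simp only [add_apply, smul_apply, neg_apply, sum_coord_single, smul_eq_mul]
  change _ * -_ + (𝒮.C.c κ i - pairT κ 0 (sol hs hr hx n i)) * _ + _ = _
  ring

end Setting

end

/-! ### Closed evolution equations, smoothness, and the abstract hierarchy -/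

section

section Flow

variable {M N : Type*} [AddCommGroup M] [Module ℂ M] [AddCommGroup N] [Module ℂ N]

theorem raise_map (φ : M →ₗ[ℂ] N) (e g : ℂ) (f : ℤ → M) (i : ℤ) :
    φ (raise e g f i) = raise e g (fun m => φ (f m)) i := by
  unfold raise
  split_ifs <;> simp

theorem dispRaise_map (φ : M →ₗ[ℂ] N) (e g : ℂ) (l : Fin 3) (f : ℤ → M) (i : ℤ) :
    φ (Setting.dispRaise e g l f i) = Setting.dispRaise e g l (fun m => φ (f m)) i := by
  fin_cases l <;> simp [Setting.dispRaise, raise_map]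

/-- The right-hand side of the evolution of the wave functions in the time `x_{l+1}`. -/
def flow (e g : ℂ) (l : Fin 3) (U : ℤ → ℤ → ℂ) (f : ℤ → M) (i : ℤ) : M :=
  Setting.dispRaise e g l f i + (![-(U i 0 • f 2) + U i 2 • f 0,
    -(U i 0 • f 3) - U i 2 • f 1 + U i 1 • f 2 + U i 3 • f 0,
    -(U i 0 • f 4 - U i 4 • f 0 + (6 * e) • (U i 0 • f 2 - U i 2 • f 0)
      + g • (U i (-2) • f 2 - U i 2 • f (-2)) - U i 1 • f 3 + U i 3 • f 1)] : Fin 3 → M) l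

theorem flow_map (φ : M →ₗ[ℂ] N) (e g : ℂ) (l : Fin 3) (U : ℤ → ℤ → ℂ) (f : ℤ → M) (i : ℤ) :
    φ (flow e g l U f i) = flow e g l U (fun m => φ (f m)) i := by
  unfold flow
  rw [map_add, dispRaise_map]
  fin_cases l <;> simp

variable {X : Set Times} {m : WithTop ℕ∞}

theorem contDiffOn_raise {f : ℤ → Times → ℂ} (hf : ∀ i, ContDiffOn ℝ m (f i) X) (e g : ℂ)
    (i : ℤ) : ContDiffOn ℝ m (fun x => raise e g (fun l => f l x) i) X := by
  unfold raise
  split_ifs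
  · exact hf _
  · exact ((hf _).add ((hf _).const_smul _)).add ((hf _).const_smul _)

theorem contDiffOn_dispRaise {f : ℤ → Times → ℂ} (hf : ∀ i, ContDiffOn ℝ m (f i) X) (e g : ℂ)
    (l : Fin 3) (i : ℤ) :
    ContDiffOn ℝ m (fun x => Setting.dispRaise e g l (fun k => f k x) i) X := by
  fin_cases l
  · exact contDiffOn_raise hf e g i
  · exact (hf _).sub ((hf _).const_smul _)
  · exact contDiffOn_raise (contDiffOn_raise (contDiffOn_raise hf e g) e g) e g i

theorem contDiffOn_flow {f : ℤ → Times → ℂ} (hf : ∀ i, ContDiffOn ℝ m (f i) X)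
    {U : ℤ → ℤ → Times → ℂ} (hU : ∀ i j, ContDiffOn ℝ m (U i j) X) (e g : ℂ)
    (l : Fin 3) (i : ℤ) :
    ContDiffOn ℝ m (fun x => flow e g l (fun i j => U i j x) (fun k => f k x) i) X := by
  have h : ∀ a b c, ContDiffOn ℝ m (fun x => U a b x • f c x) X := fun a b c => (hU a b).smul (hf c)
  refine (contDiffOn_dispRaise hf e g l i).add ?_
  fin_cases l
  · exact (h _ _ _).neg.add (h _ _ _)
  · exact (((h _ _ _).neg.sub (h _ _ _)).add (h _ _ _)).add (h _ _ _)
  · exact ((((((h _ _ _).sub (h _ _ _)).add (((h _ _ _).sub (h _ _ _)).const_smul _)).add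
      (((h _ _ _).sub (h _ _ _)).const_smul _)).sub (h _ _ _)).add (h _ _ _)).neg

theorem contDiffOn_succ_of_pd (hX : IsOpen X) {f : Times → ℂ} {k : ℕ}
    (hd : ∀ x ∈ X, DifferentiableAt ℝ f x) (h : ∀ l, ContDiffOn ℝ k (pd l f) X) :
    ContDiffOn ℝ (k + 1 : ℕ) f X := by
  have e : ((k + 1 : ℕ) : WithTop ℕ∞) = (k : WithTop ℕ∞) + 1 := by push_cast; rfl
  rw [e, contDiffOn_succ_iff_fderiv_of_isOpen hX]
  refine ⟨fun x hx => (hd x hx).differentiableWithinAt, by simp, ?_⟩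
  have : fderiv ℝ f = fun x => ∑ l, pd l f x • Setting.coord l := by
    funext x; exact Setting.clm_eq_sum _
  rw [this]
  exact ContDiffOn.sum fun l _ => (h l).smul contDiffOn_const

end Flow

namespace Setting

open SkewMeasure

variable {𝒮 : Setting} {X : Set Times} {u : ℤ → Times → ℂ → ℤ → ℂ} {n : ℤ} {x : Times}

/-- The operator sends the `m`-th solution to `ρ_n c^[m]`, and `flow` commutes with linear maps, so
both sides have computable images. These agree by the kernel identity belonging to the time in
question. -/
theorem dsol_eqOn (hs : 𝒮.IsSolution X u) (hr : 𝒮.IsRegular X u) (hX : IsOpen X)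
    (hh : ∀ n, ∀ x ∈ X, 𝒮.HomogeneousTrivial n x) (hx : x ∈ X) (n i : ℤ) (l : Fin 3) (κ : 𝒮.S) :
    (dsol hs hr hX hx n i l : ℂ → ℂ) κ
      = ((flow 𝒮.C.e 𝒮.C.g l (fun i j => 𝒮.U u n i j x) (sol hs hr hx n) i :
          𝒮.admissible n x) : ℂ → ℂ) κ := by
  refine eqOn_of_integralOp_eq (hh n x hx) (fun κ => ?_) κ
  rw [flow_map, integralOp_dsol]
  have hκ := 𝒮.S_regular κ.2
  have e : (fun m => integralOp κ (sol hs hr hx n m))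
      = fun m => (LinearMap.mulLeft ℂ (𝒮.ρ n x κ)) (𝒮.C.c κ m) := by
    funext m; rw [integralOp_sol]; rfl
  rw [e, ← flow_map, LinearMap.mulLeft_apply, flow]
  congr 1
  rw [sub_eq_add_neg]
  congr 1
  have k1 := kernel_one (sol hs hr hx n i) κ
  have k2 := kernel_two (sol hs hr hx n i) κ
  have k3 := kernel_three (sol hs hr hx n i) κ
  simp only [pairW_sol] at k1 k2 k3
  fin_cases l
  · simp only [dispRaise, Curve.dispersion, Curve.c_two, Curve.c_zero]
    norm_num [raise]
    linear_combination -k1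
  · simp [dispRaise, Curve.dispersion, Curve.c_two, Curve.c_zero, Curve.c_one, Curve.c_three]
    linear_combination -k2
  · have h3 : ¬ Even 3 := by decide
    simp [dispRaise, Curve.dispersion, Curve.c_two, Curve.c_zero, Curve.c_one, Curve.c_three,
      Curve.c_four, Curve.c_neg_two, h3]
    linear_combination -k3

theorem pd_sol (hs : 𝒮.IsSolution X u) (hr : 𝒮.IsRegular X u) (hX : IsOpen X)
    (hh : ∀ n, ∀ x ∈ X, 𝒮.HomogeneousTrivial n x) (hx : x ∈ X) (n i : ℤ) (l : Fin 3) (κ : 𝒮.S) :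
    pd l (fun x => u n x κ i) x
      = flow 𝒮.C.e 𝒮.C.g l (fun i j => 𝒮.U u n i j x) (u n x κ) i := by
  have h := flow_map ((LinearMap.proj (R := ℂ) (φ := fun _ : ℂ => ℂ) (κ : ℂ)).comp
    (𝒮.admissible n x).subtype) 𝒮.C.e 𝒮.C.g l (fun i j => 𝒮.U u n i j x) (sol hs hr hx n) i
  have h1 : (dsol hs hr hX hx n i l : ℂ → ℂ) κ = pd l (fun x => u n x κ i) x := rfl
  have h2 : (fun m => ((LinearMap.proj (R := ℂ) (φ := fun _ : ℂ => ℂ) (κ : ℂ)).comp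
    (𝒮.admissible n x).subtype) (sol hs hr hx n m)) = u n x κ := rfl
  rw [h2] at h
  rw [← h1, dsol_eqOn hs hr hX hh hx n i l κ, ← h]
  rfl

theorem pd_U_eq (hs : 𝒮.IsSolution X u) (hr : 𝒮.IsRegular X u) (hX : IsOpen X)
    (hh : ∀ n, ∀ x ∈ X, 𝒮.HomogeneousTrivial n x) (hx : x ∈ X) (n i j : ℤ) (l : Fin 3) :
    pd l (𝒮.U u n i j) x
      = flow 𝒮.C.e 𝒮.C.g l (fun i j => 𝒮.U u n i j x) (fun m => 𝒮.U u n m j x) i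
        + dispRaise 𝒮.C.e 𝒮.C.g l (fun m => 𝒮.U u n i m x) j := by
  rw [pd_U hs hr hX hx, pairW_congr (dsol_eqOn hs hr hX hh hx n i l), flow_map]
  rfl

/-- First derivatives of the entries and wave functions are polynomials in the same quantities, so
each order of smoothness gives the next. Differentiability alone starts the induction. -/
theorem contDiffOn_nat (hs : 𝒮.IsSolution X u) (hr : 𝒮.IsRegular X u) (hX : IsOpen X)
    (hh : ∀ n, ∀ x ∈ X, 𝒮.HomogeneousTrivial n x) (n : ℤ) (k : ℕ) :
    (∀ i j, ContDiffOn ℝ k (𝒮.U u n i j) X) ∧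
      ∀ κ : 𝒮.S, ∀ i, ContDiffOn ℝ k (fun x => u n x κ i) X := by
  have dU : ∀ i j, ∀ x ∈ X, DifferentiableAt ℝ (𝒮.U u n i j) x := fun i j x hx =>
    (hasFDerivAt_U hs hr hX hx n i j).differentiableAt
  have du : ∀ (κ : 𝒮.S) i, ∀ x ∈ X, DifferentiableAt ℝ (fun x => u n x κ i) x :=
    fun κ i x hx => differentiableAt_sol hr hX hx n i κ.2
  induction k with
  | zero =>
    simp only [Nat.cast_zero, contDiffOn_zero]
    exact ⟨fun i j x hx => (dU i j x hx).continuousAt.continuousWithinAt,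
      fun κ i x hx => (du κ i x hx).continuousAt.continuousWithinAt⟩
  | succ k ih =>
    refine ⟨fun i j => contDiffOn_succ_of_pd hX (dU i j) fun l => ?_,
      fun κ i => contDiffOn_succ_of_pd hX (du κ i) fun l => ?_⟩
    · exact ((contDiffOn_flow (fun m => ih.1 m j) ih.1 _ _ l i).add
        (contDiffOn_dispRaise (ih.1 i) _ _ l j)).congr
        fun x hx => pd_U_eq hs hr hX hh hx n i j l
    · exact (contDiffOn_flow (ih.2 κ) ih.1 _ _ l i).congr
        fun x hx => pd_sol hs hr hX hh hx n i l κ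

theorem contDiffOn_U (hs : 𝒮.IsSolution X u) (hr : 𝒮.IsRegular X u) (hX : IsOpen X)
    (hh : ∀ n, ∀ x ∈ X, 𝒮.HomogeneousTrivial n x) (n i j : ℤ) :
    ContDiffOn ℝ ∞ (𝒮.U u n i j) X :=
  contDiffOn_infty.2 fun k => (contDiffOn_nat hs hr hX hh n k).1 i j

theorem contDiffOn_sol (hs : 𝒮.IsSolution X u) (hr : 𝒮.IsRegular X u) (hX : IsOpen X)
    (hh : ∀ n, ∀ x ∈ X, 𝒮.HomogeneousTrivial n x) (n : ℤ) (κ : 𝒮.S) (i : ℤ) :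
    ContDiffOn ℝ ∞ (fun x => u n x κ i) X :=
  contDiffOn_infty.2 fun k => (contDiffOn_nat hs hr hX hh n k).2 κ i

/-- The potentials and wave functions satisfy the abstract relations, in the ring of smooth
functions. -/
theorem hierarchy (hs : 𝒮.IsSolution X u) (hr : 𝒮.IsRegular X u) (hX : IsOpen X)
    (hh : ∀ n, ∀ x ∈ X, 𝒮.HomogeneousTrivial n x) (κ : 𝒮.S) :
    Hierarchy (deriv' hX) 𝒮.C.e 𝒮.C.sqrtg
      (fun n i j => toSmooth (𝒮.U u n i j) (contDiffOn_U hs hr hX hh n i j))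
      (fun n i => toSmooth (fun x => u n x κ i) (contDiffOn_sol hs hr hX hh n κ i)) := by
  have rU : ∀ n i j (x : X), ev x (toSmooth (𝒮.U u n i j) (contDiffOn_U hs hr hX hh n i j))
    = 𝒮.U u n i j x := fun n i j x => rfl
  have ru : ∀ n i (x : X), ev x (toSmooth (fun x => u n x κ i) (contDiffOn_sol hs hr hX hh n κ i))
    = u n x κ i := fun n i x => rfl
  have dU : ∀ n i j l (x : X),
      ev x (deriv' hX l (toSmooth (𝒮.U u n i j) (contDiffOn_U hs hr hX hh n i j))) = _ :=
    fun n i j l x => ((represents_toSmooth _).pd hX l x).symm.trans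
      (pd_U_eq hs hr hX hh x.2 n i j l)
  have du : ∀ n i l (x : X), ev x (deriv' hX l (toSmooth (fun x => u n x κ i)
      (contDiffOn_sol hs hr hX hh n κ i))) = _ :=
    fun n i l x => ((represents_toSmooth _).pd hX l x).symm.trans
      (pd_sol hs hr hX hh x.2 n i l κ)
  have hraise : ∀ (x : X) e g (f : ℤ → smoothRing X) i,
      ev x (raise e g f i) = raise e g (fun m => ev x (f m)) i :=
    fun x e g f i => raise_map (ev x).toLinearMap e g f i
  constructor
  · intro n i j
    refine smoothRing_ext fun x => ?_
    rw [map_neg, rU, rU, U_skew hs hr x.2]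
  · intro n i
    refine smoothRing_ext fun x => ?_
    simp only [du, map_add, map_sub, map_mul, hraise, rU, ru, 𝒮.C.sqrtg_sq_eq]
    simp [flow, dispRaise]
    ring
  · intro n i
    refine smoothRing_ext fun x => ?_
    simp only [du, map_add, map_sub, map_mul, map_smul, rU, ru, 𝒮.C.sqrtg_sq_eq]
    simp [flow, dispRaise]
    ring
  · intro n i
    refine smoothRing_ext fun x => ?_
    simp only [du, map_add, map_sub, map_mul, map_smul, hraise, rU, ru, 𝒮.C.sqrtg_sq_eq]
    simp [flow, dispRaise]
    ring
  · intro n i j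
    refine smoothRing_ext fun x => ?_
    simp only [dU, map_add, map_sub, map_mul, hraise, rU, 𝒮.C.sqrtg_sq_eq]
    simp [flow, dispRaise]
    ring
  · intro n i j
    refine smoothRing_ext fun x => ?_
    simp only [dU, map_add, map_sub, map_mul, map_smul, rU, 𝒮.C.sqrtg_sq_eq]
    simp [flow, dispRaise]
    ring
  · intro n i
    refine smoothRing_ext fun x => ?_
    simp only [map_add, map_sub, map_mul, map_smul, rU, ru]
    obtain ⟨f, hf⟩ := exists_sol_succ hs hr x.2 n i
    have := sol_up hs hr hh x.2 n i f hf κ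
    rw [← congrFun hf κ]
    exact this
  · intro n i j
    refine smoothRing_ext fun x => ?_
    simp only [map_add, map_sub, map_mul, map_smul, rU]
    exact U_up hs hr hh x.2 n i j
  · intro n i
    refine smoothRing_ext fun x => ?_
    simp only [map_add, map_sub, map_mul, map_smul, rU, ru]
    exact sol_down hs hr hh x.2 n i κ

end Setting

end

/-! ### The potentials, the linear system and the Lax pair as functions on `X` -/

section

namespace Setting

open SkewMeasure

variable {𝒮 : Setting} {X : Set Times} {u : ℤ → Times → ℂ → ℤ → ℂ} {n : ℤ} {x : Times}

/-- The pointwise form of `Hierarchy.w_mul_v`, which needs no wave function and hence no choice of a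
parameter in `S`. -/
theorem potW_mul_potV (hs : 𝒮.IsSolution X u) (hr : 𝒮.IsRegular X u)
    (hh : ∀ n, ∀ x ∈ X, 𝒮.HomogeneousTrivial n x) (hx : x ∈ X) (n : ℤ) :
    𝒮.potW u (n + 1) x * 𝒮.potV u n x = 1 := by
  have h := U_up hs hr hh hx n 1 0
  have h0 : 𝒮.U u (n + 1) 1 1 x = 0 := self_eq_neg.1 (U_skew hs hr hx (n + 1) 1 1)
  norm_num [h0, 𝒮.C.sqrtg_sq_eq] at h
  have hg := mul_inv_cancel₀ 𝒮.C.g_ne_zero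
  simp only [potW, potV]
  linear_combination -𝒮.C.g⁻¹ * h + 𝒮.U u (n + 1) 1 0 x * hg

theorem contDiffOn_potV (hs : 𝒮.IsSolution X u) (hr : 𝒮.IsRegular X u) (hX : IsOpen X)
    (hh : ∀ n, ∀ x ∈ X, 𝒮.HomogeneousTrivial n x) (n : ℤ) : ContDiffOn ℝ ∞ (𝒮.potV u n) X :=
  contDiffOn_const.add (contDiffOn_const.mul (contDiffOn_U hs hr hX hh n 3 2))

theorem contDiffOn_potW (hs : 𝒮.IsSolution X u) (hr : 𝒮.IsRegular X u) (hX : IsOpen X)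
    (hh : ∀ n, ∀ x ∈ X, 𝒮.HomogeneousTrivial n x) (n : ℤ) : ContDiffOn ℝ ∞ (𝒮.potW u n) X :=
  contDiffOn_const.sub (contDiffOn_U hs hr hX hh n 1 0)

end Setting

section Linear

variable {X : Set Times} {C : Curve} {U : ℤ → ℤ → ℤ → smoothRing X} {F : ℤ → ℤ → smoothRing X}
  {u v w φ : ℤ → Times → ℂ}

/-- The linear system of a hierarchy in the ring of smooth functions. -/
theorem Hierarchy.linearSystem (hX : IsOpen X) (h : Hierarchy (deriv' hX) C.e C.sqrtg U F)
    (hu : ∀ n, Represents (u n) (U n 2 0))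
    (hv : ∀ n, Represents (v n) (1 + (C.sqrtg ^ 2)⁻¹ • U n 3 2))
    (hw : ∀ n, Represents (w n) (1 - U n 1 0)) (hφ : ∀ n, Represents (φ n) (F n 0)) (m : ℤ) :
    LinearSystem C X (u (m + 1)) (v (m + 1)) (w (m + 1)) (φ m) (φ (m + 1)) (φ (m + 2)) := by
  have hσ := C.sqrtg_ne_zero
  have lw := (hw (m + 1)).dlog hX (h.w_mul_v hσ m)
  have e₁ := h.second hσ (m + 1)
  have e₂ := h.third hσ (m + 1)
  have e₃ := h.spatial hσ m rfl
  rw [show m + 1 + 1 = m + 2 by ring] at e₁ e₂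
  constructor <;> intro x hx <;> lift x to X using hx
  · have := congrArg (ev x) e₁
    simp only [map_add, map_sub, map_neg, map_smul, map_mul, smul_eq_mul] at this
    simp only [(hφ (m + 1)).pd hX _ x, ((hφ (m + 1)).pd hX 0).pd hX _ x, (hu (m + 1)).pd hX _ x,
      hφ _ x, hv _ x, hw _ x, map_add, map_sub, map_smul, smul_eq_mul]
    linear_combination this
  · have := congrArg (ev x) e₂
    simp only [map_add, map_sub, map_smul, map_mul, smul_eq_mul] at this
    simp only [(hφ (m + 1)).pd hX _ x,
      (((hφ (m + 1)).pd hX 0).pd hX 0).pd hX 0 x, (hu (m + 1)).pd hX _ x,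
      ((hu (m + 1)).pd hX 0).pd hX 0 x, (hw (m + 1)).pd hX 0 x, hφ _ x, hv _ x, map_add, map_sub,
      map_smul, smul_eq_mul]
    linear_combination this
  · have := congrArg (ev x) e₃
    simp only [map_add, map_sub, map_smul, map_mul, smul_eq_mul] at this
    simp only [(hφ (m + 1)).pd hX 0 x, ((hφ (m + 1)).pd hX 0).pd hX 0 x, (hu (m + 1)).pd hX 0 x,
      lw _ x, (lw 0).pd hX 0 x, hφ _ x, hv _ x, hw _ x, map_add, map_sub, map_mul, map_smul,
      smul_eq_mul]
    linear_combination this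

/-- The Lax pair of a hierarchy in the ring of smooth functions. -/
theorem Hierarchy.laxPair (hX : IsOpen X) (h : Hierarchy (deriv' hX) C.e C.sqrtg U F)
    (hu : ∀ n, Represents (u n) (U n 2 0))
    (hv : ∀ n, Represents (v n) (1 + (C.sqrtg ^ 2)⁻¹ • U n 3 2))
    (hw : ∀ n, Represents (w n) (1 - U n 1 0)) (hφ : ∀ n, Represents (φ n) (F n 0)) (n : ℤ) :
    LaxPair C X (u n) (v n) (w n) ![φ n, φ (n + 1)] := by
  have hσ := C.sqrtg_ne_zero
  have hV := (mul_comm _ _).trans (h.w_mul_v hσ n)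
  have hlog : ∀ i, deriv' hX i (1 + (C.sqrtg ^ 2)⁻¹ • U n 3 2)
      = (1 + (C.sqrtg ^ 2)⁻¹ • U n 3 2)
        * (deriv' hX i (1 + (C.sqrtg ^ 2)⁻¹ • U n 3 2) * (1 - U (n + 1) 1 0)) := fun i => by
    linear_combination (-deriv' hX i (1 + (C.sqrtg ^ 2)⁻¹ • U n 3 2)) * hV
  have e₁ := h.second hσ n
  have e₂ := h.third hσ n
  -- The second row of the Lax pair at level `n` is the linear system at level `n + 1`, rewritten in
  -- the potentials of level `n`.
  have f₁ := h.second hσ (n + 1)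
  have f₂ := h.third hσ (n + 1)
  rw [show n + 1 + 1 = n + 2 by ring] at f₁ f₂
  have e₃ := lax_snd_of_linear (deriv'_comm hX 1 0) C.e C.sqrtg (h.w_mul_v hσ n) (hlog 0)
    (hlog 1) rfl (h.u_succ hσ n) f₁ f₂ (h.spatial hσ n rfl)
  have h₁ : Represents ((![φ n, φ (n + 1)] : Fin 2 → Times → ℂ) 0) (F n 0) := hφ n
  have h₂ : Represents ((![φ n, φ (n + 1)] : Fin 2 → Times → ℂ) 1) (F (n + 1) 0) := hφ (n + 1)
  intro x hx i
  lift x to X using hx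
  fin_cases i
  · refine ⟨((hφ n).pd hX 1 x).trans (Eq.trans ?_
      (represents_laxP_fst hX (hu n) (hv n) (hw n) h₁ h₂ x).symm),
      ((hφ n).pd hX 2 x).trans (Eq.trans ?_
      (represents_laxQ_fst hX (hu n) (hv n) (hw n) h₁ h₂ x).symm)⟩
    · rw [e₁, ringP₁]
      congr 1
      algebra
    · rw [e₂, ringQ₁]
      congr 1
      algebra
  · exact ⟨((hφ (n + 1)).pd hX 1 x).trans ((congrArg (ev x) e₃.1).trans
      (represents_laxP_snd hX (hu n) (hv n) hV h₁ h₂ rfl rfl x).symm),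
      ((hφ (n + 1)).pd hX 2 x).trans ((congrArg (ev x) e₃.2).trans
      (represents_laxQ_snd hX (hu n) (hv n) hV h₁ h₂ rfl rfl x).symm)⟩

end Linear

end

end EllipticKP

end

/-! ### Assembly of the claims -/

open EllipticKP in
theorem mainTheorem3 :
    -- the linear system and its Lax form, for solutions of the linear integral equation
    (∀ (𝒮 : Setting) (X : Set Times) (u : ℤ → Times → ℂ → ℤ → ℂ), IsOpen X →
      𝒮.IsSolution X u → 𝒮.IsRegular X u →
      (∀ n, ∀ x ∈ X, 𝒮.HomogeneousTrivial n x) →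
      ∀ n : ℤ,
        (ContDiffOn ℝ ∞ (𝒮.potU u n) X ∧ ContDiffOn ℝ ∞ (𝒮.potV u n) X ∧
          ContDiffOn ℝ ∞ (𝒮.potW u n) X) ∧
        (∀ x ∈ X, 𝒮.potV u n x ≠ 0 ∧ 𝒮.potW u n x ≠ 0) ∧
        ∀ κ ∈ 𝒮.S,
          ContDiffOn ℝ ∞ (waveφ u κ n) X ∧
          LinearSystem 𝒮.C X (𝒮.potU u n) (𝒮.potV u n) (𝒮.potW u n)
            (waveφ u κ (n - 1)) (waveφ u κ n) (waveφ u κ (n + 1)) ∧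
          LaxPair 𝒮.C X (𝒮.potU u n) (𝒮.potV u n) (𝒮.potW u n)
            ![waveφ u κ n, waveφ u κ (n + 1)]) ∧
    -- the zero curvature equation on an arbitrary open region
    (∀ (C : Curve) (X : Set Times) (u v w : Times → ℂ), IsOpen X →
      ContDiffOn ℝ ∞ u X → ContDiffOn ℝ ∞ v X → ContDiffOn ℝ ∞ w X → (∀ x ∈ X, v x ≠ 0) →
      (ZeroCurvature C X u v w ↔
        ∃ s a : Times → ℂ, ContDiffOn ℝ ∞ a X ∧ (∀ x ∈ X, D₁ a x = 0 ∧ D₂ a x = 0) ∧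
          EllipticCKPWith C X u v w s a)) ∧
    -- the zero curvature equation for potentials with the background `u = 0`, `v = w = 1`
    (∀ (C : Curve) (u v w : Times → ℂ) (l : Filter ℝ), (l = Filter.atBot ∨ l = Filter.atTop) →
      ContDiff ℝ ∞ u → ContDiff ℝ ∞ v → ContDiff ℝ ∞ w → (∀ x, v x ≠ 0) →
      VanishesWithDerivatives l u → VanishesWithDerivatives l (fun x => v x - 1) →
      VanishesWithDerivatives l (fun x => w x - 1) →
      (ZeroCurvature C Set.univ u v w ↔
        ∃ s : Times → ℂ, VanishesAlong l s ∧ EllipticCKP C Set.univ u v w s)) := by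
  refine ⟨fun 𝒮 X u hX hs hr hh n => ⟨⟨Setting.contDiffOn_U hs hr hX hh n 2 0,
    Setting.contDiffOn_potV hs hr hX hh n, Setting.contDiffOn_potW hs hr hX hh n⟩,
    fun x hx => ⟨?_, ?_⟩, fun κ hκ => ⟨Setting.contDiffOn_sol hs hr hX hh n ⟨κ, hκ⟩ 0, ?_⟩⟩,
    fun C X u v w hX hu hv hw hv0 => zeroCurvature_iff C hX hu hv hw hv0,
    fun C u v w l hl hu hv hw hv0 lu lv lw =>
      zeroCurvature_univ_iff C hl hu hv hw hv0 lu lv lw⟩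
  · exact right_ne_zero_of_mul_eq_one (Setting.potW_mul_potV hs hr hh hx n)
  -- The partner of `w_n` is `v_{n-1}`.
  · have := Setting.potW_mul_potV hs hr hh hx (n - 1)
    rw [sub_add_cancel] at this
    exact left_ne_zero_of_mul_eq_one this
  · have h := Setting.hierarchy hs hr hX hh ⟨κ, hκ⟩
    have rv : ∀ n, Represents (𝒮.potV u n) (1 + (𝒮.C.sqrtg ^ 2)⁻¹ •
        toSmooth (𝒮.U u n 3 2) (Setting.contDiffOn_U hs hr hX hh n 3 2)) := fun n x => by
      rw [𝒮.C.sqrtg_sq_eq]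
      rfl
    refine ⟨?_, h.laxPair hX (fun n => represents_toSmooth _) rv (fun n x => rfl)
      (fun n => represents_toSmooth _) n⟩
    -- The logarithmic derivatives of `w_n` are formed with the inverse `v_{n-1}`, so the linear
    -- system is indexed from the level below.
    obtain ⟨m, rfl⟩ : ∃ m, n = m + 1 := ⟨n - 1, by ring⟩
    rw [add_sub_cancel_right, add_assoc, one_add_one_eq_two]
    exact h.linearSystem hX (fun n => represents_toSmooth _) rv (fun n x => rfl)
      (fun n => represents_toSmooth _) m
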